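/- **Theorem 7.1.** Let $N\ge 1$ be an integer, $d>0$, $p>1$, and $r_0:=\frac{N(p-1)}{d}$. Let $$G_d(x,t):=(2\pi)^{-N}\int_{\mathbb R^N}e^{ix\cdot\xi}e^{-t|\xi|^d}\,d\xi,\qquad x\in\mathbb R^N,\ t>0,$$ be the fundamental solution of $\partial_t u+(-\Delta)^{d/2}u=0$. For a locally integrable function $\phi:\mathbb R^N\to\mathbb R$ and $0<T\le\infty$, a solution in $\mathbb R^N\times[0,T)$ of $$\partial_t u+(-\Delta)^{\frac d2}u=|u|^p,\qquad u(\cdot,0)=\phi,\tag{SP}$$ is a function $u$ which is bounded and continuous on $\mathbb R^N\times(\tau,T)$ for every $\tau\in(0,T)$ and satisfies $$u(x,t)=\int_{\mathbb R^N}G_d(x-y,t)\phi(y)\,dy+\int_0^t\int_{\mathbb R^N}G_d(x-y,t-s)|u(y,s)|^p\,dy\,ds$$ for all $(x,t)\in\mathbb R^N\times(0,T)$, the integrals being absolutely convergent. Write $B(x,\sigma)$ for the open ball and $\frac{1}{|B|}\int_B$ for the mean value over a ball $B$. (a) Let $r_0<1$. There are $\gamma>0$ and $C>0$, depending only on $N,d,p$,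 and for every locally integrable $\phi$ there is a constant $C_\phi>0$, such that, whenever $T\in(0,\infty)$ and $$\sup_{x\in\mathbb R^N}\frac{1}{|B(x,T^{1/d})|}\int_{B(x,T^{1/d})}|\phi(y)|\,dy\le\gamma\,T^{-\frac{N}{dr_0}},$$ problem (SP) possesses a solution $u$ in $\mathbb R^N\times[0,T)$ such that, for $(x,t)\in\mathbb R^N\times(0,T)$, $$|u(x,t)|\le C\,T^{-\frac Nd\left(\frac1{r_0}-1\right)}\,t^{-\frac Nd}\qquad\text{and}\qquad |u(x,t)|\le C_\phi\,t^{-\frac Nd}.$$ Here $C$ is independent of $\phi$ and $T$, and $C_\phi$ is independent of $T$. (b) Let $r_0>1$. For every $q>1$ there are $\gamma>0$ and $C>0$, depending only on $N,d,p,q$, such that, whenever $\phi$ is locally integrable, $T\in(0,\infty]$ and $$\sup_{x\in\mathbb R^N}\ \sup_{0<\sigma<T^{1/d}}\sigma^{\frac N{r_0}}\left(\frac{1}{|B(x,\sigma)|}\int_{B(x,\sigma)}|\phi(y)|^q\,dy\right)^{\frac1q}\le\gamma,$$ problem (SP) possesses a solution $u$ in $\mathbb R^N\times[0,T)$ such that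 $|u(x,t)|\le C\,t^{-\frac{N}{dr_0}}$ for $(x,t)\in\mathbb R^N\times(0,T)$. (c) Let $r_0=1$ and $\beta>0$, and set, for $s\ge 0$ and $s>0$ respectively, $$\Phi(s):=s[\log(e+s)]^\beta,\qquad \rho(s):=s^{-N}\left[\log\left(e+s^{-1}\right)\right]^{-\frac Nd},$$ and let $\Phi^{-1}$ be the inverse of the bijection $\Phi:[0,\infty)\to[0,\infty)$. There are $\gamma>0$ and $C>0$, depending only on $N,d,p,\beta$, such that, whenever $\phi$ is locally integrable, $T\in(0,\infty)$, and, for all $0<\sigma<T^{1/d}$ and $x\in\mathbb R^N$, the function $\Phi(T^{N/d}|\phi|)$ is integrable on $B(x,\sigma)$ with $$\sup_{x\in\mathbb R^N}\Phi^{-1}\left(\frac{1}{|B(x,\sigma)|}\int_{B(x,\sigma)}\Phi\left(T^{\frac Nd}|\phi(y)|\right)dy\right)\le\gamma\,\rho\left(\sigma T^{-\frac1d}\right),\qquad 0<\sigma<T^{\frac1d},$$ problem (SP) possesses a solution $u$ in $\mathbb R^N\times[0,T)$ such that $$|u(x,t)|\le C\,t^{-\frac Nd}\left|\log\frac{t}{2T}\right|^{-\frac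 Nd},\qquad (x,t)\in\mathbb R^N\times(0,T).$$ -/

import Mathlib

open MeasureTheory Metric Set
open scoped ENNReal

noncomputable section

namespace FracHeat

/-- `ℝ^N` with the Euclidean norm. -/
abbrev Space (N : ℕ) : Type := EuclideanSpace ℝ (Fin N)

/-- The fundamental solution of `∂_t u + (-Δ)^{d/2} u = 0` on `ℝ^N × (0, ∞)`,
`G_d(x,t) = (2π)^{-N} ∫ e^{i x·ξ} e^{-t |ξ|^d} dξ`. The integral is real, since the Fourier symbol
is even; the real part only serves to obtain a real-valued function. -/
def kernel (N : ℕ) (d : ℝ) (x : Space N) (t : ℝ) : ℝ :=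
  ((2 * Real.pi) ^ N)⁻¹ *
    (∫ ξ : Space N, Complex.exp (Complex.I * ((inner ℝ x ξ : ℝ) : ℂ)) *
      ((Real.exp (-t * ‖ξ‖ ^ d) : ℝ) : ℂ)).re

/-- `u` is a solution in `ℝ^N × [0,T)`, where `0 < T ≤ ∞`, of
`∂_t u + (-Δ)^{d/2} u = |u|^p`, `u(·,0) = φ`: it is bounded and continuous on `ℝ^N × (τ,T)` for
every `τ ∈ (0,T)` and satisfies
`u(x,t) = ∫ G_d(x-y,t) φ(y) dy + ∫_0^t ∫ G_d(x-y,t-s) |u(y,s)|^p dy ds`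
on `ℝ^N × (0,T)`, with absolutely convergent integrals. -/
structure IsSolution (N : ℕ) (d p : ℝ) (φ : Space N → ℝ) (T : ℝ≥0∞)
    (u : Space N → ℝ → ℝ) : Prop where
  continuousOn : ∀ τ : ℝ, 0 < τ →
    ContinuousOn (fun z : Space N × ℝ => u z.1 z.2)
      {z : Space N × ℝ | τ < z.2 ∧ ENNReal.ofReal z.2 < T}
  bounded : ∀ τ : ℝ, 0 < τ →
    ∃ M : ℝ, ∀ (x : Space N) (t : ℝ), τ < t → ENNReal.ofReal t < T → |u x t| ≤ M
  integrable_initial : ∀ (x : Space N) (t : ℝ), 0 < t → ENNReal.ofReal t < T →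
    Integrable (fun y : Space N => kernel N d (x - y) t * φ y)
  integrable_duhamel : ∀ (x : Space N) (t : ℝ), 0 < t → ENNReal.ofReal t < T →
    IntegrableOn (fun z : ℝ × Space N => kernel N d (x - z.2) (t - z.1) * |u z.2 z.1| ^ p)
      (Ioo 0 t ×ˢ univ)
  integral_eq : ∀ (x : Space N) (t : ℝ), 0 < t → ENNReal.ofReal t < T →
    u x t = (∫ y : Space N, kernel N d (x - y) t * φ y) +
      ∫ s in Ioo 0 t, ∫ y : Space N, kernel N d (x - y) (t - s) * |u y s| ^ p

/-- `r_0 = N (p - 1) / d`. -/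
def r0 (N : ℕ) (d p : ℝ) : ℝ := N * (p - 1) / d

/-- `Φ(s) = s [log(e + s)]^β`. -/
def Phi (β s : ℝ) : ℝ := s * Real.log (Real.exp 1 + s) ^ β

theorem one_le_log_exp_add {s : ℝ} (hs : 0 ≤ s) : 1 ≤ Real.log (Real.exp 1 + s) := by
  rw [Real.le_log_iff_exp_le (by positivity)]; linarith
theorem Phi_bijOn {β : ℝ} (hβ : 0 < β) : BijOn (Phi β) (Ici 0) (Ici 0) := by
  have hmono : StrictMonoOn (Phi β) (Ici 0) := by
    intro a ha b hb hab
    simp only [mem_Ici] at ha hb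
    have h1 := one_le_log_exp_add ha
    have h2 : Real.log (Real.exp 1 + a) ^ β ≤ Real.log (Real.exp 1 + b) ^ β := by
      apply Real.rpow_le_rpow (by linarith) _ hβ.le
      exact Real.log_le_log (by positivity) (by linarith)
    have h3 : 0 < Real.log (Real.exp 1 + a) ^ β := Real.rpow_pos_of_pos (by linarith) _
    unfold Phi
    exact mul_lt_mul hab h2 h3 hb
  have hge : ∀ s, 0 ≤ s → s ≤ Phi β s := fun s hs => by
    have := Real.one_le_rpow (one_le_log_exp_add hs) hβ.le
    unfold Phi; nlinarith
  refine ⟨fun s hs => (mem_Ici.1 hs).trans (hge s hs), hmono.injOn, fun y hy => ?_⟩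
  have hc : ContinuousOn (Phi β) (Icc 0 y) := by
    unfold Phi
    refine continuousOn_id.mul (ContinuousOn.rpow_const (ContinuousOn.log (by fun_prop) ?_) ?_)
    · intro x hx; have := hx.1; positivity
    · intro x hx; right; exact hβ.le
  obtain ⟨x, hx, rfl⟩ := intermediate_value_Icc (mem_Ici.1 hy) hc
    (show y ∈ Icc (Phi β 0) (Phi β y) from ⟨by simpa [Phi] using hy, hge y hy⟩)
  exact ⟨x, hx.1, rfl⟩

/-- The inverse of the bijection `Φ : [0,∞) → [0,∞)`. -/
def PhiInv (β : ℝ) : ℝ → ℝ := Function.invFunOn (Phi β) (Ici 0)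

/-- `ρ(s) = s^{-N} [log(e + s^{-1})]^{-N/d}`. -/
def rho (N : ℕ) (d s : ℝ) : ℝ :=
  s ^ (-(N : ℝ)) * Real.log (Real.exp 1 + s⁻¹) ^ (-((N : ℝ) / d))

end FracHeat

end

open FracHeat

noncomputable section

namespace FracHeat

/-! ### One-variable derivative bounds -/

/-! No sign and no semigroup property of $G_d$ is used. The argument runs through the positive
kernel $K(x,t)=a^{\varepsilon}(a+|x|)^{-N-\varepsilon}$, $a=t^{1/d}$, with $0<\varepsilon\le d$ and
$\varepsilon<1$, which dominates $|G_d|$ up to a constant (`exists_abs_kernel_le`). The decay comes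
from finite differences of the symbol: if $x\cdot h=\pi$, translating $\xi$ by $h$ changes the sign
of $e^{ix\cdot\xi}$, so each difference with step $h$ multiplies the Fourier integral by $-2$. For
$h=\pi x/|x|^2$ the $(N+1)$-st difference of $e^{-|\xi|^d}$ has $L^1$ norm $O(|h|^{N+\varepsilon})$,
that is $O(|x|^{-N-\varepsilon})$. Differences, unlike derivatives, tolerate the singularity of
$|\xi|^d$ at the origin.

Two facts about $K$ replace the linear theory: $K_r*K_s\le C K_{r+s}$
(`exists_potential_potential_le`), and the potential at time $t$ is controlled by the masses of
balls of radius $t^{1/d}$ (`exists_potential_le`).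

For the nonlinear problem a barrier $W$ is sought which dominates the $K$-potential of $|\phi|$ and
whose Duhamel integral of $W^p$ is at most $\delta W$. For small $\delta$ the integral operator
preserves $|u|\le 2cW$ and contracts the weighted norm $\sup|u|/W$, so the Picard iterates converge
to a solution (`exists_solution_of_isBarrier`).

Barriers are built uniformly in `exists_solution_of_average`. Write $\Phi(s)=s\,h(s)$ with $h$
increasing, let $F$ be the $K$-potential of $\Phi(\theta|\phi|)$ and $V=\Phi^{-1}(F)$; the barrier
is a multiple of $V$. A Jensen-type inequality bounds the linear part by $V$. If $V\le\kappa(t)$ and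
$v^{p-1}\le m(t)h(v)$ for $0<v\le\kappa(t)$, then $V^p\le mF$. The semigroup inequality carries
$F(\cdot,s)$ to $CF(\cdot,t)$, so the Duhamel integral is at most $C F(t)\int_0^t m\le
C\,h(\kappa(t))\int_0^t m\cdot V(t)$. Only the smallness of $h(\kappa(t))\int_0^t m$ remains. The
three cases are $h=1$, where $m(s)\sim s^{-r_0}$ is integrable because $r_0<1$; $h(s)=s^{q-1}$,
where powers of $t$ cancel; and $h(s)=[\log(e+s)]^\beta$, where powers of $\log(2T/t)$ cancel. -/

/-- Differencing commutes with differentiation, so the induction replaces the whole chain of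
derivatives by its first differences; the mean value inequality trades the one surplus derivative
for the one difference taken. -/
theorem norm_fwdDiff_iter_le {n : ℕ} {F : ℕ → ℝ → ℝ} {a M : ℝ}
    (hF : ∀ i < n, ∀ s ∈ Icc a (a + n), HasDerivAt (F i) (F (i + 1) s) s)
    (hM : ∀ s ∈ Icc a (a + n), |F n s| ≤ M) :
    |(fwdDiff (1 : ℝ))^[n] (F 0) a| ≤ M := by
  induction n generalizing F with
  | zero => simpa using hM a (by simp)
  | succ n ih =>
    rw [Function.iterate_succ_apply]
    push_cast at hF hM
    refine ih (F := fun i => fwdDiff (1 : ℝ) (F i)) (fun i hi s hs => ?_) fun s hs => ?_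
    · have h1 := hF i (by lia) (s + 1) ⟨by linarith [hs.1], by linarith [hs.2]⟩
      have h2 := hF i (by lia) s ⟨by linarith [hs.1], by linarith [hs.2]⟩
      exact (h1.comp_add_const s 1).sub h2
    · have := (convex_Icc s (s + 1)).norm_image_sub_le_of_norm_hasDerivWithin_le
        (f := F n) (f' := F (n + 1)) (C := M) (x := s) (y := s + 1)
        (fun y hy => (hF n (by lia) y
          ⟨by linarith [hs.1, hy.1], by linarith [hs.2, hy.2]⟩).hasDerivWithinAt)
        (fun y hy => hM y ⟨by linarith [hs.1, hy.1], by linarith [hs.2, hy.2]⟩)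
        (by simp) (by simp)
      simpa [fwdDiff] using this

theorem fwdDiff_iter_line {E : Type*} [AddCommGroup E] [Module ℝ E] (g : E → ℝ) (n : ℕ)
    (h ξ : E) : (fwdDiff h)^[n] g ξ = (fwdDiff (1 : ℝ))^[n] (fun s => g (ξ + s • h)) 0 := by
  simp [fwdDiff_iter_eq_sum_shift, ← Nat.cast_smul_eq_nsmul ℝ]

theorem hasDerivAt_iteratedDeriv {f : ℝ → ℝ} {n i : ℕ} {s : ℝ} (hf : ContDiffAt ℝ n f s)
    (hi : i < n) : HasDerivAt (iteratedDeriv i f) (iteratedDeriv (i + 1) f s) s := by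
  rw [iteratedDeriv_succ]
  refine DifferentiableAt.hasDerivAt ?_
  have h1 := hf.differentiableAt_iteratedFDeriv (m := i) (by exact_mod_cast hi)
  have : iteratedDeriv i f = fun s => iteratedFDeriv ℝ i f s (fun _ => 1) := by
    ext; rw [iteratedDeriv_eq_iteratedFDeriv]
  rw [this]
  exact h1.continuousMultilinear_apply_const _

theorem abs_iteratedDeriv_comp_le {g f : ℝ → ℝ} {n : ℕ} {s t : Set ℝ} {x C D : ℝ}
    (ht : IsOpen t) (hs : IsOpen s) (hg : ContDiffOn ℝ n g t) (hf : ContDiffOn ℝ n f s)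
    (hst : MapsTo f s t) (hx : x ∈ s) (hC : ∀ i ≤ n, |iteratedDeriv i g (f x)| ≤ C)
    (hD : ∀ i, 1 ≤ i → i ≤ n → |iteratedDeriv i f x| ≤ D ^ i) :
    |iteratedDeriv n (g ∘ f) x| ≤ n.factorial * C * D ^ n := by
  have := norm_iteratedFDerivWithin_comp_le hg hf le_rfl ht.uniqueDiffOn hs.uniqueDiffOn hst hx
    (C := C) (D := D)
    (fun i hi => by
      rw [iteratedFDerivWithin_of_isOpen i ht (hst hx), norm_iteratedFDeriv_eq_norm_iteratedDeriv]
      exact hC i hi)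
    (fun i h1 hi => by
      rw [iteratedFDerivWithin_of_isOpen i hs hx, norm_iteratedFDeriv_eq_norm_iteratedDeriv]
      exact hD i h1 hi)
  rwa [iteratedFDerivWithin_of_isOpen n hs hx, norm_iteratedFDeriv_eq_norm_iteratedDeriv] at this

theorem exists_rpow_mul_exp_neg_le (a : ℝ) (ha : 0 ≤ a) :
    ∃ C : ℝ, 0 < C ∧ ∀ x : ℝ, 0 ≤ x → x ^ a * Real.exp (-x) ≤ C := by
  obtain ⟨n, hn⟩ := exists_nat_ge a
  refine ⟨1 + n.factorial, by positivity, fun x hx => ?_⟩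
  have h1 : x ^ a ≤ 1 + x ^ n := by
    rcases le_total x 1 with h | h
    · linarith [Real.rpow_le_one hx h ha, pow_nonneg hx n]
    · have := Real.rpow_le_rpow_of_exponent_le h hn
      rw [Real.rpow_natCast] at this
      linarith
  have h2 := Real.pow_div_factorial_le_exp x hx n
  rw [div_le_iff₀ (by positivity)] at h2
  have h3 : Real.exp x * Real.exp (-x) = 1 := by rw [← Real.exp_add]; simp
  have h4 := Real.exp_pos (-x)
  have h5 : Real.exp (-x) ≤ 1 := by simpa using hx
  nlinarith [mul_le_mul_of_nonneg_right h1 h4.le, mul_le_mul_of_nonneg_right h2 h4.le]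

/-- The profile `a ↦ exp (-l a^α)` near `a = 1`, normalised to vanish there. -/
def expProfile (α l a : ℝ) : ℝ := Real.exp (-l * a ^ α) - Real.exp (-l)

theorem contDiffOn_expProfile (α l : ℝ) (n : ℕ) : ContDiffOn ℝ n (expProfile α l) (Ioi 0) := by
  unfold expProfile
  refine ContDiffOn.sub (ContDiffOn.exp (contDiffOn_const.mul ?_)) contDiffOn_const
  intro x hx
  exact (Real.contDiffAt_rpow_const_of_ne (ne_of_gt hx)).contDiffWithinAt

/-- The chain rule for $e^{-ly}$ composed with $y=a^\alpha$ produces $l^ie^{-l}$, and for $i\ge1\ge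
b$ the spare power $l^{i-b}$ is absorbed by the exponential. The order $i=0$ would violate the bound
as $l\to0$; it is harmless because the profile vanishes at $a=1$. -/
theorem exists_iteratedDeriv_expProfile_le (α b : ℝ) (hb1 : b ≤ 1) (n : ℕ) :
    ∃ C : ℝ, 0 < C ∧ ∀ l : ℝ, 0 < l → ∀ i ≤ n, |iteratedDeriv i (expProfile α l) 1| ≤ C * l ^ b := by
  have hex : ∀ i : ℕ, ∃ C : ℝ, 0 < C ∧ ∀ l : ℝ, 0 < l → 1 ≤ i → l ^ i * Real.exp (-l) ≤ C * l ^ b := by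
    intro i
    rcases Nat.eq_zero_or_pos i with rfl | hi
    · exact ⟨1, one_pos, by simp⟩
    have hi' : (1 : ℝ) ≤ i := by exact_mod_cast hi
    obtain ⟨C, hC, h⟩ := exists_rpow_mul_exp_neg_le (i - b) (by linarith)
    refine ⟨C, hC, fun l hl _ => ?_⟩
    have := mul_le_mul_of_nonneg_right (h l hl.le) (Real.rpow_nonneg hl.le b)
    rwa [mul_right_comm, ← Real.rpow_add hl, sub_add_cancel, Real.rpow_natCast] at this
  choose c hc hcl using hex
  set C₀ := ∑ i ∈ Finset.range (n + 1), c i with hC₀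
  have hC₀pos : 0 < C₀ := Finset.sum_pos (fun i _ => hc i) (by simp)
  have hcC : ∀ i ≤ n, c i ≤ C₀ := fun i hi =>
    Finset.single_le_sum (f := c) (fun j _ => (hc j).le) (by simp; lia)
  set B := 1 + ∑ i ∈ Finset.range (n + 1), |iteratedDeriv i (fun a : ℝ => a ^ α) 1| with hB
  have hB1 : 1 ≤ B := by
    have : 0 ≤ ∑ i ∈ Finset.range (n + 1), |iteratedDeriv i (fun a : ℝ => a ^ α) 1| :=
      Finset.sum_nonneg fun _ _ => abs_nonneg _
    linarith
  have hBi : ∀ i, 1 ≤ i → i ≤ n → |iteratedDeriv i (fun a : ℝ => a ^ α) 1| ≤ B ^ i := by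
    intro i h1 hi
    have h2 := Finset.single_le_sum (f := fun i => |iteratedDeriv i (fun a : ℝ => a ^ α) 1|)
      (fun j _ => abs_nonneg _) (show i ∈ Finset.range (n + 1) by simp; lia)
    calc _ ≤ B := by linarith
      _ ≤ B ^ i := le_self_pow₀ hB1 (by lia)
  refine ⟨n.factorial * C₀ * B ^ n, by positivity, fun l hl i hi => ?_⟩
  have hlb : 0 < l ^ b := Real.rpow_pos_of_pos hl b
  have hcomp : expProfile α l = (fun y => Real.exp (-l * y) - Real.exp (-l)) ∘ fun a : ℝ => a ^ α := rfl
  rw [hcomp]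
  have := abs_iteratedDeriv_comp_le (n := i) (x := 1) (s := Ioi 0) (t := univ) (C := C₀ * l ^ b)
    (D := B) (g := fun y => Real.exp (-l * y) - Real.exp (-l)) (f := fun a : ℝ => a ^ α)
    isOpen_univ isOpen_Ioi (by fun_prop)
    (fun x hx => (Real.contDiffAt_rpow_const_of_ne (ne_of_gt hx)).contDiffWithinAt)
    (fun _ _ => mem_univ _) (by simp) ?_ (fun j h1 hj => hBi j h1 (by lia))
  · refine this.trans ?_
    have h1 : (i.factorial : ℝ) ≤ n.factorial := by exact_mod_cast Nat.factorial_le hi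
    have h2 : B ^ i ≤ B ^ n := pow_le_pow_right₀ hB1 hi
    calc (i.factorial : ℝ) * (C₀ * l ^ b) * B ^ i ≤ n.factorial * (C₀ * l ^ b) * B ^ n := by gcongr
      _ = _ := by ring
  · intro j hj
    rcases Nat.eq_zero_or_pos j with rfl | hj0
    · simp; positivity
    · have h1 : iteratedDeriv j (fun y => Real.exp (-l * y) - Real.exp (-l)) ((1 : ℝ) ^ α)
          = (-l) ^ j * Real.exp (-l) := by
        have : (fun y => Real.exp (-l * y) - Real.exp (-l))
            = fun y => -Real.exp (-l) + Real.exp (-l * y) := by ext; ring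
        rw [this, iteratedDeriv_const_add hj0, iteratedDeriv_exp_const_mul]
        simp
      rw [h1, abs_mul, abs_pow, abs_neg, abs_of_pos hl, Real.abs_exp]
      refine (hcl j l hl hj0).trans ?_
      gcongr
      exact hcC j (by lia)

theorem iteratedDeriv_quadratic (A B C : ℝ) (i : ℕ) (hi : 1 ≤ i) (s : ℝ) :
    iteratedDeriv i (fun s : ℝ => A + B * s + C * s ^ 2) s =
      if i = 1 then B + 2 * C * s else if i = 2 then 2 * C else 0 := by
  obtain ⟨j, rfl⟩ : ∃ j, i = j + 1 := ⟨i - 1, by lia⟩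
  have h1 : deriv (fun s : ℝ => A + B * s + C * s ^ 2) = fun s => B + 2 * C * s := by
    ext s
    have h := (((hasDerivAt_id s).const_mul B).const_add A).add (((hasDerivAt_id s).pow 2).const_mul C)
    exact h.deriv.trans (by simp; ring)
  have h2 : deriv (fun s : ℝ => B + 2 * C * s) = fun _ => 2 * C := by
    ext s
    have h := ((hasDerivAt_id s).const_mul (2 * C)).const_add B
    exact h.deriv.trans (by simp)
  rw [iteratedDeriv_succ', h1]
  rcases j with - | j
  · simp
  · rw [iteratedDeriv_succ', h2, iteratedDeriv_const]
    rcases j with - | j <;> simp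

/-- Derivatives along lines of `ξ ↦ exp (-‖ξ‖^d)` away from the origin. -/
theorem exists_iteratedDeriv_line_le {E : Type*} [NormedAddCommGroup E] [InnerProductSpace ℝ E]
    (d ε : ℝ) (hd : 0 < d) (hεd : ε ≤ d) (n : ℕ) (hn : 1 ≤ n) :
    ∃ C : ℝ, 0 < C ∧ ∀ (ξ h : E) (s : ℝ), ξ + s • h ≠ 0 →
      |iteratedDeriv n (fun s : ℝ => Real.exp (-‖ξ + s • h‖ ^ d)) s| ≤
        C * ‖ξ + s • h‖ ^ ε * (‖h‖ / ‖ξ + s • h‖) ^ n := by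
  obtain ⟨C, hC, hCl⟩ := exists_iteratedDeriv_expProfile_le (d / 2) (ε / d)
    (by rw [div_le_one hd]; exact hεd) n
  refine ⟨n.factorial * C * 2 ^ n, by positivity, fun ξ h s hs => ?_⟩
  set r := ‖ξ + s • h‖ with hr
  have hr0 : 0 < r := norm_pos_iff.2 hs
  -- Dividing the squared norm by its value $r^2$ at the point $s$ turns the function into a profile
  -- with parameter $l=r^d$ evaluated at $Q(s)=1$, so that $l^{\varepsilon/d}=r^\varepsilon$. The
  -- inner function is only quadratic, with $i$-th derivative at $s$ at most $(2\|h\|/r)^i$.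
  set Q : ℝ → ℝ := fun s' => ‖ξ‖ ^ 2 / r ^ 2 + 2 * inner ℝ ξ h / r ^ 2 * s' + ‖h‖ ^ 2 / r ^ 2 * s' ^ 2
    with hQ
  have hQeq : ∀ s', Q s' = ‖ξ + s' • h‖ ^ 2 / r ^ 2 := by
    intro s'
    rw [norm_add_sq_real, inner_smul_right, norm_smul, mul_pow, Real.norm_eq_abs, sq_abs]
    simp only [hQ]; ring
  have hQs : Q s = 1 := by rw [hQeq, ← hr]; field_simp
  have hQc : Continuous Q := by fun_prop
  have hfun : (fun s' : ℝ => Real.exp (-‖ξ + s' • h‖ ^ d)) =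
      fun s' => Real.exp (-r ^ d) + (expProfile (d / 2) (r ^ d) ∘ Q) s' := by
    ext s'
    have : (Q s') ^ (d / 2) = ‖ξ + s' • h‖ ^ d / r ^ d := by
      rw [hQeq, Real.div_rpow (by positivity) (by positivity), ← Real.rpow_natCast,
        ← Real.rpow_natCast, ← Real.rpow_mul (by positivity), ← Real.rpow_mul (by positivity)]
      congr 2 <;> push_cast <;> ring
    simp only [Function.comp, expProfile, this]
    have hrd : r ^ d ≠ 0 := by positivity
    rw [show -r ^ d * (‖ξ + s' • h‖ ^ d / r ^ d) = -‖ξ + s' • h‖ ^ d by field_simp]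
    ring
  rw [hfun, iteratedDeriv_const_add hn]
  have hpos : s ∈ Q ⁻¹' Ioi 0 := by simp [hQs]
  have hb := abs_iteratedDeriv_comp_le (n := n) (x := s) (s := Q ⁻¹' Ioi 0) (t := Ioi 0)
    (C := C * (r ^ d) ^ (ε / d)) (D := 2 * (‖h‖ / r)) (g := expProfile (d / 2) (r ^ d)) (f := Q)
    isOpen_Ioi (isOpen_Ioi.preimage hQc) (contDiffOn_expProfile _ _ _) (by fun_prop)
    (fun _ hx => hx) hpos ?_ ?_
  · refine hb.trans (le_of_eq ?_)
    rw [← Real.rpow_mul hr0.le, mul_div_cancel₀ _ hd.ne', mul_pow]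
    ring
  · intro i hi
    rw [hQs]
    exact hCl _ (by positivity) i hi
  · intro i h1 hi
    rw [hQ, iteratedDeriv_quadratic _ _ _ _ h1]
    split_ifs with hi1 hi2
    · subst hi1
      have : 2 * inner ℝ ξ h / r ^ 2 + 2 * (‖h‖ ^ 2 / r ^ 2) * s =
          2 * inner ℝ (ξ + s • h) h / r ^ 2 := by
        rw [inner_add_left, inner_smul_left, real_inner_self_eq_norm_sq]
        simp; ring
      rw [this, pow_one, abs_div, abs_mul, abs_of_pos (show (0:ℝ) < 2 by norm_num),
        abs_of_pos (show (0:ℝ) < r ^ 2 by positivity), div_le_iff₀ (by positivity)]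
      have h3 := abs_real_inner_le_norm (ξ + s • h) h
      rw [← hr] at h3
      calc 2 * |inner ℝ (ξ + s • h) h| ≤ 2 * (r * ‖h‖) := by gcongr
        _ = _ := by field_simp
    · subst hi2
      rw [abs_of_nonneg (by positivity), mul_pow, div_pow]
      have : 0 ≤ ‖h‖ ^ 2 / r ^ 2 := by positivity
      nlinarith
    · simp; positivity

/-! ### Decay of the fundamental solution -/

theorem abs_fwdDiff_iter_le {E : Type*} [AddCommGroup E] {f : E → ℝ} {h : E} {M : ℝ} (n : ℕ) (ξ : E)
    (hM : ∀ k : ℕ, k ≤ n → |f (ξ + k • h)| ≤ M) : |(fwdDiff h)^[n] f ξ| ≤ 2 ^ n * M := by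
  induction n generalizing ξ with
  | zero => simpa using hM 0 le_rfl
  | succ n ih =>
    rw [Function.iterate_succ_apply', fwdDiff]
    have h1 := ih ξ fun k hk => hM k (by lia)
    have h2 := ih (ξ + h) fun k hk => by
      have := hM (k + 1) (by lia)
      rwa [add_smul, one_smul, add_comm (k • h), ← add_assoc] at this
    refine (abs_sub _ _).trans ?_
    rw [pow_succ]; linarith

theorem abs_exp_neg_rpow_sub_one_le {d ε r : ℝ} (hr : 0 ≤ r) (hε : 0 < ε) (hεd : ε ≤ d) :
    |Real.exp (-r ^ d) - 1| ≤ r ^ ε := by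
  have h0 : 0 ≤ r ^ d := Real.rpow_nonneg hr d
  have h1 : Real.exp (-r ^ d) ≤ 1 := by simpa using h0
  rw [abs_of_nonpos (by linarith)]
  rcases le_total r 1 with h | h
  · have h2 := Real.add_one_le_exp (-r ^ d)
    have h3 : r ^ d ≤ r ^ ε := by
      rcases hr.eq_or_lt with rfl | hr'
      · rw [Real.zero_rpow hε.ne', Real.zero_rpow (by linarith)]
      · exact Real.rpow_le_rpow_of_exponent_ge hr' h hεd
    linarith
  · have h2 := Real.one_le_rpow h hε.le
    linarith [Real.exp_pos (-r ^ d)]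

/-- Where $\|\xi\|\le 2n\|h\|$ the shifted points may meet the singularity, and smallness comes from
$|e^{-r^d}-1|\le r^\varepsilon$ alone. Farther out the segment from $\xi$ to $\xi+nh$ avoids the
origin, and $n$ differences are bounded by the $n$-th derivative along it. -/
theorem exists_fwdDiff_exp_le {E : Type*} [NormedAddCommGroup E] [InnerProductSpace ℝ E]
    (d ε : ℝ) (hd : 0 < d) (hε : 0 < ε) (hεd : ε ≤ d) (hε1 : ε ≤ 1) (n : ℕ) (hn : 1 ≤ n) :
    ∃ C : ℝ, 0 < C ∧ ∀ ξ h : E, h ≠ 0 →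
      |(fwdDiff h)^[n] (fun ξ : E => Real.exp (-‖ξ‖ ^ d)) ξ| ≤
        C * ‖h‖ ^ ε * (1 + ‖ξ‖ / ‖h‖) ^ (-(n - ε)) := by
  obtain ⟨C₁, hC₁, hder⟩ := exists_iteratedDeriv_line_le (E := E) d ε hd hεd n hn
  have hn' : (1 : ℝ) ≤ n := by exact_mod_cast hn
  have hne : 0 ≤ n - ε := by linarith
  refine ⟨C₁ * 4 ^ (n - ε) + 2 ^ n * (3 * n) ^ ε * (1 + 2 * n) ^ (n - ε), by positivity,
    fun ξ h hh => ?_⟩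
  have hh0 : 0 < ‖h‖ := norm_pos_iff.2 hh
  set y := ‖ξ‖ / ‖h‖ with hy
  have hy0 : 0 ≤ y := by positivity
  have hξ : ‖ξ‖ = y * ‖h‖ := by rw [hy]; field_simp
  have hyp : 0 < (1 + y) ^ (-(n - ε)) := by positivity
  have hhe : 0 < ‖h‖ ^ ε := by positivity
  rcases le_or_gt y (2 * n) with hle | hgt
  · -- near the origin
    have hfun : (fwdDiff h)^[n] (fun ξ : E => Real.exp (-‖ξ‖ ^ d)) ξ =
        (fwdDiff h)^[n] (fun ξ : E => Real.exp (-‖ξ‖ ^ d) - 1) ξ := by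
      obtain ⟨j, rfl⟩ : ∃ j, n = j + 1 := ⟨n - 1, by lia⟩
      rw [Function.iterate_succ_apply, Function.iterate_succ_apply]
      have : fwdDiff h (fun ξ : E => Real.exp (-‖ξ‖ ^ d)) =
          fwdDiff h fun ξ : E => Real.exp (-‖ξ‖ ^ d) - 1 := by ext ξ; simp [fwdDiff]
      rw [this]
    rw [hfun]
    have h1 : |(fwdDiff h)^[n] (fun ξ : E => Real.exp (-‖ξ‖ ^ d) - 1) ξ| ≤
        2 ^ n * (3 * n * ‖h‖) ^ ε := by
      refine abs_fwdDiff_iter_le n ξ fun k hk => ?_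
      refine (abs_exp_neg_rpow_sub_one_le (norm_nonneg _) hε hεd).trans ?_
      refine Real.rpow_le_rpow (norm_nonneg _) ?_ hε.le
      have hk' : (k : ℝ) ≤ n := by exact_mod_cast hk
      calc ‖ξ + k • h‖ ≤ ‖ξ‖ + ‖k • h‖ := norm_add_le _ _
        _ ≤ 2 * n * ‖h‖ + n * ‖h‖ := by
          rw [← Nat.cast_smul_eq_nsmul ℝ, norm_smul, hξ, Real.norm_natCast]
          gcongr
        _ = _ := by ring
    rw [Real.mul_rpow (by positivity) (by positivity)] at h1
    have h2 : 1 ≤ (1 + 2 * n) ^ (n - ε) * (1 + y) ^ (-(n - ε)) := by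
      rw [Real.rpow_neg (by positivity), ← div_eq_mul_inv, one_le_div (by positivity)]
      exact Real.rpow_le_rpow (by positivity) (by linarith) hne
    calc _ ≤ _ := h1
      _ = (2 ^ n * (3 * n) ^ ε * ‖h‖ ^ ε) * 1 := by ring
      _ ≤ (2 ^ n * (3 * n) ^ ε * ‖h‖ ^ ε) * ((1 + 2 * n) ^ (n - ε) * (1 + y) ^ (-(n - ε))) := by
          gcongr
      _ = 2 ^ n * (3 * n) ^ ε * (1 + 2 * n) ^ (n - ε) * ‖h‖ ^ ε * (1 + y) ^ (-(n - ε)) := by ring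
      _ ≤ _ := by
          have : 0 ≤ C₁ * 4 ^ (n - ε) := by positivity
          gcongr
          linarith
  · -- away from the origin
    -- As $y>2n\ge2$, moving by at most $n\|h\|$ costs at most half of $\|\xi\|=y\|h\|$, and
    -- $y/2\ge(1+y)/4$.
    have hlow : ∀ s ∈ Icc (0 : ℝ) (0 + n), (1 + y) / 4 * ‖h‖ ≤ ‖ξ + s • h‖ := by
      intro s hs
      rw [zero_add] at hs
      have h1 := norm_sub_norm_le ξ (-(s • h))
      rw [sub_neg_eq_add, norm_neg, norm_smul, Real.norm_eq_abs, abs_of_nonneg hs.1, hξ] at h1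
      have h2 : s * ‖h‖ ≤ y / 2 * ‖h‖ := by gcongr; linarith [hs.2]
      have h3 : (1 + y) / 4 * ‖h‖ ≤ y / 2 * ‖h‖ :=
        mul_le_mul_of_nonneg_right (by linarith) hh0.le
      linarith
    have hne0 : ∀ s ∈ Icc (0 : ℝ) (0 + n), ξ + s • h ≠ 0 := by
      intro s hs h0
      have := hlow s hs
      rw [h0, norm_zero] at this
      have : 0 < (1 + y) / 4 * ‖h‖ := by positivity
      linarith
    rw [fwdDiff_iter_line]
    have := norm_fwdDiff_iter_le (n := n) (a := 0)
      (F := fun i => iteratedDeriv i fun s : ℝ => Real.exp (-‖ξ + s • h‖ ^ d))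
      (M := C₁ * 4 ^ (n - ε) * ‖h‖ ^ ε * (1 + y) ^ (-(n - ε))) ?_ ?_
    · rw [iteratedDeriv_zero] at this
      refine this.trans ?_
      gcongr
      have : 0 ≤ 2 ^ n * (3 * n : ℝ) ^ ε * (1 + 2 * n) ^ (n - ε) := by positivity
      linarith
    · intro i hi s hs
      refine hasDerivAt_iteratedDeriv (n := n) ?_ hi
      have h1 : ContDiffAt ℝ n (fun s : ℝ => ‖ξ + s • h‖) s :=
        ContDiffAt.norm ℝ (by fun_prop) (hne0 s hs)
      exact (((h1.rpow_const_of_ne (norm_ne_zero_iff.2 (hne0 s hs)))).neg).exp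
    · intro s hs
      refine (hder ξ h s (hne0 s hs)).trans ?_
      set r := ‖ξ + s • h‖
      have hr0 : 0 < r := norm_pos_iff.2 (hne0 s hs)
      have h1 : r ^ ε * (‖h‖ / r) ^ n = ‖h‖ ^ ε * (r / ‖h‖) ^ (-(n - ε)) := by
        rw [Real.div_rpow hr0.le hh0.le, neg_sub, Real.rpow_sub hr0, Real.rpow_sub hh0,
          Real.rpow_natCast, Real.rpow_natCast, div_pow]
        field_simp
      have h2 : (r / ‖h‖) ^ (-(n - ε)) ≤ ((1 + y) / 4) ^ (-(n - ε)) := by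
        refine Real.rpow_le_rpow_of_nonpos (by positivity) ?_ (by linarith)
        rw [le_div_iff₀ hh0]
        exact hlow s hs
      have h3 : ((1 + y) / 4) ^ (-(n - ε)) = 4 ^ (n - ε) * (1 + y) ^ (-(n - ε)) := by
        rw [Real.div_rpow (by positivity) (by positivity), Real.rpow_neg (by norm_num : (0:ℝ) ≤ 4)]
        field_simp
      rw [mul_assoc, h1]
      calc C₁ * (‖h‖ ^ ε * (r / ‖h‖) ^ (-(n - ε))) ≤ C₁ * (‖h‖ ^ ε * ((1 + y) / 4) ^ (-(n - ε))) := by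
            gcongr
        _ = _ := by rw [h3]; ring

variable {N : ℕ}

theorem integrable_exp_neg_mul_rpow {d t : ℝ} (hd : 0 < d) (ht : 0 < t) :
    Integrable fun ξ : Space N => Real.exp (-t * ‖ξ‖ ^ d) := by
  obtain ⟨C, hC, h⟩ := exists_rpow_mul_exp_neg_le (((N : ℝ) + 1) / d) (by positivity)
  have hint := integrable_one_add_norm (E := Space N) (μ := volume) (r := (N : ℝ) + 1) (by simp)
  refine (hint.const_mul (2 ^ ((N : ℝ) + 1) * (1 + C * t ^ (-(((N : ℝ) + 1) / d))))).mono' ?_ ?_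
  · refine Continuous.aestronglyMeasurable ?_
    have : Continuous fun ξ : Space N => ‖ξ‖ ^ d := continuous_norm.rpow_const fun _ => Or.inr hd.le
    fun_prop
  · refine Filter.Eventually.of_forall fun ξ => ?_
    rw [Real.norm_eq_abs, Real.abs_exp]
    set r := ‖ξ‖
    have hr : 0 ≤ r := norm_nonneg _
    have h1 := h (t * r ^ d) (by positivity)
    rw [Real.mul_rpow ht.le (by positivity), ← Real.rpow_mul hr, mul_div_cancel₀ _ hd.ne',
      ← neg_mul] at h1
    have h1' : r ^ ((N : ℝ) + 1) * Real.exp (-t * r ^ d) ≤ C * t ^ (-(((N : ℝ) + 1) / d)) := by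
      rw [Real.rpow_neg ht.le, ← div_eq_mul_inv, le_div_iff₀ (by positivity)]
      linarith
    have h2 : (1 + r) ^ ((N : ℝ) + 1) ≤ 2 ^ ((N : ℝ) + 1) * (1 + r ^ ((N : ℝ) + 1)) := by
      rcases le_total r 1 with hr1 | hr1
      · calc (1 + r) ^ ((N : ℝ) + 1) ≤ 2 ^ ((N : ℝ) + 1) := by gcongr; linarith
          _ ≤ _ := le_mul_of_one_le_right (by positivity) (by linarith [Real.rpow_nonneg hr ((N:ℝ)+1)])
      · calc (1 + r) ^ ((N : ℝ) + 1) ≤ (2 * r) ^ ((N : ℝ) + 1) := by gcongr; linarith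
          _ = 2 ^ ((N : ℝ) + 1) * r ^ ((N : ℝ) + 1) := Real.mul_rpow (by norm_num) hr
          _ ≤ _ := by gcongr; linarith
    have he : Real.exp (-t * r ^ d) ≤ 1 := by
      rw [Real.exp_le_one_iff]; have : 0 ≤ t * r ^ d := by positivity
      linarith
    rw [Real.rpow_neg (show 0 ≤ 1 + r by positivity), ← div_eq_mul_inv, le_div_iff₀ (by positivity)]
    calc Real.exp (-t * r ^ d) * (1 + r) ^ ((N : ℝ) + 1)
        ≤ Real.exp (-t * r ^ d) * (2 ^ ((N : ℝ) + 1) * (1 + r ^ ((N : ℝ) + 1))) := by gcongr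
      _ = 2 ^ ((N : ℝ) + 1) * (Real.exp (-t * r ^ d) + r ^ ((N : ℝ) + 1) * Real.exp (-t * r ^ d)) := by
          ring
      _ ≤ _ := by gcongr

/-! ### Finite differences under the Fourier integral -/

theorem norm_exp_I_inner (x ξ : Space N) :
    ‖Complex.exp (Complex.I * ((inner ℝ x ξ : ℝ) : ℂ))‖ = 1 := by
  rw [mul_comm, Complex.norm_exp_ofReal_mul_I]

theorem integrable_exp_I_mul {f : Space N → ℝ} (hf : Integrable f) (x : Space N) :
    Integrable fun ξ => Complex.exp (Complex.I * ((inner ℝ x ξ : ℝ) : ℂ)) * (f ξ : ℂ) := by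
  refine hf.ofReal.bdd_mul (c := 1) ?_ (Filter.Eventually.of_forall fun ξ => (norm_exp_I_inner x ξ).le)
  exact Continuous.aestronglyMeasurable (by fun_prop)

/-- The substitution $\xi\mapsto\xi+h$ multiplies the exponential by $e^{i\pi}=-1$, so the shifted
and unshifted terms add up instead of cancelling. -/
theorem integral_exp_mul_fwdDiff {f : Space N → ℝ} (hf : Integrable f) {x h : Space N}
    (hx : inner ℝ x h = Real.pi) :
    ∫ ξ, Complex.exp (Complex.I * ((inner ℝ x ξ : ℝ) : ℂ)) * ((fwdDiff h f ξ : ℝ) : ℂ) =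
      -2 * ∫ ξ, Complex.exp (Complex.I * ((inner ℝ x ξ : ℝ) : ℂ)) * (f ξ : ℂ) := by
  have h1 : ∫ ξ, Complex.exp (Complex.I * ((inner ℝ x ξ : ℝ) : ℂ)) * (f (ξ + h) : ℂ) =
      -∫ ξ, Complex.exp (Complex.I * ((inner ℝ x ξ : ℝ) : ℂ)) * (f ξ : ℂ) := by
    rw [← integral_add_right_eq_self
      (fun ξ => Complex.exp (Complex.I * ((inner ℝ x ξ : ℝ) : ℂ)) * (f ξ : ℂ)) h, ← integral_neg]
    congr 1
    ext ξ
    rw [inner_add_right, hx, Complex.ofReal_add, mul_add, Complex.exp_add, mul_comm Complex.I (Real.pi : ℂ),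
      Complex.exp_pi_mul_I]
    ring
  have h2 := integrable_exp_I_mul (hf.comp_add_right h) x
  have h3 := integrable_exp_I_mul hf x
  simp only [fwdDiff, Complex.ofReal_sub, mul_sub]
  rw [integral_sub h2 h3, h1]
  ring

theorem integral_exp_mul_fwdDiff_iter {f : Space N → ℝ} (hf : Integrable f) {x h : Space N}
    (hx : inner ℝ x h = Real.pi) (n : ℕ) :
    Integrable ((fwdDiff h)^[n] f) ∧
    ∫ ξ, Complex.exp (Complex.I * ((inner ℝ x ξ : ℝ) : ℂ)) * (((fwdDiff h)^[n] f ξ : ℝ) : ℂ) =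
      (-2) ^ n * ∫ ξ, Complex.exp (Complex.I * ((inner ℝ x ξ : ℝ) : ℂ)) * (f ξ : ℂ) := by
  induction n with
  | zero => simpa using hf
  | succ n ih =>
    rw [Function.iterate_succ_apply']
    exact ⟨(ih.1.comp_add_right h).sub ih.1, by rw [integral_exp_mul_fwdDiff ih.1 hx, ih.2]; ring⟩

theorem norm_integral_exp_mul_le {f : Space N → ℝ} {x : Space N} :
    ‖∫ ξ, Complex.exp (Complex.I * ((inner ℝ x ξ : ℝ) : ℂ)) * (f ξ : ℂ)‖ ≤ ∫ ξ, |f ξ| := by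
  refine (norm_integral_le_integral_norm _).trans (le_of_eq ?_)
  congr 1; ext ξ
  rw [norm_mul, norm_exp_I_inner, one_mul, Complex.norm_real, Real.norm_eq_abs]

/-- The characteristic function of `exp (-‖ξ‖^d)` decays like `‖x‖^{-(N+ε)}`. -/
theorem exists_norm_integral_exp_le (N : ℕ) (d ε : ℝ) (hd : 0 < d) (hε : 0 < ε) (hεd : ε ≤ d) (hε1 : ε < 1) :
    ∃ C : ℝ, 0 < C ∧ ∀ x : Space N, x ≠ 0 →
      ‖∫ ξ : Space N, Complex.exp (Complex.I * ((inner ℝ x ξ : ℝ) : ℂ)) * ((Real.exp (-‖ξ‖ ^ d) : ℝ) : ℂ)‖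
        ≤ C * ‖x‖ ^ (-((N : ℝ) + ε)) := by
  -- With $N+1$ differences the bound decays at the rate $N+1-\varepsilon>N$, hence is integrable;
  -- this is where $\varepsilon<1$ enters.
  obtain ⟨C, hC, hfd⟩ := exists_fwdDiff_exp_le (E := Space N) d ε hd hε hεd hε1.le (N + 1) (by lia)
  have hint := integrable_one_add_norm (E := Space N) (μ := volume) (r := ((N + 1 : ℕ) : ℝ) - ε)
    (by simp; linarith)
  set A := ∫ ξ : Space N, (1 + ‖ξ‖) ^ (-(((N + 1 : ℕ) : ℝ) - ε)) with hA
  have hA0 : 0 ≤ A := integral_nonneg fun ξ => by positivity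
  refine ⟨C * (A + 1) * Real.pi ^ ((N : ℝ) + ε), by positivity, fun x hx => ?_⟩
  have hx0 : 0 < ‖x‖ := norm_pos_iff.2 hx
  set h : Space N := (Real.pi / ‖x‖ ^ 2) • x with hh
  have hxh : inner ℝ x h = Real.pi := by
    rw [hh, inner_smul_right, real_inner_self_eq_norm_sq]; field_simp
  have hnorm : ‖h‖ = Real.pi / ‖x‖ := by
    rw [hh, norm_smul, Real.norm_eq_abs, abs_of_pos (by positivity)]; field_simp
  have hh0 : 0 < ‖h‖ := by rw [hnorm]; positivity
  have hg : Integrable fun ξ : Space N => Real.exp (-‖ξ‖ ^ d) := by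
    simpa using integrable_exp_neg_mul_rpow (N := N) hd one_pos
  obtain ⟨hi, he⟩ := integral_exp_mul_fwdDiff_iter hg hxh (N + 1)
  have h1 := norm_integral_exp_mul_le (f := (fwdDiff h)^[N + 1] fun ξ : Space N => Real.exp (-‖ξ‖ ^ d))
    (x := x)
  rw [he, norm_mul, norm_pow, norm_neg, Complex.norm_ofNat] at h1
  have h2 : ∫ ξ, |(fwdDiff h)^[N + 1] (fun ξ : Space N => Real.exp (-‖ξ‖ ^ d)) ξ| ≤
      C * ‖h‖ ^ ε * (‖h‖ ^ N * A) := by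
    -- Rescaling by $\|h\|$ yields the extra factor $\|h\|^N$, which together with
    -- $\|h\|^\varepsilon$ gives the exponent $N+\varepsilon$.
    have h3 : ∫ ξ : Space N, (1 + ‖ξ‖ / ‖h‖) ^ (-(((N + 1 : ℕ) : ℝ) - ε)) = ‖h‖ ^ N * A := by
      have := Measure.integral_comp_smul (volume : Measure (Space N))
        (fun ξ => (1 + ‖ξ‖) ^ (-(((N + 1 : ℕ) : ℝ) - ε))) ‖h‖⁻¹
      simp only [norm_smul, norm_inv, norm_norm, finrank_euclideanSpace, Fintype.card_fin,
        smul_eq_mul, inv_pow, inv_inv, abs_pow, abs_norm] at this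
      rw [hA, ← this]
      congr 1; ext ξ; rw [div_eq_inv_mul]
    rw [← h3, ← integral_const_mul]
    refine integral_mono hi.abs (Integrable.const_mul ?_ _) fun ξ => hfd ξ h (norm_pos_iff.1 hh0)
    have := hint.comp_smul (inv_ne_zero hh0.ne')
    refine this.congr (Filter.Eventually.of_forall fun ξ => ?_)
    simp only [norm_smul, norm_inv, norm_norm]
    rw [div_eq_inv_mul]
  have h4 : ‖h‖ ^ ε * ‖h‖ ^ N = Real.pi ^ ((N : ℝ) + ε) * ‖x‖ ^ (-((N : ℝ) + ε)) := by
    rw [← Real.rpow_natCast, ← Real.rpow_add hh0, hnorm, Real.div_rpow Real.pi_pos.le hx0.le,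
      Real.rpow_neg hx0.le, add_comm ε, div_eq_mul_inv]
  set J := ‖∫ ξ : Space N, Complex.exp (Complex.I * ((inner ℝ x ξ : ℝ) : ℂ)) *
    ((Real.exp (-‖ξ‖ ^ d) : ℝ) : ℂ)‖
  have hJ : J ≤ 2 ^ (N + 1) * J := le_mul_of_one_le_left (norm_nonneg _) (one_le_pow₀ (by norm_num))
  calc J ≤ C * ‖h‖ ^ ε * (‖h‖ ^ N * A) := hJ.trans (h1.trans h2)
    _ = C * A * (‖h‖ ^ ε * ‖h‖ ^ N) := by ring
    _ ≤ C * (A + 1) * (‖h‖ ^ ε * ‖h‖ ^ N) := by gcongr; linarith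
    _ = _ := by rw [h4]; ring

/-- The kernel `a^ε (a + ‖x‖)^{-(N+ε)}` dominating the fundamental solution at time `a^d`. -/
def majorant (N : ℕ) (ε a : ℝ) (x : Space N) : ℝ := a ^ ε * (a + ‖x‖) ^ (-((N : ℝ) + ε))

theorem kernel_scaling {d t : ℝ} (hd : 0 < d) (ht : 0 < t) (x : Space N) :
    kernel N d x t = ((t ^ (1 / d)) ^ N)⁻¹ * kernel N d ((t ^ (1 / d))⁻¹ • x) 1 := by
  set R := t ^ (1 / d) with hR
  have hR0 : 0 < R := by positivity
  have hRd : R ^ d = t := by rw [hR, ← Real.rpow_mul ht.le, one_div_mul_cancel hd.ne', Real.rpow_one]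
  have := Measure.integral_comp_smul (volume : Measure (Space N)) (fun ξ : Space N =>
    Complex.exp (Complex.I * ((inner ℝ (R⁻¹ • x) ξ : ℝ) : ℂ)) * ((Real.exp (-1 * ‖ξ‖ ^ d) : ℝ) : ℂ)) R
  unfold kernel
  have h2 : ∀ ξ : Space N, Complex.exp (Complex.I * ((inner ℝ x ξ : ℝ) : ℂ)) *
      ((Real.exp (-t * ‖ξ‖ ^ d) : ℝ) : ℂ) =
      Complex.exp (Complex.I * ((inner ℝ (R⁻¹ • x) (R • ξ) : ℝ) : ℂ)) *
        ((Real.exp (-1 * ‖R • ξ‖ ^ d) : ℝ) : ℂ) := by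
    intro ξ
    rw [inner_smul_left, inner_smul_right, norm_smul, Real.norm_eq_abs, abs_of_pos hR0,
      Real.mul_rpow hR0.le (norm_nonneg _), hRd, neg_one_mul, neg_mul]
    congr 4
    simp [hR0.ne']
  simp_rw [h2]
  rw [this]
  simp only [finrank_euclideanSpace, Fintype.card_fin, abs_of_pos (inv_pos.2 (pow_pos hR0 N))]
  rw [Complex.real_smul, Complex.re_ofReal_mul]
  ring

/-- By scaling only $t=1$ matters. There the $L^1$ norm of the symbol bounds the kernel for
$\|x\|\le1$ and the Fourier decay bounds it for $\|x\|\ge1$; both are comparable with a power of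
$1+\|x\|$. -/
theorem exists_abs_kernel_le (N : ℕ) (d ε : ℝ) (hd : 0 < d) (hε : 0 < ε) (hεd : ε ≤ d) (hε1 : ε < 1) :
    ∃ C : ℝ, 1 ≤ C ∧ ∀ (x : Space N) (t : ℝ), 0 < t →
      |kernel N d x t| ≤ C * majorant N ε (t ^ (1 / d)) x := by
  obtain ⟨C, hC, hdec⟩ := exists_norm_integral_exp_le N d ε hd hε hεd hε1
  set b := ((2 * Real.pi) ^ N)⁻¹ with hb
  have hb0 : 0 < b := by positivity
  set A := ∫ ξ : Space N, |Real.exp (-‖ξ‖ ^ d)| with hA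
  have hA0 : 0 ≤ A := integral_nonneg fun ξ => abs_nonneg _
  have hone : ∀ x : Space N, |kernel N d x 1| ≤
      b * (A + C) * 2 ^ ((N : ℝ) + ε) * (1 + ‖x‖) ^ (-((N : ℝ) + ε)) := by
    intro x
    unfold kernel
    rw [abs_mul, abs_of_pos hb0]
    simp only [neg_mul, one_mul]
    refine (mul_le_mul_of_nonneg_left (Complex.abs_re_le_norm _) hb0.le).trans ?_
    simp only [mul_assoc]
    refine mul_le_mul_of_nonneg_left ?_ hb0.le
    have hfac : ∀ r : ℝ, 0 < r → (1 + ‖x‖) ≤ 2 * r →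
        r ^ (-((N : ℝ) + ε)) ≤ 2 ^ ((N : ℝ) + ε) * (1 + ‖x‖) ^ (-((N : ℝ) + ε)) := by
      intro r hr hle
      rw [Real.rpow_neg hr.le, Real.rpow_neg (by positivity), ← div_eq_mul_inv,
        le_div_iff₀ (by positivity), inv_mul_le_iff₀ (by positivity),
        ← Real.mul_rpow hr.le (by norm_num)]
      exact Real.rpow_le_rpow (by positivity) (by linarith) (by positivity)
    rcases le_total ‖x‖ 1 with hx | hx
    · have h1 := hfac 1 one_pos (by linarith)
      rw [Real.one_rpow] at h1
      calc _ ≤ A := norm_integral_exp_mul_le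
        _ ≤ (A + C) * 1 := by linarith
        _ ≤ _ := by gcongr
    · have hx0 : 0 < ‖x‖ := by linarith
      calc _ ≤ C * ‖x‖ ^ (-((N : ℝ) + ε)) := hdec x (norm_pos_iff.1 hx0)
        _ ≤ (A + C) * ‖x‖ ^ (-((N : ℝ) + ε)) := by gcongr; linarith
        _ ≤ _ := by gcongr; exact hfac _ hx0 (by linarith)
  refine ⟨max 1 (b * (A + C) * 2 ^ ((N : ℝ) + ε)), le_max_left _ _, fun x t ht => ?_⟩
  rw [kernel_scaling hd ht, abs_mul]
  set a := t ^ (1 / d) with ha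
  have ha0 : 0 < a := by positivity
  rw [abs_of_pos (inv_pos.2 (pow_pos ha0 N))]
  have h1 := hone (a⁻¹ • x)
  have h2 : (a ^ N)⁻¹ * (1 + ‖a⁻¹ • x‖) ^ (-((N : ℝ) + ε)) = majorant N ε a x := by
    unfold majorant
    rw [norm_smul, norm_inv, Real.norm_eq_abs, abs_of_pos ha0,
      show 1 + a⁻¹ * ‖x‖ = (a + ‖x‖) / a by field_simp,
      Real.div_rpow (by positivity) ha0.le, Real.rpow_neg ha0.le, Real.rpow_add ha0,
      Real.rpow_natCast]
    field_simp
  have hm : 0 ≤ majorant N ε a x := by unfold majorant; positivity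
  calc (a ^ N)⁻¹ * |kernel N d (a⁻¹ • x) 1|
      ≤ (a ^ N)⁻¹ * (b * (A + C) * 2 ^ ((N : ℝ) + ε) * (1 + ‖a⁻¹ • x‖) ^ (-((N : ℝ) + ε))) := by gcongr
    _ = b * (A + C) * 2 ^ ((N : ℝ) + ε) * majorant N ε a x := by rw [← h2]; ring
    _ ≤ _ := by gcongr; exact le_max_right _ _

theorem continuousAt_kernel {d : ℝ} (hd : 0 < d) (x : Space N) {t : ℝ} (ht : 0 < t) :
    ContinuousAt (fun z : Space N × ℝ => kernel N d z.1 z.2) (x, t) := by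
  unfold kernel
  refine continuousAt_const.mul (Complex.continuous_re.continuousAt.comp ?_)
  have hc : Continuous fun ξ : Space N => ‖ξ‖ ^ d := continuous_norm.rpow_const fun _ => Or.inr hd.le
  refine continuousAt_of_dominated (bound := fun ξ => Real.exp (-(t / 2) * ‖ξ‖ ^ d)) ?_ ?_
    (integrable_exp_neg_mul_rpow hd (by positivity)) ?_
  · exact Filter.Eventually.of_forall fun z => Continuous.aestronglyMeasurable (by fun_prop)
  · have : ∀ᶠ z : Space N × ℝ in nhds (x, t), t / 2 < z.2 :=
      continuous_snd.continuousAt.eventually (lt_mem_nhds (show t / 2 < (x, t).2 by simp; linarith))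
    filter_upwards [this] with z hz
    refine Filter.Eventually.of_forall fun ξ => ?_
    rw [norm_mul, norm_exp_I_inner, one_mul, Complex.norm_real, Real.norm_eq_abs, Real.abs_exp]
    gcongr
  · exact Filter.Eventually.of_forall fun ξ => Continuous.continuousAt (by fun_prop)

/-! ### The majorant kernel -/

theorem majorant_pos {ε a : ℝ} (ha : 0 < a) (x : Space N) : 0 < majorant N ε a x := by
  unfold majorant; positivity

theorem majorant_nonneg {ε a : ℝ} (ha : 0 ≤ a) (x : Space N) : 0 ≤ majorant N ε a x := by
  unfold majorant; positivity

theorem measurable_majorant (ε : ℝ) :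
    Measurable fun z : ℝ × Space N => majorant N ε z.1 z.2 := by
  unfold majorant
  have h1 : Measurable fun z : ℝ × Space N => z.1 ^ ε := measurable_fst.pow_const ε
  have h2 : Measurable fun z : ℝ × Space N => (z.1 + ‖z.2‖) ^ (-((N : ℝ) + ε)) :=
    (measurable_fst.add measurable_snd.norm).pow_const _
  exact h1.mul h2

theorem majorant_le_majorant {ε a b c : ℝ} (hε : 0 < ε) (ha : 0 < a) (hab : a ≤ b) (hc : 0 < c)
    {x y : Space N} (h : b + ‖y‖ ≤ c * (a + ‖x‖)) :
    majorant N ε a x ≤ c ^ ((N : ℝ) + ε) * majorant N ε b y := by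
  have hb : 0 < b := ha.trans_le hab
  unfold majorant
  have h1 : (a + ‖x‖) ^ (-((N : ℝ) + ε)) ≤ c ^ ((N : ℝ) + ε) * (b + ‖y‖) ^ (-((N : ℝ) + ε)) := by
    rw [Real.rpow_neg (by positivity), Real.rpow_neg (by positivity), ← div_eq_mul_inv,
      le_div_iff₀ (by positivity), inv_mul_le_iff₀ (by positivity),
      ← Real.mul_rpow (by positivity) hc.le]
    exact Real.rpow_le_rpow (by positivity) (by linarith) (by positivity)
  calc a ^ ε * (a + ‖x‖) ^ (-((N : ℝ) + ε))
      ≤ b ^ ε * (c ^ ((N : ℝ) + ε) * (b + ‖y‖) ^ (-((N : ℝ) + ε))) := by gcongr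
    _ = _ := by ring

/-- Whichever of $\|u\|$ and $b+\|v\|$ is larger is comparable with $\tau+\|u+v\|$, so the
corresponding factor is at most a multiple of the kernel at $u+v$. The other factor is kept and
bounded by the sum. -/
theorem majorant_mul_le_of_le {ε a b c τ : ℝ} (hε : 0 < ε) (ha : 0 < a) (hab : a ≤ b) (hbτ : b ≤ τ)
    (hc : 1 ≤ c) (hτ : τ ≤ c * b) (u v : Space N) :
    majorant N ε a u * majorant N ε b v ≤
      (2 * c) ^ ((N : ℝ) + ε) * majorant N ε τ (u + v) * (majorant N ε a u + majorant N ε b v) := by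
  have hb : 0 < b := ha.trans_le hab
  have hu := majorant_pos (ε := ε) ha u
  have hv := majorant_pos (ε := ε) hb v
  have ht := majorant_pos (ε := ε) (hb.trans_le hbτ) (u + v)
  have hn := norm_add_le u v
  have hnu := norm_nonneg u
  have hnv := norm_nonneg v
  have hP : 0 < (2 * c) ^ ((N : ℝ) + ε) * majorant N ε τ (u + v) := by positivity
  rcases le_or_gt ‖u‖ (b + ‖v‖) with h | h
  · have h1 : majorant N ε b v ≤ (2 * c) ^ ((N : ℝ) + ε) * majorant N ε τ (u + v) :=
      majorant_le_majorant hε hb hbτ (by positivity) (by nlinarith)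
    nlinarith [mul_le_mul_of_nonneg_left h1 hu.le, mul_pos hP hv]
  · have h1 : majorant N ε a u ≤ (2 * c) ^ ((N : ℝ) + ε) * majorant N ε τ (u + v) :=
      majorant_le_majorant hε ha (hab.trans hbτ) (by positivity) (by nlinarith)
    nlinarith [mul_le_mul_of_nonneg_right h1 hv.le, mul_pos hP hu]

theorem majorant_mul_le {ε d : ℝ} (hε : 0 < ε) (hd : 0 < d) {r s : ℝ} (hr : 0 < r) (hs : 0 < s)
    (u v : Space N) :
    majorant N ε (r ^ (1 / d)) u * majorant N ε (s ^ (1 / d)) v ≤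
      (2 * 2 ^ (1 / d)) ^ ((N : ℝ) + ε) * majorant N ε ((r + s) ^ (1 / d)) (u + v) *
        (majorant N ε (r ^ (1 / d)) u + majorant N ε (s ^ (1 / d)) v) := by
  have hd' : 0 ≤ 1 / d := by positivity
  have hc : (1 : ℝ) ≤ 2 ^ (1 / d) := Real.one_le_rpow (by norm_num) hd'
  -- The larger of the two times is at least half of their sum, which supplies the constant
  -- $2^{1/d}$.
  have key : ∀ r s : ℝ, 0 < r → r ≤ s → (r + s) ^ (1 / d) ≤ 2 ^ (1 / d) * s ^ (1 / d) := by
    intro r s hr hrs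
    rw [← Real.mul_rpow (by norm_num) (by linarith)]
    exact Real.rpow_le_rpow (by linarith) (by linarith) hd'
  rcases le_total r s with h | h
  · exact majorant_mul_le_of_le hε (by positivity) (Real.rpow_le_rpow hr.le h hd')
      (Real.rpow_le_rpow hs.le (by linarith) hd') hc (key r s hr h) u v
  · have := majorant_mul_le_of_le hε (by positivity) (Real.rpow_le_rpow hs.le h hd')
      (Real.rpow_le_rpow hr.le (by linarith) hd') hc (key s r hs h) v u
    rw [add_comm s r, add_comm v u] at this
    linarith

theorem lintegral_majorant {ε : ℝ} (hε : 0 < ε) :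
    ∃ A : ℝ, 0 < A ∧ ∀ a : ℝ, 0 < a → ∫⁻ x : Space N, ENNReal.ofReal (majorant N ε a x) = ENNReal.ofReal A := by
  have hint := integrable_one_add_norm (E := Space N) (μ := volume) (r := (N : ℝ) + ε)
    (by simp; exact hε)
  refine ⟨∫ x : Space N, (1 + ‖x‖) ^ (-((N : ℝ) + ε)), ?_, fun a ha => ?_⟩
  · rw [integral_pos_iff_support_of_nonneg (fun x => by positivity) hint]
    have : (Function.support fun x : Space N => (1 + ‖x‖) ^ (-((N : ℝ) + ε))) = univ := by
      ext x; simp only [Function.mem_support, mem_univ, iff_true]; positivity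
    rw [this]
    exact isOpen_univ.measure_pos volume univ_nonempty
  · have h2 : ∀ x : Space N, majorant N ε a x = (a ^ N)⁻¹ * (1 + ‖a⁻¹ • x‖) ^ (-((N : ℝ) + ε)) := by
      intro x
      unfold majorant
      rw [norm_smul, norm_inv, Real.norm_eq_abs, abs_of_pos ha,
        show 1 + a⁻¹ * ‖x‖ = (a + ‖x‖) / a by field_simp,
        Real.div_rpow (by positivity) ha.le, Real.rpow_neg ha.le, Real.rpow_add ha,
        Real.rpow_natCast]
      field_simp
    have h3 : Integrable (fun x : Space N => majorant N ε a x) := by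
      simp_rw [h2]
      exact (hint.comp_smul (inv_ne_zero ha.ne')).const_mul _
    rw [← ofReal_integral_eq_lintegral_ofReal h3
      (Filter.Eventually.of_forall fun x => majorant_nonneg ha.le x)]
    congr 1
    simp_rw [h2]
    rw [integral_const_mul, Measure.integral_comp_smul (volume : Measure (Space N))
      (fun ξ => (1 + ‖ξ‖) ^ (-((N : ℝ) + ε))) a⁻¹]
    simp only [finrank_euclideanSpace, Fintype.card_fin, smul_eq_mul, inv_pow, inv_inv, abs_pow,
      abs_of_pos ha]
    field_simp

/-- The potential `∫ K(x - y, t) μ(y) dy` of a nonnegative function with respect to the majorant. -/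
def potential (N : ℕ) (d ε : ℝ) (μ : Space N → ℝ≥0∞) (x : Space N) (t : ℝ) : ℝ≥0∞ :=
  ∫⁻ y, ENNReal.ofReal (majorant N ε (t ^ (1 / d)) (x - y)) * μ y

theorem measurable_majorant_comp {α : Type*} [MeasurableSpace α] (ε d : ℝ) {f : α → ℝ}
    {g : α → Space N} (hf : Measurable f) (hg : Measurable g) :
    Measurable fun z => ENNReal.ofReal (majorant N ε (f z ^ (1 / d)) (g z)) :=
  ((measurable_majorant ε).comp ((hf.pow_const _).prodMk hg)).ennreal_ofReal

theorem potential_congr {d ε : ℝ} {μ ν : Space N → ℝ≥0∞} (h : μ =ᵐ[volume] ν) :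
    potential N d ε μ = potential N d ε ν := by
  ext x t
  exact lintegral_congr_ae (h.mono fun y hy => by simp only [hy])

theorem measurable_potential {d ε : ℝ} {μ : Space N → ℝ≥0∞} (hμ : AEMeasurable μ) :
    Measurable fun z : Space N × ℝ => potential N d ε μ z.1 z.2 := by
  rw [potential_congr hμ.ae_eq_mk]
  unfold potential
  refine Measurable.lintegral_prod_right'
    (f := fun z : (Space N × ℝ) × Space N =>
      ENNReal.ofReal (majorant N ε (z.1.2 ^ (1 / d)) (z.1.1 - z.2)) * hμ.mk μ z.2) ?_
  exact (measurable_majorant_comp ε d (by fun_prop) (by fun_prop)).mul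
    (hμ.measurable_mk.comp measurable_snd)

/-- This stands in for the semigroup property. After Tonelli, the pointwise product bound pulls
$K_{r+s}(x-z)$ out of the inner integral, and what is left are two kernels whose total mass does not
depend on time. -/
theorem exists_potential_potential_le (N : ℕ) {d ε : ℝ} (hd : 0 < d) (hε : 0 < ε) :
    ∃ C : ℝ, 0 < C ∧ ∀ (μ : Space N → ℝ≥0∞), AEMeasurable μ → ∀ (x : Space N) (r s : ℝ), 0 < r → 0 < s →
      potential N d ε (fun y => potential N d ε μ y s) x r ≤
        ENNReal.ofReal C * potential N d ε μ x (r + s) := by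
  obtain ⟨A, hA, hAint⟩ := lintegral_majorant (N := N) hε
  set P := (2 * 2 ^ (1 / d) : ℝ) ^ ((N : ℝ) + ε) with hP
  have hP0 : 0 < P := by positivity
  refine ⟨P * (2 * A), by positivity, fun μ hμ x r s hr hs => ?_⟩
  rw [potential_congr hμ.ae_eq_mk]
  set ν := hμ.mk μ
  have hν : Measurable ν := hμ.measurable_mk
  unfold potential
  have hr' : 0 < r ^ (1 / d) := by positivity
  have hs' : 0 < s ^ (1 / d) := by positivity
  have hrs' : 0 < (r + s) ^ (1 / d) := by positivity
  have hm : ∀ (t : ℝ) , Measurable fun y : Space N =>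
      ENNReal.ofReal (majorant N ε (t ^ (1 / d)) y) := fun t =>
    measurable_majorant_comp ε d measurable_const measurable_id
  calc ∫⁻ y, ENNReal.ofReal (majorant N ε (r ^ (1 / d)) (x - y)) *
        ∫⁻ z, ENNReal.ofReal (majorant N ε (s ^ (1 / d)) (y - z)) * ν z
      = ∫⁻ y, ∫⁻ z, ENNReal.ofReal (majorant N ε (r ^ (1 / d)) (x - y)) *
          (ENNReal.ofReal (majorant N ε (s ^ (1 / d)) (y - z)) * ν z) := by
        congr 1; ext y
        rw [lintegral_const_mul]
        exact ((hm s).comp (by fun_prop)).mul hν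
    _ = ∫⁻ z, ∫⁻ y, ENNReal.ofReal (majorant N ε (r ^ (1 / d)) (x - y)) *
          (ENNReal.ofReal (majorant N ε (s ^ (1 / d)) (y - z)) * ν z) := by
        refine lintegral_lintegral_swap (Measurable.aemeasurable ?_)
        exact ((hm r).comp (by fun_prop)).mul (((hm s).comp (by fun_prop)).mul (hν.comp measurable_snd))
    _ ≤ ∫⁻ z, ENNReal.ofReal (P * (2 * A)) *
          (ENNReal.ofReal (majorant N ε ((r + s) ^ (1 / d)) (x - z)) * ν z) := by
        refine lintegral_mono fun z => ?_
        calc ∫⁻ y, ENNReal.ofReal (majorant N ε (r ^ (1 / d)) (x - y)) *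
              (ENNReal.ofReal (majorant N ε (s ^ (1 / d)) (y - z)) * ν z)
            ≤ ∫⁻ y, (ENNReal.ofReal (P * majorant N ε ((r + s) ^ (1 / d)) (x - z)) * ν z) *
                (ENNReal.ofReal (majorant N ε (r ^ (1 / d)) (x - y)) +
                  ENNReal.ofReal (majorant N ε (s ^ (1 / d)) (y - z))) := by
              refine lintegral_mono fun y => ?_
              have := majorant_mul_le hε hd hr hs (x - y) (y - z)
              rw [sub_add_sub_cancel] at this
              have h2 := ENNReal.ofReal_le_ofReal this
              rw [ENNReal.ofReal_mul (majorant_nonneg hr'.le _),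
                ENNReal.ofReal_mul (mul_nonneg hP0.le (majorant_nonneg hrs'.le _)),
                ENNReal.ofReal_add (majorant_nonneg hr'.le _) (majorant_nonneg hs'.le _)] at h2
              calc _ = ENNReal.ofReal (majorant N ε (r ^ (1 / d)) (x - y)) *
                    ENNReal.ofReal (majorant N ε (s ^ (1 / d)) (y - z)) * ν z := by ring
                _ ≤ _ := mul_le_mul_left h2 _
                _ = _ := by ring
          _ = (ENNReal.ofReal (P * majorant N ε ((r + s) ^ (1 / d)) (x - z)) * ν z) *
                (ENNReal.ofReal A + ENNReal.ofReal A) := by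
              rw [lintegral_const_mul, lintegral_add_left,
                lintegral_sub_left_eq_self
                  (fun y => ENNReal.ofReal (majorant N ε (r ^ (1 / d)) y)) x,
                lintegral_sub_right_eq_self
                  (fun y => ENNReal.ofReal (majorant N ε (s ^ (1 / d)) y)) z, hAint _ hr', hAint _ hs']
              · exact (hm r).comp (by fun_prop)
              · exact ((hm r).comp (by fun_prop)).add ((hm s).comp (by fun_prop))
          _ = _ := by
              rw [← ENNReal.ofReal_add hA.le hA.le, ENNReal.ofReal_mul hP0.le,
                ENNReal.ofReal_mul hP0.le, two_mul]
              ring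
    _ = _ := by
        rw [lintegral_const_mul]
        exact ((hm (r + s)).comp (by fun_prop)).mul hν

/-- On a ball of radius $a=t^{1/d}$ the kernel varies only by a bounded factor. Thus $K(x-y)$ may be
replaced by its average over $z\in B(y,a)$; exchanging the integrals leaves the mass of $\mu$ on
$B(z,a)$ integrated against $K(x-z)$. No covering argument is needed. -/
theorem exists_potential_le (N : ℕ) (d : ℝ) {ε : ℝ} (hε : 0 < ε) :
    ∃ C : ℝ, 0 < C ∧ ∀ (μ : Space N → ℝ≥0∞), AEMeasurable μ → ∀ (t : ℝ), 0 < t → ∀ (S : ℝ≥0∞),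
      (∀ z, ∫⁻ y in ball z (t ^ (1 / d)), μ y ≤ S) → ∀ x : Space N,
        ENNReal.ofReal (t ^ ((N : ℝ) / d)) * potential N d ε μ x t ≤ ENNReal.ofReal C * S := by
  obtain ⟨A, hA, hAint⟩ := lintegral_majorant (N := N) hε
  set ω := volume (ball (0 : Space N) 1) with hω
  have hω0 : ω ≠ 0 := (measure_ball_pos _ _ one_pos).ne'
  have hω1 : ω ≠ ∞ := measure_ball_lt_top.ne
  set P := (2 : ℝ) ^ ((N : ℝ) + ε) with hP
  have hP0 : 0 < P := by positivity
  refine ⟨P * A / ω.toReal, by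
    have := ENNReal.toReal_pos hω0 hω1
    positivity, fun μ hμ t ht S hS x => ?_⟩
  rw [potential_congr hμ.ae_eq_mk]
  have hS' : ∀ z, ∫⁻ y in ball z (t ^ (1 / d)), hμ.mk μ y ≤ S := fun z => by
    refine le_trans (le_of_eq ?_) (hS z)
    exact lintegral_congr_ae (ae_restrict_of_ae (hμ.ae_eq_mk.mono fun y hy => hy.symm))
  set ν := hμ.mk μ
  have hν : Measurable ν := hμ.measurable_mk
  set a := t ^ (1 / d) with ha
  have ha0 : 0 < a := by positivity
  have haN : t ^ ((N : ℝ) / d) = a ^ N := by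
    rw [ha, ← Real.rpow_natCast, ← Real.rpow_mul ht.le]; congr 1; ring
  have hvol : ∀ y : Space N, volume (ball y a) = ENNReal.ofReal (a ^ N) * ω := by
    intro y
    rw [Measure.addHaar_ball_of_pos _ _ ha0]; simp [hω]
  have hm : Measurable fun y : Space N => ENNReal.ofReal (majorant N ε a y) :=
    ((measurable_majorant ε).comp (measurable_const.prodMk measurable_id)).ennreal_ofReal
  have hset : MeasurableSet {p : Space N × Space N | dist p.1 p.2 < a} :=
    measurableSet_lt (by fun_prop) measurable_const
  have key : ω * (ENNReal.ofReal (t ^ ((N : ℝ) / d)) * potential N d ε ν x t) ≤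
      ENNReal.ofReal (P * A) * S := by
    unfold potential
    rw [← ha, haN]
    calc ω * (ENNReal.ofReal (a ^ N) * ∫⁻ y, ENNReal.ofReal (majorant N ε a (x - y)) * ν y)
        = ∫⁻ y, volume (ball y a) * (ENNReal.ofReal (majorant N ε a (x - y)) * ν y) := by
          simp_rw [hvol]
          rw [lintegral_const_mul]
          · ring
          · exact (hm.comp (by fun_prop)).mul hν
      _ ≤ ∫⁻ y, ∫⁻ z in ball y a,
            ENNReal.ofReal P * (ENNReal.ofReal (majorant N ε a (x - z)) * ν y) := by
          refine lintegral_mono fun y => ?_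
          rw [mul_comm, ← setLIntegral_const]
          refine setLIntegral_mono' measurableSet_ball fun z hz => ?_
          rw [← mul_assoc]
          refine mul_le_mul_left ?_ _
          rw [← ENNReal.ofReal_mul hP0.le]
          refine ENNReal.ofReal_le_ofReal (majorant_le_majorant hε ha0 le_rfl two_pos ?_)
          have h1 : ‖x - z‖ ≤ ‖x - y‖ + ‖y - z‖ := norm_sub_le_norm_sub_add_norm_sub x y z
          have h2 : ‖y - z‖ < a := by rw [← dist_eq_norm, dist_comm]; exact hz
          linarith [norm_nonneg (x - y)]
      _ = ∫⁻ y, ∫⁻ z, {p : Space N × Space N | dist p.1 p.2 < a}.indicator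
            (fun p => ENNReal.ofReal P * (ENNReal.ofReal (majorant N ε a (x - p.2)) * ν p.1)) (y, z) := by
          congr 1; ext y
          rw [← lintegral_indicator measurableSet_ball]
          congr 1; ext z
          simp only [indicator, mem_ball, mem_ofPred_eq, dist_comm]
      _ = ∫⁻ z, ∫⁻ y, {p : Space N × Space N | dist p.1 p.2 < a}.indicator
            (fun p => ENNReal.ofReal P * (ENNReal.ofReal (majorant N ε a (x - p.2)) * ν p.1)) (y, z) := by
          refine lintegral_lintegral_swap (Measurable.aemeasurable ?_)
          refine Measurable.indicator ?_ hset
          exact ((hm.comp (by fun_prop)).mul (hν.comp measurable_fst)).const_mul _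
      _ = ∫⁻ z, ∫⁻ y in ball z a,
            ENNReal.ofReal P * ENNReal.ofReal (majorant N ε a (x - z)) * ν y := by
          congr 1; ext z
          rw [← lintegral_indicator measurableSet_ball]
          congr 1; ext y
          simp only [indicator, mem_ball, mem_ofPred_eq, mul_assoc]
      _ ≤ ∫⁻ z, ENNReal.ofReal P * ENNReal.ofReal (majorant N ε a (x - z)) * S := by
          refine lintegral_mono fun z => ?_
          rw [lintegral_const_mul _ hν]
          gcongr
          exact hS' z
      _ = _ := by
          simp_rw [mul_assoc]
          rw [lintegral_const_mul, lintegral_mul_const, lintegral_sub_left_eq_self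
            (fun y => ENNReal.ofReal (majorant N ε a y)) x, hAint _ ha0, ENNReal.ofReal_mul hP0.le]
          · ring
          · exact hm.comp (by fun_prop)
          · exact (hm.comp (by fun_prop)).mul_const _
  rw [ENNReal.ofReal_div_of_pos (ENNReal.toReal_pos hω0 hω1), ENNReal.ofReal_toReal hω1]
  rw [← ENNReal.mul_div_right_comm, ENNReal.le_div_iff_mul_le (Or.inl hω0) (Or.inl hω1), mul_comm]
  exact key

/-! ### The linear part and the Duhamel part -/

theorem measurable_kernel (d : ℝ) : Measurable fun z : Space N × ℝ => kernel N d z.1 z.2 := by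
  unfold kernel
  have h : StronglyMeasurable fun z : (Space N × ℝ) × Space N =>
      Complex.exp (Complex.I * ((inner ℝ z.1.1 z.2 : ℝ) : ℂ)) *
        ((Real.exp (-z.1.2 * ‖z.2‖ ^ d) : ℝ) : ℂ) := by
    refine Measurable.stronglyMeasurable ?_
    have h1 : Measurable fun z : (Space N × ℝ) × Space N => ‖z.2‖ ^ d :=
      (measurable_snd.norm).pow_const d
    fun_prop
  exact (Complex.measurable_re.comp h.integral_prod_right'.measurable).const_mul _

/-- A Harnack-type comparison on a parabolic neighbourhood of $(x_0,r)$. It supplies the dominating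
functions for continuity of the linear and Duhamel terms. -/
theorem majorant_shift_le {ε d : ℝ} (hε : 0 < ε) (hd : 0 < d) {r r' : ℝ} (hr : 0 < r)
    (h1 : r / 2 ≤ r') (h2 : r' ≤ 2 * r) {x x₀ : Space N} (hx : ‖x - x₀‖ ≤ r ^ (1 / d)) (y : Space N) :
    majorant N ε (r' ^ (1 / d)) (x - y) ≤
      (2 ^ (1 / d)) ^ ε * (2 * 2 ^ (1 / d)) ^ ((N : ℝ) + ε) * majorant N ε (r ^ (1 / d)) (x₀ - y) := by
  have hd' : 0 ≤ 1 / d := by positivity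
  have hr' : 0 < r' := by linarith
  set k : ℝ := 2 ^ (1 / d) with hk
  have hk1 : 1 ≤ k := Real.one_le_rpow (by norm_num) hd'
  set a := r' ^ (1 / d)
  set b := r ^ (1 / d)
  have ha : 0 < a := by positivity
  have hb : 0 < b := by positivity
  have hab : a ≤ k * b := by
    rw [hk, ← Real.mul_rpow (by norm_num) hr.le]
    exact Real.rpow_le_rpow hr'.le h2 hd'
  have hba : b ≤ k * a := by
    rw [hk, ← Real.mul_rpow (by norm_num) hr'.le]
    exact Real.rpow_le_rpow hr.le (by linarith) hd'
  have hn : ‖x₀ - y‖ ≤ ‖x - x₀‖ + ‖x - y‖ := by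
    have := norm_sub_le_norm_sub_add_norm_sub x₀ x y
    rwa [norm_sub_rev x₀ x] at this
  have hle : b + ‖x₀ - y‖ ≤ (2 * k) * (a + ‖x - y‖) := by nlinarith [norm_nonneg (x - y)]
  unfold majorant
  have h3 : (a + ‖x - y‖) ^ (-((N : ℝ) + ε)) ≤
      (2 * k) ^ ((N : ℝ) + ε) * (b + ‖x₀ - y‖) ^ (-((N : ℝ) + ε)) := by
    rw [Real.rpow_neg (by positivity), Real.rpow_neg (by positivity), ← div_eq_mul_inv,
      le_div_iff₀ (by positivity), inv_mul_le_iff₀ (by positivity),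
      ← Real.mul_rpow (by positivity) (by positivity)]
    exact Real.rpow_le_rpow (by positivity) (by linarith) (by positivity)
  calc a ^ ε * (a + ‖x - y‖) ^ (-((N : ℝ) + ε))
      ≤ (k * b) ^ ε * ((2 * k) ^ ((N : ℝ) + ε) * (b + ‖x₀ - y‖) ^ (-((N : ℝ) + ε))) := by gcongr
    _ = _ := by rw [Real.mul_rpow (by positivity) hb.le]; ring

/-- A constant `c` for which `c` times the majorant dominates the fundamental solution. -/
def KernelBound (N : ℕ) (d ε c : ℝ) : Prop :=
  ∀ (x : Space N) (t : ℝ), 0 < t → |kernel N d x t| ≤ c * majorant N ε (t ^ (1 / d)) x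

theorem KernelBound.enorm_le {d ε c : ℝ} (hc : 0 ≤ c) (h : KernelBound N d ε c) (x : Space N) {t : ℝ}
    (ht : 0 < t) :
    ‖kernel N d x t‖ₑ ≤ ENNReal.ofReal c * ENNReal.ofReal (majorant N ε (t ^ (1 / d)) x) := by
  rw [← ENNReal.ofReal_mul hc, Real.enorm_eq_ofReal_abs]
  exact ENNReal.ofReal_le_ofReal (h x t ht)

theorem KernelBound.lintegral_le {d ε c : ℝ} (hc : 0 ≤ c) (h : KernelBound N d ε c) (φ : Space N → ℝ)
    (x : Space N) {t : ℝ} (ht : 0 < t) :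
    ∫⁻ y, ‖kernel N d (x - y) t * φ y‖ₑ ≤
      ENNReal.ofReal c * potential N d ε (fun y => ‖φ y‖ₑ) x t := by
  unfold potential
  rw [← lintegral_const_mul' _ _ ENNReal.ofReal_ne_top]
  refine lintegral_mono fun y => ?_
  rw [enorm_mul, ← mul_assoc]
  gcongr
  exact h.enorm_le hc _ ht

theorem aestronglyMeasurable_kernel_mul {φ : Space N → ℝ} (hφ : AEStronglyMeasurable φ) (d : ℝ)
    (x : Space N) (t : ℝ) : AEStronglyMeasurable fun y => kernel N d (x - y) t * φ y := by
  refine AEStronglyMeasurable.mul (Measurable.aestronglyMeasurable ?_) hφ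
  exact (measurable_kernel d).comp (f := fun y : Space N => (x - y, t)) (by fun_prop)

theorem KernelBound.integrable {d ε c : ℝ} (hc : 0 ≤ c) (h : KernelBound N d ε c) {φ : Space N → ℝ}
    (hφ : AEStronglyMeasurable φ) {x : Space N} {t : ℝ} (ht : 0 < t)
    (hfin : potential N d ε (fun y => ‖φ y‖ₑ) x t < ∞) :
    Integrable fun y => kernel N d (x - y) t * φ y :=
  ⟨aestronglyMeasurable_kernel_mul hφ d x t,
    (h.lintegral_le hc φ x ht).trans_lt (ENNReal.mul_lt_top ENNReal.ofReal_lt_top hfin)⟩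

theorem integrable_majorant_mul {d ε : ℝ} {φ : Space N → ℝ}
    (hφ : AEStronglyMeasurable φ) {x : Space N} {t : ℝ} (ht : 0 < t)
    (hfin : potential N d ε (fun y => ‖φ y‖ₑ) x t < ∞) :
    Integrable fun y => majorant N ε (t ^ (1 / d)) (x - y) * ‖φ y‖ := by
  refine ⟨AEStronglyMeasurable.mul (Measurable.aestronglyMeasurable ?_) hφ.norm, ?_⟩
  · exact (measurable_majorant ε).comp (f := fun y : Space N => (t ^ (1 / d), x - y)) (by fun_prop)
  · refine lt_of_le_of_lt (lintegral_mono fun y => ?_) hfin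
    rw [enorm_mul, enorm_norm, Real.enorm_of_nonneg (majorant_nonneg (by positivity) _)]

theorem KernelBound.continuousAt_linear {d ε c : ℝ} (hd : 0 < d) (hε : 0 < ε) (hc : 0 ≤ c)
    (h : KernelBound N d ε c) {φ : Space N → ℝ}
    (hφ : AEStronglyMeasurable φ) {x₀ : Space N} {t₀ : ℝ} (ht₀ : 0 < t₀)
    (hfin : potential N d ε (fun y => ‖φ y‖ₑ) x₀ t₀ < ∞) :
    ContinuousAt (fun z : Space N × ℝ => ∫ y, kernel N d (z.1 - y) z.2 * φ y) (x₀, t₀) := by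
  set P : ℝ := (2 ^ (1 / d)) ^ ε * (2 * 2 ^ (1 / d)) ^ ((N : ℝ) + ε)
  refine continuousAt_of_dominated
    (bound := fun y => c * P * (majorant N ε (t₀ ^ (1 / d)) (x₀ - y) * ‖φ y‖)) ?_ ?_ ?_ ?_
  · exact Filter.Eventually.of_forall fun z => aestronglyMeasurable_kernel_mul hφ d z.1 z.2
  · have h1 : ∀ᶠ z : Space N × ℝ in nhds (x₀, t₀), z.2 ∈ Ioo (t₀ / 2) (2 * t₀) :=
      continuous_snd.continuousAt.eventually
        (Ioo_mem_nhds (show t₀ / 2 < (x₀, t₀).2 by simp; linarith)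
          (show (x₀, t₀).2 < 2 * t₀ by simp; linarith))
    have h2 : ∀ᶠ z : Space N × ℝ in nhds (x₀, t₀), z.1 ∈ ball x₀ (t₀ ^ (1 / d)) :=
      continuous_fst.continuousAt.eventually (ball_mem_nhds x₀ (by positivity))
    filter_upwards [h1, h2] with z hz1 hz2
    refine Filter.Eventually.of_forall fun y => ?_
    rw [norm_mul, ← mul_assoc]
    gcongr
    rw [mul_assoc]
    refine (h (z.1 - y) z.2 (by linarith [hz1.1])).trans ?_
    gcongr
    exact majorant_shift_le hε hd ht₀ hz1.1.le hz1.2.le (by rw [← dist_eq_norm]; exact (mem_ball.1 hz2).le) y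
  · exact (integrable_majorant_mul hφ ht₀ hfin).const_mul _
  · refine Filter.Eventually.of_forall fun y => ?_
    refine ContinuousAt.mul ?_ continuousAt_const
    have := continuousAt_kernel (N := N) hd (x₀ - y) ht₀
    exact ContinuousAt.comp (f := fun z : Space N × ℝ => (z.1 - y, z.2)) (x := (x₀, t₀)) this (by fun_prop)

/-- The Duhamel integrand at `(x, t)` with source `f`. -/
def duhamelIntegrand (N : ℕ) (d : ℝ) (f : Space N → ℝ → ℝ) (x : Space N) (t : ℝ) (z : ℝ × Space N) : ℝ :=
  kernel N d (x - z.2) (t - z.1) * f z.2 z.1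

theorem measurable_duhamelIntegrand (d : ℝ) {f : Space N → ℝ → ℝ}
    (hf : Measurable fun z : Space N × ℝ => f z.1 z.2) :
    Measurable fun q : (Space N × ℝ) × (ℝ × Space N) => duhamelIntegrand N d f q.1.1 q.1.2 q.2 := by
  unfold duhamelIntegrand
  refine Measurable.mul ?_ ?_
  · exact (measurable_kernel d).comp
      (f := fun q : (Space N × ℝ) × (ℝ × Space N) => (q.1.1 - q.2.2, q.1.2 - q.2.1)) (by fun_prop)
  · exact hf.comp (f := fun q : (Space N × ℝ) × (ℝ × Space N) => (q.2.2, q.2.1)) (by fun_prop)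

theorem measurable_duhamelIntegrand_right (d : ℝ) {f : Space N → ℝ → ℝ}
    (hf : Measurable fun z : Space N × ℝ => f z.1 z.2) (x : Space N) (t : ℝ) :
    Measurable (duhamelIntegrand N d f x t) :=
  (measurable_duhamelIntegrand d hf).comp (f := fun z => ((x, t), z)) (by fun_prop)

theorem volume_restrict_prod_univ (I : Set ℝ) :
    (volume : Measure (ℝ × Space N)).restrict (I ×ˢ univ) =
      ((volume : Measure ℝ).restrict I).prod volume := by
  rw [Measure.volume_eq_prod, ← Measure.prod_restrict, Measure.restrict_univ]

theorem KernelBound.lintegral_duhamel_le {d ε c : ℝ} (hc : 0 ≤ c) (h : KernelBound N d ε c)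
    {f : Space N → ℝ → ℝ} (hf : Measurable fun z : Space N × ℝ => f z.1 z.2) {I : Set ℝ}
    (hI : MeasurableSet I) {t : ℝ} (hIt : I ⊆ Iio t) (x : Space N) :
    ∫⁻ z in I ×ˢ univ, ‖duhamelIntegrand N d f x t z‖ₑ ≤
      ENNReal.ofReal c * ∫⁻ s in I, potential N d ε (fun y => ‖f y s‖ₑ) x (t - s) := by
  rw [volume_restrict_prod_univ, lintegral_prod _
    ((measurable_duhamelIntegrand_right d hf x t).enorm.aemeasurable),
    ← lintegral_const_mul' _ _ ENNReal.ofReal_ne_top]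
  have key : ∀ s ∈ I, ∫⁻ y, ‖duhamelIntegrand N d f x t (s, y)‖ₑ ≤
      ENNReal.ofReal c * potential N d ε (fun y => ‖f y s‖ₑ) x (t - s) := by
    intro s hs
    simp only [duhamelIntegrand]
    exact h.lintegral_le hc (fun y => f y s) x (sub_pos.2 (hIt hs))
  exact setLIntegral_mono' hI key

/-- The Duhamel integral as an iterated integral. -/
def duhamel (N : ℕ) (d : ℝ) (f : Space N → ℝ → ℝ) (x : Space N) (t : ℝ) : ℝ :=
  ∫ s in Ioo 0 t, ∫ y : Space N, kernel N d (x - y) (t - s) * f y s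

theorem duhamel_eq {d : ℝ} {f : Space N → ℝ → ℝ} {x : Space N} {t : ℝ}
    (h : IntegrableOn (duhamelIntegrand N d f x t) (Ioo 0 t ×ˢ univ)) :
    duhamel N d f x t = ∫ z in Ioo 0 t ×ˢ univ, duhamelIntegrand N d f x t z := by
  rw [IntegrableOn, volume_restrict_prod_univ] at h
  rw [volume_restrict_prod_univ, integral_prod _ h]
  rfl

theorem measurable_duhamel (d : ℝ) {f : Space N → ℝ → ℝ}
    (hf : Measurable fun z : Space N × ℝ => f z.1 z.2) :
    Measurable fun z : Space N × ℝ => duhamel N d f z.1 z.2 := by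
  have h1 : StronglyMeasurable fun q : ((Space N × ℝ) × ℝ) × Space N =>
      kernel N d (q.1.1.1 - q.2) (q.1.1.2 - q.1.2) * f q.2 q.1.2 := by
    refine Measurable.stronglyMeasurable ?_
    exact (measurable_duhamelIntegrand d hf).comp
      (f := fun q : ((Space N × ℝ) × ℝ) × Space N => (q.1.1, (q.1.2, q.2))) (by fun_prop)
  have h2 := h1.integral_prod_right' (ν := volume)
  -- The time domain depends on $t$, so it is moved into an indicator before integrating out $s$.
  have hset : MeasurableSet {q : (Space N × ℝ) × ℝ | q.2 ∈ Ioo 0 q.1.2} := by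
    refine (measurableSet_lt (f := fun _ : (Space N × ℝ) × ℝ => (0 : ℝ)) (by fun_prop) measurable_snd).inter ?_
    exact measurableSet_lt (f := fun q : (Space N × ℝ) × ℝ => q.2) (by fun_prop) (by fun_prop)
  have h3 := (h2.indicator hset).integral_prod_right' (ν := volume)
  convert h3.measurable using 1
  ext z
  unfold duhamel
  rw [← integral_indicator measurableSet_Ioo]
  congr 1

theorem KernelBound.integrableOn_duhamel {d ε c : ℝ} (hc : 0 ≤ c) (h : KernelBound N d ε c)
    {f : Space N → ℝ → ℝ} (hf : Measurable fun z : Space N × ℝ => f z.1 z.2) {I : Set ℝ}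
    (hI : MeasurableSet I) {t : ℝ} (hIt : I ⊆ Iio t) {x : Space N}
    (hfin : ∫⁻ s in I, potential N d ε (fun y => ‖f y s‖ₑ) x (t - s) < ∞) :
    IntegrableOn (duhamelIntegrand N d f x t) (I ×ˢ univ) :=
  ⟨(measurable_duhamelIntegrand_right d hf x t).aestronglyMeasurable,
    (h.lintegral_duhamel_le hc hf hI hIt x).trans_lt (ENNReal.mul_lt_top ENNReal.ofReal_lt_top hfin)⟩

theorem KernelBound.abs_setIntegral_duhamel_le {d ε c R : ℝ} (hc : 0 ≤ c) (hR : 0 ≤ R)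
    (h : KernelBound N d ε c)
    {f : Space N → ℝ → ℝ} (hf : Measurable fun z : Space N × ℝ => f z.1 z.2) {I : Set ℝ}
    (hI : MeasurableSet I) {t : ℝ} (hIt : I ⊆ Iio t) {x : Space N}
    (hfin : ∫⁻ s in I, potential N d ε (fun y => ‖f y s‖ₑ) x (t - s) ≤ ENNReal.ofReal R) :
    |∫ z in I ×ˢ univ, duhamelIntegrand N d f x t z| ≤ c * R := by
  have h1 := (enorm_integral_le_lintegral_enorm (μ := volume.restrict (I ×ˢ univ))
    (duhamelIntegrand N d f x t)).trans (h.lintegral_duhamel_le hc hf hI hIt x)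
  have h2 := h1.trans (mul_le_mul_right hfin _)
  rwa [← ENNReal.ofReal_mul hc, Real.enorm_eq_ofReal_abs,
    ENNReal.ofReal_le_ofReal_iff (by positivity)] at h2

theorem potential_mono {d ε : ℝ} {μ ν : Space N → ℝ≥0∞} (h : ∀ y, μ y ≤ ν y) (x : Space N) (t : ℝ) :
    potential N d ε μ x t ≤ potential N d ε ν x t :=
  lintegral_mono fun y => mul_le_mul_right (h y) _

theorem potential_const_mul {d ε b : ℝ} (μ : Space N → ℝ≥0∞) (x : Space N) (t : ℝ) :
    potential N d ε (fun y => ENNReal.ofReal b * μ y) x t =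
      ENNReal.ofReal b * potential N d ε μ x t := by
  unfold potential
  rw [← lintegral_const_mul' _ _ ENNReal.ofReal_ne_top]
  congr 1; ext y; ring

theorem exists_potential_const {ε : ℝ} (hε : 0 < ε) :
    ∃ A : ℝ, 0 < A ∧ ∀ (d t M : ℝ), 0 < t → ∀ x : Space N,
      potential N d ε (fun _ => ENNReal.ofReal M) x t = ENNReal.ofReal A * ENNReal.ofReal M := by
  obtain ⟨A, hA, hAint⟩ := lintegral_majorant (N := N) hε
  refine ⟨A, hA, fun d t M ht x => ?_⟩
  unfold potential
  rw [lintegral_mul_const' _ _ ENNReal.ofReal_ne_top, lintegral_sub_left_eq_self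
    (fun y => ENNReal.ofReal (majorant N ε (t ^ (1 / d)) y)) x, hAint _ (by positivity)]

/-- Stopping the source at $t_0-\eta$ keeps $t_0-s\ge\eta$. For $(x,t)$ close to $(x_0,t_0)$ at the
scale of $\eta$ the kernel is then dominated by a fixed multiple of its majorant at $(x_0,t_0)$. -/
theorem KernelBound.continuousAt_duhamel_head {d ε c : ℝ} (hd : 0 < d) (hε : 0 < ε) (hc : 0 ≤ c)
    (h : KernelBound N d ε c) {f : Space N → ℝ → ℝ}
    (hf : Measurable fun z : Space N × ℝ => f z.1 z.2) {x₀ : Space N} {t₀ η : ℝ} (hη : 0 < η)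
    (hfin : ∫⁻ s in Ioo 0 (t₀ - η), potential N d ε (fun y => ‖f y s‖ₑ) x₀ (t₀ - s) < ∞) :
    ContinuousAt (fun z : Space N × ℝ =>
      ∫ q in Ioo 0 (t₀ - η) ×ˢ univ, duhamelIntegrand N d f z.1 z.2 q) (x₀, t₀) := by
  set P : ℝ := (2 ^ (1 / d)) ^ ε * (2 * 2 ^ (1 / d)) ^ ((N : ℝ) + ε)
  have hset : MeasurableSet (Ioo 0 (t₀ - η) ×ˢ univ : Set (ℝ × Space N)) :=
    measurableSet_Ioo.prod MeasurableSet.univ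
  refine continuousAt_of_dominated (bound := fun q : ℝ × Space N =>
    c * P * (majorant N ε ((t₀ - q.1) ^ (1 / d)) (x₀ - q.2) * ‖f q.2 q.1‖)) ?_ ?_ ?_ ?_
  · exact Filter.Eventually.of_forall fun z =>
      (measurable_duhamelIntegrand_right d hf z.1 z.2).aestronglyMeasurable
  · have h1 : ∀ᶠ z : Space N × ℝ in nhds (x₀, t₀), z.2 ∈ Ioo (t₀ - η / 2) (t₀ + η / 2) :=
      continuous_snd.continuousAt.eventually
        (Ioo_mem_nhds (show t₀ - η / 2 < (x₀, t₀).2 by simp; linarith)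
          (show (x₀, t₀).2 < t₀ + η / 2 by simp; linarith))
    have h2 : ∀ᶠ z : Space N × ℝ in nhds (x₀, t₀), z.1 ∈ ball x₀ (η ^ (1 / d)) :=
      continuous_fst.continuousAt.eventually (ball_mem_nhds x₀ (by positivity))
    filter_upwards [h1, h2] with z hz1 hz2
    refine (ae_restrict_iff' hset).2 (Filter.Eventually.of_forall fun q hq => ?_)
    have hq1 : q.1 < t₀ - η := hq.1.2
    unfold duhamelIntegrand
    rw [norm_mul, ← mul_assoc]
    gcongr
    rw [mul_assoc]
    refine (h (z.1 - q.2) (z.2 - q.1) (by linarith [hz1.1])).trans ?_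
    gcongr
    refine majorant_shift_le hε hd (by linarith) (by linarith [hz1.1]) (by linarith [hz1.2]) ?_ q.2
    rw [← dist_eq_norm]
    exact (mem_ball.1 hz2).le.trans (Real.rpow_le_rpow hη.le (by linarith) (by positivity))
  · refine Integrable.const_mul ⟨Measurable.aestronglyMeasurable ?_, ?_⟩ _
    · refine Measurable.mul ?_ ?_
      · exact (measurable_majorant ε).comp
          (f := fun q : ℝ × Space N => ((t₀ - q.1) ^ (1 / d), x₀ - q.2))
          (((measurable_const.sub measurable_fst).pow_const _).prodMk (by fun_prop))
      · exact (hf.comp (f := fun q : ℝ × Space N => (q.2, q.1)) (by fun_prop)).norm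
    · refine lt_of_le_of_lt ?_ hfin
      have hm : Measurable fun q : ℝ × Space N =>
          ENNReal.ofReal (majorant N ε ((t₀ - q.1) ^ (1 / d)) (x₀ - q.2)) * ‖f q.2 q.1‖ₑ :=
        (measurable_majorant_comp ε d (by fun_prop) (by fun_prop)).mul
          (hf.comp (f := fun q : ℝ × Space N => (q.2, q.1)) (by fun_prop)).enorm
      have heq : ∫⁻ s in Ioo 0 (t₀ - η), potential N d ε (fun y => ‖f y s‖ₑ) x₀ (t₀ - s) =
          ∫⁻ q in Ioo 0 (t₀ - η) ×ˢ univ,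
            ENNReal.ofReal (majorant N ε ((t₀ - q.1) ^ (1 / d)) (x₀ - q.2)) * ‖f q.2 q.1‖ₑ := by
        rw [volume_restrict_prod_univ, lintegral_prod _ hm.aemeasurable]
        rfl
      rw [heq]
      refine setLIntegral_mono' hset fun q hq => ?_
      have hq1 : q.1 < t₀ - η := hq.1.2
      have hpos : 0 < t₀ - q.1 := by linarith
      rw [enorm_mul, enorm_norm, Real.enorm_of_nonneg (majorant_nonneg (by positivity) _)]
  · refine (ae_restrict_iff' hset).2 (Filter.Eventually.of_forall fun q hq => ?_)
    have hq1 : q.1 < t₀ - η := hq.1.2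
    refine ContinuousAt.mul ?_ continuousAt_const
    have := continuousAt_kernel (N := N) hd (x₀ - q.2) (show 0 < t₀ - q.1 by linarith)
    exact ContinuousAt.comp (f := fun z : Space N × ℝ => (z.1 - q.2, z.2 - q.1)) (x := (x₀, t₀)) this
      (by fun_prop)

/-- The Duhamel term is a locally uniform limit of its truncated versions: the source is bounded
near $t_0$, and the kernel has bounded mass, so the omitted tail is $O(\eta)$ uniformly. -/
theorem KernelBound.continuousAt_duhamel {d ε c : ℝ} (hd : 0 < d) (hε : 0 < ε) (hc : 0 ≤ c)
    (h : KernelBound N d ε c) {f : Space N → ℝ → ℝ}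
    (hf : Measurable fun z : Space N × ℝ => f z.1 z.2) {x₀ : Space N} {t₀ τ T' M : ℝ} (hτ : 0 < τ)
    (hτt : τ < t₀) (htT : t₀ < T') (hM : ∀ y s, τ < s → s < T' → |f y s| ≤ M)
    (hfin : ∀ x t, 0 < t → t < T' →
      ∫⁻ s in Ioo 0 t, potential N d ε (fun y => ‖f y s‖ₑ) x (t - s) < ∞) :
    ContinuousAt (fun z : Space N × ℝ => duhamel N d f z.1 z.2) (x₀, t₀) := by
  obtain ⟨A, hA, hAc⟩ := exists_potential_const (N := N) hε
  have hM0 : 0 ≤ M := (abs_nonneg _).trans (hM 0 t₀ hτt htT)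
  refine continuousAt_of_locally_uniform_approx_of_continuousAt fun V hV => ?_
  obtain ⟨e, he, heV⟩ := Metric.mem_uniformity_dist.1 hV
  -- The first two bounds on $\eta$ keep the tail inside $(\tau,T')$, where $|f|\le M$. For
  -- $|t-t_0|<\eta/2$ the tail has length below $2\eta$, which explains the last bound.
  have hlim : ∃ η : ℝ, 0 < η ∧ η < t₀ - τ ∧ η < T' - t₀ ∧ c * (A * M * (2 * η)) < e := by
    refine ⟨min (min ((t₀ - τ) / 2) ((T' - t₀) / 2)) (e / (2 * (c * A * M * 2 + 1))), ?_, ?_, ?_, ?_⟩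
    · have : 0 < e / (2 * (c * A * M * 2 + 1)) := by positivity
      exact lt_min (lt_min (by linarith) (by linarith)) this
    · exact ((min_le_left _ _).trans (min_le_left _ _)).trans_lt (by linarith)
    · exact ((min_le_left _ _).trans (min_le_right _ _)).trans_lt (by linarith)
    · set η := min (min ((t₀ - τ) / 2) ((T' - t₀) / 2)) (e / (2 * (c * A * M * 2 + 1)))
      have h1 : η ≤ e / (2 * (c * A * M * 2 + 1)) := min_le_right _ _
      rw [le_div_iff₀ (by positivity)] at h1
      have h2 : 0 ≤ c * A * M * 2 := by positivity
      have h3 : 0 < η := by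
        have : 0 < e / (2 * (c * A * M * 2 + 1)) := by positivity
        exact lt_min (lt_min (by linarith) (by linarith)) this
      nlinarith
  obtain ⟨η, hη, hη1, hη2, hηe⟩ := hlim
  refine ⟨{z | z.2 ∈ Ioo (t₀ - η / 2) (t₀ + η / 2)}, ?_,
    fun z => ∫ q in Ioo 0 (t₀ - η) ×ˢ univ, duhamelIntegrand N d f z.1 z.2 q, ?_, ?_⟩
  · exact continuous_snd.continuousAt.eventually
      (Ioo_mem_nhds (show t₀ - η / 2 < (x₀, t₀).2 by simp; linarith)
        (show (x₀, t₀).2 < t₀ + η / 2 by simp; linarith))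
  · refine h.continuousAt_duhamel_head hd hε hc hf hη (lt_of_le_of_lt ?_ (hfin x₀ t₀ (by linarith) htT))
    exact lintegral_mono_set (Ioo_subset_Ioo_right (by linarith))
  · rintro ⟨x, t⟩ ⟨ht1, ht2⟩
    apply heV
    simp only at ht1 ht2 ⊢
    have ht0 : 0 < t := by linarith
    have htT' : t < T' := by linarith
    have hint : IntegrableOn (duhamelIntegrand N d f x t) (Ioo 0 t ×ˢ univ) :=
      h.integrableOn_duhamel hc hf measurableSet_Ioo (fun s hs => hs.2) (hfin x t ht0 htT')
    have hun : (Ioo 0 t ×ˢ univ : Set (ℝ × Space N)) =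
        (Ioo 0 (t₀ - η) ×ˢ univ) ∪ (Ico (t₀ - η) t ×ˢ univ) := by
      rw [← union_prod, Ioo_union_Ico_eq_Ioo (by linarith) (by linarith)]
    have hdis : Disjoint (Ioo 0 (t₀ - η) ×ˢ univ : Set (ℝ × Space N)) (Ico (t₀ - η) t ×ˢ univ) := by
      rw [Set.disjoint_left]
      rintro q ⟨hq, -⟩ ⟨hq', -⟩
      exact absurd hq.2 (not_lt.2 hq'.1)
    rw [duhamel_eq hint, hun, setIntegral_union hdis (measurableSet_Ico.prod MeasurableSet.univ)
      (hint.mono_set (by rw [hun]; exact subset_union_left))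
      (hint.mono_set (by rw [hun]; exact subset_union_right)), dist_eq_norm, add_sub_cancel_left]
    refine lt_of_le_of_lt ?_ hηe
    refine h.abs_setIntegral_duhamel_le hc (by positivity) hf measurableSet_Ico (fun s hs => hs.2) ?_
    calc ∫⁻ s in Ico (t₀ - η) t, potential N d ε (fun y => ‖f y s‖ₑ) x (t - s)
        ≤ ∫⁻ s in Ico (t₀ - η) t, ENNReal.ofReal (A * M) := by
          refine setLIntegral_mono' measurableSet_Ico fun s hs => ?_
          rw [ENNReal.ofReal_mul hA.le, ← hAc d (t - s) M (sub_pos.2 hs.2) x]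
          refine potential_mono (fun y => ?_) x _
          rw [Real.enorm_eq_ofReal_abs]
          exact ENNReal.ofReal_le_ofReal (hM y s (by linarith [hs.1]) (by linarith [hs.2]))
      _ = ENNReal.ofReal (A * M) * ENNReal.ofReal (t - (t₀ - η)) := by
          rw [setLIntegral_const, Real.volume_Ico]
      _ ≤ ENNReal.ofReal (A * M * (2 * η)) := by
          rw [← ENNReal.ofReal_mul (by positivity)]
          refine ENNReal.ofReal_le_ofReal ?_
          gcongr
          linarith

/-! ### Existence below a supersolution of the majorant problem -/

theorem abs_rpow_sub_rpow_le {p R a b : ℝ} (hp : 1 ≤ p) (ha : 0 ≤ a) (haR : a ≤ R) (hb : 0 ≤ b)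
    (hbR : b ≤ R) : |a ^ p - b ^ p| ≤ p * R ^ (p - 1) * |a - b| := by
  refine (convex_Icc 0 R).norm_image_sub_le_of_norm_hasDerivWithin_le (f := fun x : ℝ => x ^ p)
    (f' := fun x => p * x ^ (p - 1))
    (fun x _ => (Real.hasDerivAt_rpow_const (Or.inr hp)).hasDerivWithinAt)
    (fun x hx => ?_) ⟨hb, hbR⟩ ⟨ha, haR⟩
  rw [Real.norm_of_nonneg (mul_nonneg (by linarith) (Real.rpow_nonneg hx.1 _))]
  have := Real.rpow_le_rpow hx.1 hx.2 (show 0 ≤ p - 1 by linarith)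
  gcongr

/-- `W` dominates the linear part, and its own Duhamel integral with the factor `δ`. -/
structure IsBarrier (N : ℕ) (d p ε δ : ℝ) (φ : Space N → ℝ) (T : ℝ≥0∞) (W : Space N → ℝ → ℝ) : Prop where
  measurable : Measurable fun z : Space N × ℝ => W z.1 z.2
  nonneg : ∀ x t, 0 ≤ W x t
  linear_le : ∀ x t, 0 < t → ENNReal.ofReal t < T →
    potential N d ε (fun y => ‖φ y‖ₑ) x t ≤ ENNReal.ofReal (W x t)
  duhamel_le : ∀ x t, 0 < t → ENNReal.ofReal t < T →
    ∫⁻ s in Ioo 0 t, potential N d ε (fun y => ENNReal.ofReal (W y s ^ p)) x (t - s) ≤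
      ENNReal.ofReal (δ * W x t)
  bounded : ∀ τ : ℝ, 0 < τ → ∃ M : ℝ, ∀ x t, τ < t → ENNReal.ofReal t < T → W x t ≤ M

section Barrier

variable {d p ε δ c : ℝ} {φ : Space N → ℝ} {T : ℝ≥0∞} {W : Space N → ℝ → ℝ}

theorem IsBarrier.lintegral_source_le (hW : IsBarrier N d p ε δ φ T W) {b : ℝ} (hb : 0 ≤ b)
    {f : Space N → ℝ → ℝ} (hfb : ∀ y s, 0 < s → ENNReal.ofReal s < T → |f y s| ≤ b * W y s ^ p)
    {x : Space N} {t : ℝ} (ht : 0 < t) (htT : ENNReal.ofReal t < T) :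
    ∫⁻ s in Ioo 0 t, potential N d ε (fun y => ‖f y s‖ₑ) x (t - s) ≤
      ENNReal.ofReal (b * (δ * W x t)) := by
  calc ∫⁻ s in Ioo 0 t, potential N d ε (fun y => ‖f y s‖ₑ) x (t - s)
      ≤ ∫⁻ s in Ioo 0 t,
          ENNReal.ofReal b * potential N d ε (fun y => ENNReal.ofReal (W y s ^ p)) x (t - s) := by
        refine setLIntegral_mono' measurableSet_Ioo fun s hs => ?_
        rw [← potential_const_mul]
        refine potential_mono (fun y => ?_) x _
        rw [← ENNReal.ofReal_mul hb, Real.enorm_eq_ofReal_abs]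
        exact ENNReal.ofReal_le_ofReal
          (hfb y s hs.1 ((ENNReal.ofReal_le_ofReal hs.2.le).trans_lt htT))
    _ ≤ _ := by
        rw [lintegral_const_mul' _ _ ENNReal.ofReal_ne_top, ENNReal.ofReal_mul hb]
        gcongr
        exact hW.duhamel_le x t ht htT

theorem IsBarrier.integrableOn_source (hW : IsBarrier N d p ε δ φ T W) (hc : 0 ≤ c)
    (hK : KernelBound N d ε c) {b : ℝ} (hb : 0 ≤ b)
    {f : Space N → ℝ → ℝ} (hf : Measurable fun z : Space N × ℝ => f z.1 z.2)
    (hfb : ∀ y s, 0 < s → ENNReal.ofReal s < T → |f y s| ≤ b * W y s ^ p)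
    {x : Space N} {t : ℝ} (ht : 0 < t) (htT : ENNReal.ofReal t < T) :
    IntegrableOn (duhamelIntegrand N d f x t) (Ioo 0 t ×ˢ univ) :=
  hK.integrableOn_duhamel hc hf measurableSet_Ioo (fun _ hs => hs.2)
    ((hW.lintegral_source_le hb hfb ht htT).trans_lt ENNReal.ofReal_lt_top)

theorem IsBarrier.abs_duhamel_le (hW : IsBarrier N d p ε δ φ T W) (hc : 0 ≤ c) (hδ : 0 ≤ δ)
    (hK : KernelBound N d ε c) {b : ℝ} (hb : 0 ≤ b)
    {f : Space N → ℝ → ℝ} (hf : Measurable fun z : Space N × ℝ => f z.1 z.2)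
    (hfb : ∀ y s, 0 < s → ENNReal.ofReal s < T → |f y s| ≤ b * W y s ^ p)
    {x : Space N} {t : ℝ} (ht : 0 < t) (htT : ENNReal.ofReal t < T) :
    |duhamel N d f x t| ≤ c * (b * (δ * W x t)) := by
  rw [duhamel_eq (hW.integrableOn_source hc hK hb hf hfb ht htT)]
  have := hW.nonneg x t
  exact hK.abs_setIntegral_duhamel_le hc (by positivity) hf measurableSet_Ioo (fun _ hs => hs.2)
    (hW.lintegral_source_le hb hfb ht htT)

/-- The Lipschitz bound for $s\mapsto s^p$ on $[0,BW]$, multiplied by $kW$, gives again a multiple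
of $W^p$, whose Duhamel integral the barrier controls. The result is a Lipschitz estimate in the
norm $\sup|u|/W$. -/
theorem IsBarrier.abs_duhamel_sub_le (hW : IsBarrier N d p ε δ φ T W) (hc : 0 ≤ c) (hδ : 0 ≤ δ)
    (hp : 1 < p) (hK : KernelBound N d ε c) {B k : ℝ} (hB : 0 ≤ B) (hk : 0 ≤ k)
    {u v : Space N → ℝ → ℝ} (hu : Measurable fun z : Space N × ℝ => u z.1 z.2)
    (hv : Measurable fun z : Space N × ℝ => v z.1 z.2)
    (huB : ∀ y s, 0 < s → ENNReal.ofReal s < T → |u y s| ≤ B * W y s)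
    (hvB : ∀ y s, 0 < s → ENNReal.ofReal s < T → |v y s| ≤ B * W y s)
    (huv : ∀ y s, 0 < s → ENNReal.ofReal s < T → |u y s - v y s| ≤ k * W y s)
    {x : Space N} {t : ℝ} (ht : 0 < t) (htT : ENNReal.ofReal t < T) :
    |duhamel N d (fun y s => |u y s| ^ p) x t - duhamel N d (fun y s => |v y s| ^ p) x t| ≤
      c * (p * B ^ (p - 1) * k * (δ * W x t)) := by
  have hmeas : ∀ {u : Space N → ℝ → ℝ}, (Measurable fun z : Space N × ℝ => u z.1 z.2) →
      Measurable fun z : Space N × ℝ => |u z.1 z.2| ^ p := fun hu =>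
    (measurable_norm.comp hu).pow_const p
  have hpow : ∀ {u : Space N → ℝ → ℝ},
      (∀ y s, 0 < s → ENNReal.ofReal s < T → |u y s| ≤ B * W y s) →
      ∀ y s, 0 < s → ENNReal.ofReal s < T → |(|u y s| ^ p)| ≤ B ^ p * W y s ^ p := by
    intro u huB y s hs hsT
    rw [abs_of_nonneg (by positivity), ← Real.mul_rpow hB (hW.nonneg y s)]
    exact Real.rpow_le_rpow (abs_nonneg _) (huB y s hs hsT) (by linarith)
  have iu := hW.integrableOn_source hc hK (by positivity) (hmeas hu) (hpow huB) (x := x) ht htT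
  have iv := hW.integrableOn_source hc hK (by positivity) (hmeas hv) (hpow hvB) (x := x) ht htT
  have hsub : ∀ z, duhamelIntegrand N d (fun y s => |u y s| ^ p - |v y s| ^ p) x t z =
      duhamelIntegrand N d (fun y s => |u y s| ^ p) x t z -
        duhamelIntegrand N d (fun y s => |v y s| ^ p) x t z := fun z => by
    simp only [duhamelIntegrand]; ring
  have heq : duhamel N d (fun y s => |u y s| ^ p) x t - duhamel N d (fun y s => |v y s| ^ p) x t =
      duhamel N d (fun y s => |u y s| ^ p - |v y s| ^ p) x t := by
    rw [duhamel_eq iu, duhamel_eq iv, duhamel_eq, ← integral_sub iu iv]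
    · simp_rw [hsub]
    · exact (iu.sub iv).congr (Filter.Eventually.of_forall fun z => (hsub z).symm)
  rw [heq]
  refine hW.abs_duhamel_le hc hδ hK (by positivity) ((hmeas hu).sub (hmeas hv)) ?_ ht htT
  intro y s hs hsT
  have hw := hW.nonneg y s
  have h1 := abs_rpow_sub_rpow_le hp.le (abs_nonneg (u y s)) (huB y s hs hsT) (abs_nonneg (v y s))
    (hvB y s hs hsT)
  have h2 : |(|u y s| - |v y s|)| ≤ k * W y s := (abs_abs_sub_abs_le _ _).trans (huv y s hs hsT)
  refine h1.trans ?_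
  calc p * (B * W y s) ^ (p - 1) * |(|u y s| - |v y s|)|
      ≤ p * (B * W y s) ^ (p - 1) * (k * W y s) := by gcongr
    _ = p * B ^ (p - 1) * k * (W y s ^ (p - 1) * W y s) := by rw [Real.mul_rpow hB hw]; ring
    _ = p * B ^ (p - 1) * k * W y s ^ p := by
        congr 1
        rcases hw.eq_or_lt with h0 | h0
        · rw [← h0, mul_zero, Real.zero_rpow (by linarith)]
        · rw [← Real.rpow_add_one h0.ne', sub_add_cancel]

theorem IsBarrier.abs_linear_le (hW : IsBarrier N d p ε δ φ T W) (hc : 0 ≤ c)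
    (hK : KernelBound N d ε c) {x : Space N} {t : ℝ} (ht : 0 < t) (htT : ENNReal.ofReal t < T) :
    |∫ y, kernel N d (x - y) t * φ y| ≤ c * W x t := by
  have hw := hW.nonneg x t
  have h1 := (enorm_integral_le_lintegral_enorm (fun y => kernel N d (x - y) t * φ y)).trans
    (hK.lintegral_le hc φ x ht)
  have h2 := h1.trans (mul_le_mul_right (hW.linear_le x t ht htT) _)
  rwa [← ENNReal.ofReal_mul hc, Real.enorm_eq_ofReal_abs,
    ENNReal.ofReal_le_ofReal_iff (by positivity)] at h2

theorem measurable_linear (hφ : AEStronglyMeasurable φ) (d : ℝ) :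
    Measurable fun z : Space N × ℝ => ∫ y, kernel N d (z.1 - y) z.2 * φ y := by
  have h1 : StronglyMeasurable fun q : (Space N × ℝ) × Space N =>
      kernel N d (q.1.1 - q.2) q.1.2 * hφ.mk φ q.2 := by
    refine Measurable.stronglyMeasurable (Measurable.mul ?_ ?_)
    · exact (measurable_kernel d).comp
        (f := fun q : (Space N × ℝ) × Space N => (q.1.1 - q.2, q.1.2)) (by fun_prop)
    · exact hφ.stronglyMeasurable_mk.measurable.comp measurable_snd
  convert (h1.integral_prod_right' (ν := volume)).measurable using 1
  ext z
  exact integral_congr_ae (hφ.ae_eq_mk.mono fun y hy => by simp only [hy])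

/-! ### Picard iteration below the barrier -/

open Classical in
/-- Picard iterates for the integral equation, extended by zero outside `(0, T)`. -/
def picard (N : ℕ) (d p : ℝ) (φ : Space N → ℝ) (T : ℝ≥0∞) : ℕ → Space N → ℝ → ℝ
  | 0 => fun _ _ => 0
  | n + 1 => fun x t => if 0 < t ∧ ENNReal.ofReal t < T then
      (∫ y, kernel N d (x - y) t * φ y) + duhamel N d (fun y s => |picard N d p φ T n y s| ^ p) x t
    else 0

theorem picard_succ {n : ℕ} {x : Space N} {t : ℝ} (ht : 0 < t) (htT : ENNReal.ofReal t < T) :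
    picard N d p φ T (n + 1) x t = (∫ y, kernel N d (x - y) t * φ y) +
      duhamel N d (fun y s => |picard N d p φ T n y s| ^ p) x t :=
  if_pos ⟨ht, htT⟩

theorem picard_eq_zero (n : ℕ) (x : Space N) {t : ℝ} (ht : ¬(0 < t ∧ ENNReal.ofReal t < T)) :
    picard N d p φ T n x t = 0 := by
  cases n with
  | zero => rfl
  | succ n => exact if_neg ht

theorem measurable_picard (hφ : AEStronglyMeasurable φ) (n : ℕ) :
    Measurable fun z : Space N × ℝ => picard N d p φ T n z.1 z.2 := by
  induction n with
  | zero => exact measurable_const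
  | succ n ih =>
    refine Measurable.ite ?_ ((measurable_linear hφ d).add (measurable_duhamel d ?_)) measurable_const
    · exact (measurableSet_lt (f := fun _ : Space N × ℝ => (0 : ℝ)) measurable_const measurable_snd).inter
        (measurableSet_lt (f := fun z : Space N × ℝ => ENNReal.ofReal z.2) (by fun_prop) measurable_const)
    · exact (measurable_norm.comp ih).pow_const p

/-- The bound $2cW$ reproduces itself: one half is the linear part, and the condition on
$(2c)^p\delta$ makes the Duhamel part at most the other half. -/
theorem IsBarrier.abs_picard_le (hW : IsBarrier N d p ε δ φ T W) (hφ : AEStronglyMeasurable φ)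
    (hc : 0 ≤ c) (hδ : 0 ≤ δ) (hp : 1 < p) (hδc : (2 * c) ^ p * δ ≤ 1)
    (hK : KernelBound N d ε c) (n : ℕ) (x : Space N) (t : ℝ) (ht : 0 < t) (htT : ENNReal.ofReal t < T) :
    |picard N d p φ T n x t| ≤ 2 * c * W x t := by
  induction n generalizing x t with
  | zero =>
    have := hW.nonneg x t
    simp only [picard, abs_zero]; positivity
  | succ n ih =>
    have hw := hW.nonneg x t
    rw [picard_succ ht htT]
    have h1 := hW.abs_linear_le hc hK (x := x) ht htT
    have h2 := hW.abs_duhamel_le hc hδ hK (b := (2 * c) ^ p) (by positivity)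
      (f := fun y s => |picard N d p φ T n y s| ^ p)
      ((measurable_norm.comp (measurable_picard hφ n)).pow_const p) (fun y s hs hsT => by
        rw [abs_of_nonneg (by positivity), ← Real.mul_rpow (by positivity) (hW.nonneg y s)]
        exact Real.rpow_le_rpow (abs_nonneg _) (ih y s hs hsT) (by linarith)) (x := x) ht htT
    have h3 : c * ((2 * c) ^ p * (δ * W x t)) ≤ c * W x t := by
      rw [← mul_assoc ((2 * c) ^ p)]
      gcongr
      exact mul_le_of_le_one_left hw hδc
    refine (abs_add_le _ _).trans ?_
    linarith

theorem IsBarrier.abs_picard_sub_le (hW : IsBarrier N d p ε δ φ T W) (hφ : AEStronglyMeasurable φ)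
    (hc : 0 ≤ c) (hδ : 0 ≤ δ) (hp : 1 < p) (hδc : (2 * c) ^ p * δ ≤ 1)
    (hδp : c * p * (2 * c) ^ (p - 1) * δ ≤ 1 / 2)
    (hK : KernelBound N d ε c) (n : ℕ) (x : Space N) (t : ℝ) (ht : 0 < t) (htT : ENNReal.ofReal t < T) :
    |picard N d p φ T n x t - picard N d p φ T (n + 1) x t| ≤ c * (1 / 2) ^ n * W x t := by
  induction n generalizing x t with
  | zero =>
    rw [picard_succ ht htT]
    have : duhamel N d (fun y s => |picard N d p φ T 0 y s| ^ p) x t = 0 := by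
      simp [duhamel, picard, Real.zero_rpow (show p ≠ 0 by linarith)]
    rw [this]
    simpa [picard] using hW.abs_linear_le hc hK (x := x) ht htT
  | succ n ih =>
    have hw := hW.nonneg x t
    rw [picard_succ ht htT, picard_succ ht htT, add_sub_add_left_eq_sub]
    have h1 := hW.abs_duhamel_sub_le hc hδ hp hK (B := 2 * c) (k := c * (1 / 2) ^ n) (by positivity)
      (by positivity) (measurable_picard hφ n) (measurable_picard hφ (n + 1))
      (hW.abs_picard_le hφ hc hδ hp hδc hK n) (hW.abs_picard_le hφ hc hδ hp hδc hK (n + 1)) ih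
      (x := x) ht htT
    refine h1.trans ?_
    calc c * (p * (2 * c) ^ (p - 1) * (c * (1 / 2) ^ n) * (δ * W x t))
        = (c * p * (2 * c) ^ (p - 1) * δ) * (c * (1 / 2) ^ n * W x t) := by ring
      _ ≤ 1 / 2 * (c * (1 / 2) ^ n * W x t) := by gcongr
      _ = _ := by ring

theorem IsBarrier.exists_solution_of_le (hW : IsBarrier N d p ε δ φ T W) (hφ : AEStronglyMeasurable φ)
    (hd : 0 < d) (hε : 0 < ε)
    (hc : 0 ≤ c) (hδ : 0 ≤ δ) (hp : 1 < p) (hδc : (2 * c) ^ p * δ ≤ 1)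
    (hδp : c * p * (2 * c) ^ (p - 1) * δ ≤ 1 / 2) (hK : KernelBound N d ε c) :
    ∃ u : Space N → ℝ → ℝ, IsSolution N d p φ T u ∧
      ∀ x t, 0 < t → ENNReal.ofReal t < T → |u x t| ≤ 2 * c * W x t := by
  have hcauchy : ∀ (x : Space N) (t : ℝ), 0 < t → ENNReal.ofReal t < T → ∀ n,
      dist (picard N d p φ T n x t) (picard N d p φ T (n + 1) x t) ≤ (2 * c * W x t) / 2 / 2 ^ n := by
    intro x t ht htT n
    rw [Real.dist_eq]
    refine (hW.abs_picard_sub_le hφ hc hδ hp hδc hδp hK n x t ht htT).trans (le_of_eq ?_)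
    rw [one_div, inv_pow]; field_simp
  have hlim : ∀ (x : Space N) (t : ℝ), ∃ l, Filter.Tendsto (fun n => picard N d p φ T n x t) Filter.atTop (nhds l) := by
    intro x t
    by_cases h : 0 < t ∧ ENNReal.ofReal t < T
    · exact cauchySeq_tendsto_of_complete (cauchySeq_of_le_geometric_two (hcauchy x t h.1 h.2))
    · exact ⟨0, by simp_rw [picard_eq_zero _ x h]; exact tendsto_const_nhds⟩
  choose u hu using hlim
  have humeas : Measurable fun z : Space N × ℝ => u z.1 z.2 :=
    measurable_of_tendsto_metrizable (measurable_picard (d := d) (p := p) (T := T) hφ)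
      (tendsto_pi_nhds.2 fun z => hu z.1 z.2)
  have hdist : ∀ n (x : Space N) (t : ℝ), 0 < t → ENNReal.ofReal t < T →
      |u x t - picard N d p φ T n x t| ≤ 2 * c * (1 / 2) ^ n * W x t := by
    intro n x t ht htT
    have := dist_le_of_le_geometric_two_of_tendsto (hcauchy x t ht htT) (hu x t) n
    rw [dist_comm, Real.dist_eq] at this
    refine this.trans (le_of_eq ?_)
    rw [one_div, inv_pow]; field_simp
  have hbound : ∀ x t, 0 < t → ENNReal.ofReal t < T → |u x t| ≤ 2 * c * W x t := fun x t ht htT =>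
    le_of_tendsto (hu x t).abs
      (Filter.Eventually.of_forall fun n => hW.abs_picard_le hφ hc hδ hp hδc hK n x t ht htT)
  have heq : ∀ x t, 0 < t → ENNReal.ofReal t < T →
      u x t = (∫ y, kernel N d (x - y) t * φ y) + duhamel N d (fun y s => |u y s| ^ p) x t := by
    intro x t ht htT
    have h1 : Filter.Tendsto (fun n => duhamel N d (fun y s => |picard N d p φ T n y s| ^ p) x t)
        Filter.atTop (nhds (duhamel N d (fun y s => |u y s| ^ p) x t)) := by
      rw [tendsto_iff_dist_tendsto_zero]
      -- The weighted contraction estimate passes to the limit inside the Duhamel term, with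
      -- geometric rate.
      refine squeeze_zero (g := fun n : ℕ =>
        c * (p * (2 * c) ^ (p - 1) * (2 * c * (1 / 2) ^ n) * (δ * W x t)))
        (fun _ => dist_nonneg) (fun n => ?_) ?_
      · rw [dist_comm, Real.dist_eq]
        exact hW.abs_duhamel_sub_le hc hδ hp hK (by positivity) (by positivity) humeas
          (measurable_picard hφ n) hbound (hW.abs_picard_le hφ hc hδ hp hδc hK n) (hdist n) ht htT
      · have h0 : Filter.Tendsto (fun n : ℕ => ((1 : ℝ) / 2) ^ n) Filter.atTop (nhds 0) :=
          tendsto_pow_atTop_nhds_zero_of_lt_one (by norm_num) (by norm_num)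
        have := h0.const_mul (c * (p * (2 * c) ^ (p - 1) * (2 * c) * (δ * W x t)))
        rw [mul_zero] at this
        refine this.congr fun n => by ring
    have h2 := (hu x t).comp (Filter.tendsto_add_atTop_nat 1)
    refine tendsto_nhds_unique h2 ((h1.const_add _).congr fun n => ?_)
    exact (picard_succ ht htT).symm
  have hupm : Measurable fun z : Space N × ℝ => |u z.1 z.2| ^ p :=
    (measurable_norm.comp humeas).pow_const p
  have hupb : ∀ y s, 0 < s → ENNReal.ofReal s < T → |(|u y s| ^ p)| ≤ (2 * c) ^ p * W y s ^ p := by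
    intro y s hs hsT
    rw [abs_of_nonneg (by positivity), ← Real.mul_rpow (by positivity) (hW.nonneg y s)]
    exact Real.rpow_le_rpow (abs_nonneg _) (hbound y s hs hsT) (by linarith)
  have hlinfin : ∀ x t, 0 < t → ENNReal.ofReal t < T → potential N d ε (fun y => ‖φ y‖ₑ) x t < ∞ :=
    fun x t ht htT => (hW.linear_le x t ht htT).trans_lt ENNReal.ofReal_lt_top
  refine ⟨u, ⟨?_, ?_, ?_, ?_, heq⟩, hbound⟩
  · rintro τ hτ ⟨x₀, t₀⟩ ⟨ht₀, ht₀T⟩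
    simp only at ht₀ ht₀T
    obtain ⟨M, hM⟩ := hW.bounded (τ / 2) (by positivity)
    -- A real time strictly between $t_0$ and $T$ gives a neighbourhood on which the integral
    -- equation holds; continuity is then read off its right-hand side.
    obtain ⟨T', hT', hT'T⟩ : ∃ T' : ℝ, t₀ < T' ∧ ENNReal.ofReal T' < T := by
      have hev : ∀ᶠ r in nhds t₀, ENNReal.ofReal r < T :=
        ENNReal.continuous_ofReal.continuousAt.eventually (gt_mem_nhds ht₀T)
      obtain ⟨r, hr⟩ := ((hev.filter_mono nhdsWithin_le_nhds).and
        (self_mem_nhdsWithin (s := Ioi t₀))).exists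
      exact ⟨r, hr.2, hr.1⟩
    have hltT : ∀ s, s < T' → ENNReal.ofReal s < T := fun s hs =>
      (ENNReal.ofReal_le_ofReal hs.le).trans_lt hT'T
    have hC := (hK.continuousAt_linear hd hε hc hφ (hτ.trans ht₀) (hlinfin x₀ t₀ (hτ.trans ht₀) ht₀T)).add
      (hK.continuousAt_duhamel hd hε hc hupm (x₀ := x₀) (t₀ := t₀) (τ := τ / 2) (T' := T')
        (M := (2 * c) ^ p * (max M 0) ^ p) (by positivity) (by linarith) hT' (fun y s hs hsT' => ?_)
        (fun x t ht htT' => (hW.lintegral_source_le (by positivity) hupb ht (hltT t htT')).trans_lt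
          ENNReal.ofReal_lt_top))
    · refine (hC.congr ?_).continuousWithinAt
      have h1 : ∀ᶠ z : Space N × ℝ in nhds (x₀, t₀), z.2 ∈ Ioo 0 T' :=
        continuous_snd.continuousAt.eventually (Ioo_mem_nhds (hτ.trans ht₀) hT')
      filter_upwards [h1] with z hz
      exact (heq z.1 z.2 hz.1 (hltT _ hz.2)).symm
    · refine (hupb y s (by linarith) (hltT s hsT')).trans ?_
      have h3 : W y s ≤ max M 0 := (hM y s hs (hltT s hsT')).trans (le_max_left _ _)
      have h4 := Real.rpow_le_rpow (hW.nonneg y s) h3 (show 0 ≤ p by linarith)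
      gcongr
  · intro τ hτ
    obtain ⟨M, hM⟩ := hW.bounded τ hτ
    refine ⟨2 * c * M, fun x t ht htT => (hbound x t (hτ.trans ht) htT).trans ?_⟩
    gcongr
    exact hM x t ht htT
  · exact fun x t ht htT => hK.integrable hc hφ ht (hlinfin x t ht htT)
  · exact fun x t ht htT => hW.integrableOn_source hc hK (by positivity) hupm hupb ht htT

end Barrier

/-- Below a barrier with small enough factor `δ` there is a solution. -/
theorem exists_solution_of_isBarrier (N : ℕ) {d p ε : ℝ} (hd : 0 < d) (hp : 1 < p) (hε : 0 < ε)
    (hεd : ε ≤ d) (hε1 : ε < 1) :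
    ∃ δ : ℝ, 0 < δ ∧ ∃ A : ℝ, 0 < A ∧ ∀ (φ : Space N → ℝ) (T : ℝ≥0∞) (W : Space N → ℝ → ℝ),
      AEStronglyMeasurable φ → IsBarrier N d p ε δ φ T W →
      ∃ u : Space N → ℝ → ℝ, IsSolution N d p φ T u ∧
        ∀ x t, 0 < t → ENNReal.ofReal t < T → |u x t| ≤ A * W x t := by
  obtain ⟨c, hc1, hK⟩ := exists_abs_kernel_le N d ε hd hε hεd hε1
  have hc : 0 < c := by linarith
  -- For this $\delta$ the invariance constant is $1/p\le1$ and the contraction constant is exactly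
  -- $1/2$.
  refine ⟨1 / (p * (2 * c) ^ p), by positivity, 2 * c, by positivity, fun φ T W hφ hW => ?_⟩
  refine hW.exists_solution_of_le hφ hd hε hc.le (by positivity) hp ?_ ?_ hK
  · rw [mul_one_div, div_le_one (by positivity)]
    exact le_mul_of_one_le_left (by positivity) hp.le
  · have : (2 * c) ^ p = (2 * c) ^ (p - 1) * (2 * c) := by
      rw [← Real.rpow_add_one (by positivity), sub_add_cancel]
    rw [this]
    apply le_of_eq
    field_simp

/-! ### Barriers from weighted averages of the initial function -/

theorem monotone_comp_max {h : ℝ → ℝ} (hh : MonotoneOn h (Ici 0)) : Monotone fun y => h (max y 0) :=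
  fun _ _ hab => hh (mem_Ici.2 (le_max_right _ _)) (mem_Ici.2 (le_max_right _ _))
    (max_le_max_right 0 hab)

theorem measurable_comp_of_monotoneOn {α : Type*} [MeasurableSpace α] {h : ℝ → ℝ}
    (hh : MonotoneOn h (Ici 0)) {f : α → ℝ} (hf : Measurable f) (hf0 : ∀ x, 0 ≤ f x) :
    Measurable fun x => h (f x) := by
  convert (monotone_comp_max hh).measurable.comp hf using 1
  ext x; simp [hf0 x]

theorem aemeasurable_comp_of_monotoneOn {α : Type*} [MeasurableSpace α] {μ : Measure α} {h : ℝ → ℝ}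
    (hh : MonotoneOn h (Ici 0)) {f : α → ℝ} (hf : AEMeasurable f μ) (hf0 : ∀ x, 0 ≤ f x) :
    AEMeasurable (fun x => h (f x)) μ := by
  convert (monotone_comp_max hh).measurable.comp_aemeasurable hf using 1
  ext x; simp [hf0 x]

/-- A substitute for Jensen's inequality that needs monotonicity of $h$ but no convexity of
$\Phi(s)=s\,h(s)$. Splitting at a level $v$ gives $|\phi|\le v/\theta+\Phi(\theta|\phi|)/(\theta
h(v))$, and both terms contribute a multiple of $v/\theta$. The level is taken above $V$ and sent
down to it, since $h(V)$ may vanish when $V=0$. -/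
theorem exists_potential_norm_le {ε : ℝ} (hε : 0 < ε) :
    ∃ A : ℝ, 0 < A ∧ ∀ (d : ℝ) (h : ℝ → ℝ), MonotoneOn h (Ici 0) → (∀ s, 0 < s → 0 < h s) →
      ∀ (φ : Space N → ℝ) (θ : ℝ), 0 < θ → ∀ (x : Space N) (t V : ℝ), 0 < t → 0 ≤ V →
        potential N d ε (fun y => ENNReal.ofReal (θ * |φ y| * h (θ * |φ y|))) x t ≤
          ENNReal.ofReal (V * h V) →
        potential N d ε (fun y => ‖φ y‖ₑ) x t ≤ ENNReal.ofReal (A / θ * V) := by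
  obtain ⟨A₀, hA₀, hconst⟩ := exists_potential_const (N := N) hε
  refine ⟨A₀ + 1, by positivity, fun d h hmono hpos φ θ hθ x t V ht hV hF => ?_⟩
  have key : ∀ v, V < v → potential N d ε (fun y => ‖φ y‖ₑ) x t ≤ ENNReal.ofReal ((A₀ + 1) / θ * v) := by
    intro v hv
    have hv0 : 0 < v := hV.trans_lt hv
    have hhv := hpos v hv0
    calc potential N d ε (fun y => ‖φ y‖ₑ) x t
        ≤ potential N d ε (fun y => ENNReal.ofReal (v / θ) + ENNReal.ofReal (1 / (θ * h v)) *
            ENNReal.ofReal (θ * |φ y| * h (θ * |φ y|))) x t := by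
          refine potential_mono (fun y => ?_) x t
          rw [Real.enorm_eq_ofReal_abs, ← ENNReal.ofReal_mul (by positivity)]
          rcases le_or_gt (θ * |φ y|) v with hle | hgt
          · refine le_trans (ENNReal.ofReal_le_ofReal ?_) le_self_add
            rw [le_div_iff₀ hθ]; linarith
          · refine le_trans (ENNReal.ofReal_le_ofReal ?_) le_add_self
            have h1 : h v ≤ h (θ * |φ y|) := hmono hv0.le (hv0.trans hgt).le hgt.le
            have h2 : 0 ≤ |φ y| := abs_nonneg _
            calc |φ y| = 1 / (θ * h v) * (θ * |φ y| * h v) := by field_simp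
              _ ≤ _ := by gcongr
      _ = ENNReal.ofReal A₀ * ENNReal.ofReal (v / θ) + ENNReal.ofReal (1 / (θ * h v)) *
            potential N d ε (fun y => ENNReal.ofReal (θ * |φ y| * h (θ * |φ y|))) x t := by
          rw [← hconst d t (v / θ) ht x, ← potential_const_mul]
          unfold potential
          simp_rw [mul_add]
          rw [lintegral_add_left]
          exact (measurable_majorant_comp ε d measurable_const (by fun_prop)).mul_const _
      _ ≤ ENNReal.ofReal A₀ * ENNReal.ofReal (v / θ) + ENNReal.ofReal (1 / (θ * h v)) *
            ENNReal.ofReal (v * h v) := by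
          gcongr
          refine hF.trans (ENNReal.ofReal_le_ofReal ?_)
          rcases hV.eq_or_lt with h0 | h0
          · rw [← h0, zero_mul]; positivity
          · exact mul_le_mul hv.le (hmono hV hv0.le hv.le) (hpos V h0).le hv0.le
      _ = _ := by
          rw [← ENNReal.ofReal_mul hA₀.le, ← ENNReal.ofReal_mul (by positivity),
            ← ENNReal.ofReal_add (by positivity) (by positivity)]
          congr 1
          field_simp
  have htend : Filter.Tendsto (fun v => ENNReal.ofReal ((A₀ + 1) / θ * v)) (nhdsWithin V (Ioi V))
      (nhds (ENNReal.ofReal ((A₀ + 1) / θ * V))) := by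
    have : Continuous fun v => ENNReal.ofReal ((A₀ + 1) / θ * v) :=
      ENNReal.continuous_ofReal.comp (by fun_prop)
    exact (this.tendsto V).mono_left nhdsWithin_le_nhds
  exact ge_of_tendsto htend (Filter.eventually_of_mem self_mem_nhdsWithin key)

/-- Existence when the averages of `Φ(θ|φ|)`, `Φ(s) = s h(s)`, over balls of radius `t^{1/d}` are
controlled by `Φ(κ(t))`. -/
theorem exists_solution_of_average (N : ℕ) {d p : ℝ} (hd : 0 < d) (hp : 1 < p) :
    ∃ δ : ℝ, 0 < δ ∧ ∃ A : ℝ, 0 < A ∧ ∃ C : ℝ, 0 < C ∧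
      ∀ (h g : ℝ → ℝ), MonotoneOn h (Ici 0) → (∀ s, 0 < s → 0 < h s) → MonotoneOn g (Ici 0) →
        (∀ y, 0 ≤ y → 0 ≤ g y) → (∀ y, 0 ≤ y → g y * h (g y) = y) →
      ∀ (φ : Space N → ℝ) (T : ℝ≥0∞) (θ : ℝ) (κ m : ℝ → ℝ), AEStronglyMeasurable φ → 0 < θ →
        (∀ t, 0 < t → ENNReal.ofReal t < T → 0 < κ t) →
        (∀ τ, 0 < τ → ∃ M, ∀ t, τ < t → ENNReal.ofReal t < T → κ t ≤ M) →
        (∀ t, 0 < t → ENNReal.ofReal t < T → ∀ z : Space N,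
          ∫⁻ y in ball z (t ^ (1 / d)), ENNReal.ofReal (θ * |φ y| * h (θ * |φ y|)) ≤
            ENNReal.ofReal (t ^ ((N : ℝ) / d) * (κ t * h (κ t)) / C)) →
        (∀ t, 0 < t → ENNReal.ofReal t < T → ∀ v, 0 < v → v ≤ κ t → v ^ (p - 1) ≤ m t * h v) →
        (∀ t, 0 < t → ENNReal.ofReal t < T →
          ENNReal.ofReal (h (κ t)) * ∫⁻ s in Ioo 0 t, ENNReal.ofReal (m s) ≤
            ENNReal.ofReal (δ * θ ^ (p - 1))) →
      ∃ u : Space N → ℝ → ℝ, IsSolution N d p φ T u ∧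
        ∀ x t, 0 < t → ENNReal.ofReal t < T → |u x t| ≤ A / θ * κ t := by
  obtain ⟨ε, hε, hεd, hε1⟩ : ∃ ε : ℝ, 0 < ε ∧ ε ≤ d ∧ ε < 1 :=
    ⟨min d (1 / 2), by positivity, min_le_left _ _, (min_le_right _ _).trans_lt (by norm_num)⟩
  obtain ⟨δ₀, hδ₀, A₀, hA₀, hexist⟩ := exists_solution_of_isBarrier N hd hp hε hεd hε1
  obtain ⟨A₁, hA₁, hlin⟩ := exists_potential_norm_le (N := N) hε
  obtain ⟨C₁, hC₁, hpot⟩ := exists_potential_le N d hε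
  obtain ⟨C₂, hC₂, hsemi⟩ := exists_potential_potential_le N hd hε
  -- With $k=A_1/\theta$ one has $k^pC_2\cdot\delta\,\theta^{p-1}=\delta_0k$, the factor required of
  -- the barrier $kV$.
  refine ⟨δ₀ / (C₂ * A₁ ^ (p - 1)), by positivity, A₀ * A₁, by positivity, C₁, hC₁, ?_⟩
  intro h g hmono hpos hgmono hg0 hginv φ T θ κ m hφ hθ hκ hκbd hball hm hmint
  set μ : Space N → ℝ≥0∞ := fun y => ENNReal.ofReal (θ * |φ y| * h (θ * |φ y|)) with hμ
  have hμm : AEMeasurable μ := by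
    have h1 : AEMeasurable (fun y => θ * |φ y|) := (hφ.norm.aemeasurable).const_mul θ
    exact (h1.mul (aemeasurable_comp_of_monotoneOn hmono h1 fun y => by positivity)).ennreal_ofReal
  set F := potential N d ε μ with hFdef
  have hFκ : ∀ x t, 0 < t → ENNReal.ofReal t < T → F x t ≤ ENNReal.ofReal (κ t * h (κ t)) := by
    intro x t ht htT
    have h1 := hpot μ hμm t ht _ (hball t ht htT) x
    rw [← ENNReal.ofReal_mul hC₁.le, mul_div_cancel₀ _ hC₁.ne', ENNReal.ofReal_mul (by positivity)] at h1
    have h2 : 0 < t ^ ((N : ℝ) / d) := by positivity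
    exact (ENNReal.mul_le_mul_iff_right (ENNReal.ofReal_pos.2 h2).ne' ENNReal.ofReal_ne_top).1 h1
  set V : Space N → ℝ → ℝ := fun x t => g (F x t).toReal with hV
  have hV0 : ∀ x t, 0 ≤ V x t := fun x t => hg0 _ ENNReal.toReal_nonneg
  have hFV : ∀ x t, 0 < t → ENNReal.ofReal t < T → F x t = ENNReal.ofReal (V x t * h (V x t)) := by
    intro x t ht htT
    rw [hV, hginv _ ENNReal.toReal_nonneg,
      ENNReal.ofReal_toReal ((hFκ x t ht htT).trans_lt ENNReal.ofReal_lt_top).ne]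
  have hVκ : ∀ x t, 0 < t → ENNReal.ofReal t < T → V x t ≤ κ t := by
    intro x t ht htT
    by_contra! hlt
    have hk := hκ t ht htT
    have h1 := hFκ x t ht htT
    rw [hFV x t ht htT, ENNReal.ofReal_le_ofReal_iff (mul_pos hk (hpos _ hk)).le] at h1
    have h2 : h (κ t) ≤ h (V x t) := hmono hk.le (hk.trans hlt).le hlt.le
    have h3 := hpos _ hk
    nlinarith
  set k := A₁ / θ with hk
  have hk0 : 0 < k := by positivity
  have hVm : Measurable fun z : Space N × ℝ => V z.1 z.2 :=
    measurable_comp_of_monotoneOn hgmono (measurable_potential hμm).ennreal_toReal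
      fun z => ENNReal.toReal_nonneg
  obtain ⟨u, hu, hub⟩ := hexist φ T (fun x t => k * V x t) hφ
    { measurable := hVm.const_mul k
      nonneg := fun x t => mul_nonneg hk0.le (hV0 x t)
      linear_le := fun x t ht htT =>
        hlin d h hmono hpos φ θ hθ x t (V x t) ht (hV0 x t) (hFV x t ht htT).le
      bounded := fun τ hτ => by
        obtain ⟨M, hM⟩ := hκbd τ hτ
        refine ⟨k * M, fun x t ht htT => ?_⟩
        gcongr
        exact (hVκ x t (hτ.trans ht) htT).trans (hM t ht htT)
      duhamel_le := fun x t ht htT => by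
        have hVt := hV0 x t
        have hFt : F x t ≠ ∞ := ((hFκ x t ht htT).trans_lt ENNReal.ofReal_lt_top).ne
        -- Since $V^{p-1}\le m(s)h(V)$, the source is at most $k^pm(s)F(\cdot,s)$. The semigroup
        -- inequality replaces its potential over the remaining time $t-s$ by $C_2F(x,t)$, which no
        -- longer depends on $s$; then $F=V\,h(V)\le V\,h(\kappa(t))$.
        calc ∫⁻ s in Ioo 0 t, potential N d ε (fun y => ENNReal.ofReal ((k * V y s) ^ p)) x (t - s)
            ≤ ∫⁻ s in Ioo 0 t, ENNReal.ofReal (m s) * (ENNReal.ofReal (k ^ p * C₂) * F x t) := by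
              refine setLIntegral_mono' measurableSet_Ioo fun s hs => ?_
              have hsT : ENNReal.ofReal s < T := (ENNReal.ofReal_le_ofReal hs.2.le).trans_lt htT
              calc potential N d ε (fun y => ENNReal.ofReal ((k * V y s) ^ p)) x (t - s)
                  ≤ potential N d ε (fun y => ENNReal.ofReal (k ^ p * m s) * F y s) x (t - s) := by
                    refine potential_mono (fun y => ?_) x _
                    have hVs := hV0 y s
                    rcases hVs.eq_or_lt with h0 | h0
                    · rw [← h0, mul_zero, Real.zero_rpow (by linarith)]; simp
                    · have hkey := hm s hs.1 hsT (V y s) h0 (hVκ y s hs.1 hsT)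
                      have hms : 0 ≤ m s := by
                        by_contra! hneg
                        have h1 := hpos _ h0
                        have h2 : 0 < V y s ^ (p - 1) := by positivity
                        nlinarith
                      rw [hFV y s hs.1 hsT, ← ENNReal.ofReal_mul (by positivity)]
                      refine ENNReal.ofReal_le_ofReal ?_
                      rw [Real.mul_rpow hk0.le hVs]
                      have : V y s ^ p = V y s ^ (p - 1) * V y s := by
                        rw [← Real.rpow_add_one h0.ne', sub_add_cancel]
                      rw [this]
                      calc k ^ p * (V y s ^ (p - 1) * V y s) ≤ k ^ p * (m s * h (V y s) * V y s) := by
                            gcongr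
                        _ = _ := by ring
                _ = ENNReal.ofReal (k ^ p * m s) * potential N d ε (fun y => F y s) x (t - s) :=
                    potential_const_mul _ _ _
                _ ≤ ENNReal.ofReal (k ^ p * m s) * (ENNReal.ofReal C₂ * F x (t - s + s)) := by
                    gcongr
                    exact hsemi μ hμm x (t - s) s (sub_pos.2 hs.2) hs.1
                _ = _ := by
                    rw [sub_add_cancel, ENNReal.ofReal_mul (by positivity),
                      ENNReal.ofReal_mul (by positivity)]
                    ring
          _ = (∫⁻ s in Ioo 0 t, ENNReal.ofReal (m s)) * (ENNReal.ofReal (k ^ p * C₂) * F x t) :=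
              lintegral_mul_const' _ _ (ENNReal.mul_ne_top ENNReal.ofReal_ne_top hFt)
          _ ≤ (∫⁻ s in Ioo 0 t, ENNReal.ofReal (m s)) *
                (ENNReal.ofReal (k ^ p * C₂) * (ENNReal.ofReal (V x t) * ENNReal.ofReal (h (κ t)))) := by
              gcongr
              rw [hFV x t ht htT, ← ENNReal.ofReal_mul hVt]
              refine ENNReal.ofReal_le_ofReal ?_
              gcongr
              exact hmono hVt (hκ t ht htT).le (hVκ x t ht htT)
          _ = ENNReal.ofReal (k ^ p * C₂) * ENNReal.ofReal (V x t) *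
                (ENNReal.ofReal (h (κ t)) * ∫⁻ s in Ioo 0 t, ENNReal.ofReal (m s)) := by ring
          _ ≤ ENNReal.ofReal (k ^ p * C₂) * ENNReal.ofReal (V x t) *
                ENNReal.ofReal (δ₀ / (C₂ * A₁ ^ (p - 1)) * θ ^ (p - 1)) := by
              gcongr
              exact hmint t ht htT
          _ = ENNReal.ofReal (δ₀ * (k * V x t)) := by
              rw [← ENNReal.ofReal_mul (by positivity), ← ENNReal.ofReal_mul (by positivity)]
              congr 1
              have : k ^ p = A₁ ^ (p - 1) / θ ^ (p - 1) * k := by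
                rw [← Real.div_rpow hA₁.le hθ.le, ← hk, ← Real.rpow_add_one hk0.ne', sub_add_cancel]
              rw [this]
              have hA' : A₁ ^ (p - 1) ≠ 0 := by positivity
              have hθ' : θ ^ (p - 1) ≠ 0 := by positivity
              field_simp }
  refine ⟨u, hu, fun x t ht htT => (hub x t ht htT).trans ?_⟩
  calc A₀ * (k * V x t) ≤ A₀ * (k * κ t) := by gcongr; exact hVκ x t ht htT
    _ = _ := by rw [hk]; ring

/-! ### The three ranges of the exponent -/

theorem volume_real_ball {a : ℝ} (ha : 0 < a) (z : Space N) :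
    volume.real (ball z a) = a ^ N * volume.real (ball (0 : Space N) 1) := by
  rw [Measure.real, Measure.addHaar_ball_of_pos _ _ ha, ENNReal.toReal_mul,
    ENNReal.toReal_ofReal (by positivity)]
  simp [Measure.real]

theorem volume_real_unitBall_pos : 0 < volume.real (ball (0 : Space N) 1) :=
  ENNReal.toReal_pos (measure_ball_pos _ _ one_pos).ne' measure_ball_lt_top.ne

theorem lintegral_ball_le_of_average_le {f : Space N → ℝ} {z : Space N} {a R : ℝ} (ha : 0 < a)
    (hf0 : ∀ y, 0 ≤ f y) (hf : IntegrableOn f (ball z a)) (h : ⨍ y in ball z a, f y ≤ R) :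
    ∫⁻ y in ball z a, ENNReal.ofReal (f y) ≤
      ENNReal.ofReal (a ^ N * (volume.real (ball (0 : Space N) 1) * R)) := by
  rw [← ofReal_integral_eq_lintegral_ofReal hf (Filter.Eventually.of_forall hf0)]
  refine ENNReal.ofReal_le_ofReal ?_
  have hω := volume_real_unitBall_pos (N := N)
  rw [setAverage_eq, volume_real_ball ha, smul_eq_mul, inv_mul_le_iff₀ (by positivity)] at h
  linarith

theorem rpow_one_div_pow {d t : ℝ} (ht : 0 < t) : (t ^ (1 / d)) ^ N = t ^ ((N : ℝ) / d) := by
  rw [← Real.rpow_natCast, ← Real.rpow_mul ht.le]; congr 1; ring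

theorem lintegral_rpow_neg_le {K a t : ℝ} (hK : 0 ≤ K) (ha : a < 1) (ht : 0 < t) :
    ∫⁻ s in Ioo 0 t, ENNReal.ofReal (K * s ^ (-a)) ≤ ENNReal.ofReal (K * (t ^ (1 - a) / (1 - a))) := by
  have hint : IntegrableOn (fun s : ℝ => K * s ^ (-a)) (Ioo 0 t) := by
    have := (intervalIntegral.intervalIntegrable_rpow' (a := 0) (b := t) (r := -a) (by linarith)).const_mul K
    rw [intervalIntegrable_iff_integrableOn_Ioo_of_le ht.le] at this
    exact this
  rw [← ofReal_integral_eq_lintegral_ofReal hint ((ae_restrict_iff' measurableSet_Ioo).2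
    (Filter.Eventually.of_forall fun s hs => mul_nonneg hK (Real.rpow_nonneg hs.1.le _)))]
  refine ENNReal.ofReal_le_ofReal (le_of_eq ?_)
  rw [← integral_Ioc_eq_integral_Ioo, ← intervalIntegral.integral_of_le ht.le,
    intervalIntegral.integral_const_mul, integral_rpow (Or.inl (by linarith))]
  rw [Real.zero_rpow (by linarith), show -a + 1 = 1 - a by ring, sub_zero]

/-! ### The case $r_0<1$: uniformly local mass -/

theorem exists_solution_of_small_mass (N : ℕ) {d p : ℝ} (hd : 0 < d) (hp : 1 < p)
    (hr : r0 N d p < 1) :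
    ∃ δ : ℝ, 0 < δ ∧ ∃ A : ℝ, 0 < A ∧ ∀ (φ : Space N → ℝ) (T M : ℝ), LocallyIntegrable φ → 0 < T → 0 < M →
      (∀ z, ∫⁻ y in ball z (T ^ (1 / d)), ENNReal.ofReal |φ y| ≤ ENNReal.ofReal M) →
      M ^ (p - 1) * T ^ (1 - r0 N d p) ≤ δ →
      ∃ u : Space N → ℝ → ℝ, IsSolution N d p φ (ENNReal.ofReal T) u ∧
        ∀ x t, 0 < t → t < T → |u x t| ≤ A * M * t ^ (-((N : ℝ) / d)) := by
  obtain ⟨δ, hδ, A, hA, C, hC, hex⟩ := exists_solution_of_average N hd hp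
  set r := r0 N d p with hr0
  have hr1 : 0 < 1 - r := by linarith
  refine ⟨δ * (1 - r) / C ^ (p - 1), by positivity, A * C, by positivity, fun φ T M hφ hT hM hball hsmall => ?_⟩
  have hlt : ∀ {t}, ENNReal.ofReal t < ENNReal.ofReal T → t < T := fun h =>
    (ENNReal.ofReal_lt_ofReal_iff hT).1 h
  -- With $\Phi(s)=s$ a mass bound $M$ on the balls gives $\kappa(t)=CMt^{-N/d}$, and $\kappa^{p-1}$
  -- is a multiple of $t^{-r_0}$, integrable at $0$.
  have hsol := hex (fun _ => 1) id (fun _ _ _ _ _ => le_rfl) (fun _ _ => one_pos)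
    (fun _ _ _ _ h => h) (fun _ h => h) (fun y _ => mul_one y) φ (ENNReal.ofReal T) 1
    (fun t => C * M * t ^ (-((N : ℝ) / d))) (fun s => (C * M) ^ (p - 1) * s ^ (-r))
    hφ.aestronglyMeasurable one_pos (fun t ht _ => by positivity) ?_ ?_ ?_ ?_
  · obtain ⟨u, hu, hub⟩ := hsol
    refine ⟨u, hu, fun x t ht htT => (hub x t ht ((ENNReal.ofReal_lt_ofReal_iff hT).2 htT)).trans_eq ?_⟩
    ring
  · intro τ hτ
    refine ⟨C * M * τ ^ (-((N : ℝ) / d)), fun t ht _ => ?_⟩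
    exact mul_le_mul_of_nonneg_left
      (Real.rpow_le_rpow_of_nonpos hτ ht.le (by rw [neg_nonpos]; positivity)) (by positivity)
  · intro t ht htT z
    simp only [one_mul, mul_one]
    refine (lintegral_mono_set (ball_subset_ball
      (Real.rpow_le_rpow ht.le (hlt htT).le (by positivity)))).trans ((hball z).trans ?_)
    refine ENNReal.ofReal_le_ofReal (le_of_eq ?_)
    rw [Real.rpow_neg ht.le]
    have : t ^ ((N : ℝ) / d) ≠ 0 := by positivity
    field_simp
  · intro t ht _ v hv hvk
    rw [mul_one]
    refine (Real.rpow_le_rpow hv.le hvk (by linarith)).trans_eq ?_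
    rw [Real.mul_rpow (by positivity) (by positivity), ← Real.rpow_mul ht.le]
    congr 2
    rw [hr0, r0]; ring
  · intro t ht htT
    rw [ENNReal.ofReal_one, one_mul, Real.one_rpow, mul_one]
    refine (lintegral_rpow_neg_le (by positivity) hr ht).trans (ENNReal.ofReal_le_ofReal ?_)
    rw [le_div_iff₀ (by positivity)] at hsmall
    rw [← mul_div_assoc, div_le_iff₀ hr1, Real.mul_rpow hC.le hM.le]
    have h1 : t ^ (1 - r) ≤ T ^ (1 - r) := Real.rpow_le_rpow ht.le (hlt htT).le hr1.le
    calc C ^ (p - 1) * M ^ (p - 1) * t ^ (1 - r) ≤ C ^ (p - 1) * M ^ (p - 1) * T ^ (1 - r) := by gcongr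
      _ ≤ _ := by linarith

theorem exists_solution_of_r0_lt_one (N : ℕ) (hN : 1 ≤ N) (d p : ℝ) (hd : 0 < d) (hp : 1 < p)
    (hr : r0 N d p < 1) :
    ∃ γ : ℝ, 0 < γ ∧ ∃ C : ℝ, 0 < C ∧
      ∀ φ : Space N → ℝ, LocallyIntegrable φ → ∃ C' : ℝ, 0 < C' ∧
      ∀ T : ℝ, 0 < T →
      (∀ x : Space N,
        (⨍ y in ball x (T ^ (1 / d)), |φ y|) ≤ γ * T ^ (-((N : ℝ) / (d * r0 N d p)))) →
      ∃ u : Space N → ℝ → ℝ, IsSolution N d p φ (ENNReal.ofReal T) u ∧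
        ∀ (x : Space N) (t : ℝ), 0 < t → t < T →
          |u x t| ≤ C * T ^ (-((N : ℝ) / d * (1 / r0 N d p - 1))) * t ^ (-((N : ℝ) / d)) ∧
          |u x t| ≤ C' * t ^ (-((N : ℝ) / d)) := by
  obtain ⟨δ, hδ, A, hA, hex⟩ := exists_solution_of_small_mass N hd hp hr
  have hN' : (0 : ℝ) < N := by exact_mod_cast hN
  have hp1 : 0 < p - 1 := by linarith
  have hr0 : 0 < r0 N d p := by unfold r0; positivity
  have hrdef : (N : ℝ) / d * (p - 1) = r0 N d p := by unfold r0; ring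
  set r := r0 N d p
  set ω := volume.real (ball (0 : Space N) 1)
  have hω : 0 < ω := volume_real_unitBall_pos
  set b := (N : ℝ) / d * (1 / r - 1) with hb
  have hb0 : 0 < b := by
    have : 1 < 1 / r := by rw [lt_div_iff₀ hr0]; linarith
    have h2 : 0 < 1 / r - 1 := by linarith
    positivity
  -- The threshold mass $GT^{-b}$ turns the smallness condition into one independent of $T$.
  have hbp : -b * (p - 1) + (1 - r) = 0 := by
    have : b * (p - 1) = r * (1 / r - 1) := by rw [hb, ← hrdef]; ring
    rw [neg_mul, this]; field_simp; ring
  set G := δ ^ (1 / (p - 1)) with hG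
  have hG0 : 0 < G := by positivity
  have hGp : G ^ (p - 1) = δ := by
    rw [hG, ← Real.rpow_mul hδ.le, one_div_mul_cancel hp1.ne', Real.rpow_one]
  refine ⟨G / ω, by positivity, A * G, by positivity, fun φ hφ => ?_⟩
  have hmass : ∀ T : ℝ, 0 < T → (∀ x : Space N,
      (⨍ y in ball x (T ^ (1 / d)), |φ y|) ≤ G / ω * T ^ (-((N : ℝ) / (d * r)))) →
      ∀ z, ∫⁻ y in ball z (T ^ (1 / d)), ENNReal.ofReal |φ y| ≤ ENNReal.ofReal (G * T ^ (-b)) := by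
    intro T hT h z
    have hint : IntegrableOn (fun y => |φ y|) (ball z (T ^ (1 / d))) :=
      ((hφ.integrableOn_isCompact (isCompact_closedBall z (T ^ (1 / d)))).mono_set
        ball_subset_closedBall).abs
    refine (lintegral_ball_le_of_average_le (by positivity) (fun y => abs_nonneg _) hint (h z)).trans
      (ENNReal.ofReal_le_ofReal (le_of_eq ?_))
    rw [rpow_one_div_pow hT, show -b = (N : ℝ) / d + -((N : ℝ) / (d * r)) by rw [hb]; field_simp; ring,
      Real.rpow_add hT]
    change _ * (ω * _) = _
    field_simp
  have hsmall : ∀ T M : ℝ, 0 < T → 0 < M → M ≤ G * T ^ (-b) → M ^ (p - 1) * T ^ (1 - r) ≤ δ := by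
    intro T M hT hM hle
    calc M ^ (p - 1) * T ^ (1 - r) ≤ (G * T ^ (-b)) ^ (p - 1) * T ^ (1 - r) := by gcongr
      _ = G ^ (p - 1) * (T ^ (-b * (p - 1)) * T ^ (1 - r)) := by
          rw [Real.mul_rpow hG0.le (by positivity), ← Real.rpow_mul hT.le]; ring
      _ = δ := by rw [← Real.rpow_add hT, hbp, Real.rpow_zero, mul_one, hGp]
  -- The constant $C_\phi$ must serve all $T$ at once. If some $S$ is admissible, its threshold mass
  -- bounds the masses for every admissible $T$: by inclusion of balls when $T\le S$, and because
  -- $T^{-b}\le S^{-b}$ when $T\ge S$. If no $S$ is admissible, nothing has to be proved.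
  by_cases hS : ∃ S : ℝ, 0 < S ∧ ∀ x : Space N,
      (⨍ y in ball x (S ^ (1 / d)), |φ y|) ≤ G / ω * S ^ (-((N : ℝ) / (d * r)))
  · obtain ⟨S, hS0, hSh⟩ := hS
    refine ⟨A * (G * S ^ (-b)), by positivity, fun T hT h => ?_⟩
    set M := min (G * T ^ (-b)) (G * S ^ (-b)) with hM
    have hM0 : 0 < M := lt_min (by positivity) (by positivity)
    have hball : ∀ z, ∫⁻ y in ball z (T ^ (1 / d)), ENNReal.ofReal |φ y| ≤ ENNReal.ofReal M := by
      intro z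
      rw [hM, ENNReal.ofReal_min]
      refine le_min (hmass T hT h z) ?_
      rcases le_total T S with hTS | hTS
      · exact (lintegral_mono_set (ball_subset_ball
          (Real.rpow_le_rpow hT.le hTS (by positivity)))).trans (hmass S hS0 hSh z)
      · refine (hmass T hT h z).trans (ENNReal.ofReal_le_ofReal ?_)
        exact mul_le_mul_of_nonneg_left (Real.rpow_le_rpow_of_nonpos hS0 hTS (by linarith)) hG0.le
    obtain ⟨u, hu, hub⟩ := hex φ T M hφ hT hM0 hball (hsmall T M hT hM0 (min_le_left _ _))
    refine ⟨u, hu, fun x t ht htT => ⟨(hub x t ht htT).trans ?_, (hub x t ht htT).trans ?_⟩⟩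
    · rw [mul_assoc A G]
      gcongr
      exact min_le_left _ _
    · gcongr
      exact min_le_right _ _
  · exact ⟨1, one_pos, fun T hT h => absurd ⟨T, hT, h⟩ hS⟩

/-! ### The case $r_0>1$: Morrey-type averages -/

theorem rpow_le_add_rpow {l q q₀ a : ℝ} (hl : 0 < l) (hq : 0 ≤ q) (hqq : q ≤ q₀) (ha : 0 ≤ a) :
    a ^ q ≤ l ^ q + l ^ (q - q₀) * a ^ q₀ := by
  rcases le_or_gt a l with h | h
  · have h1 := Real.rpow_le_rpow ha h hq
    have h2 : 0 ≤ l ^ (q - q₀) * a ^ q₀ := by positivity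
    linarith
  · have ha' : 0 < a := hl.trans h
    have h1 : a ^ (q - q₀) ≤ l ^ (q - q₀) := Real.rpow_le_rpow_of_nonpos hl h.le (by linarith)
    have h2 : a ^ q = a ^ (q - q₀) * a ^ q₀ := by rw [← Real.rpow_add ha', sub_add_cancel]
    have h3 : 0 ≤ l ^ q := by positivity
    rw [h2]
    have := mul_le_mul_of_nonneg_right h1 (Real.rpow_nonneg ha q₀)
    linarith

/-- Lowering the exponent from $q_0$ to $q$ by splitting at the level $l$, in place of Hölder's
inequality; the two parts account for the factor $2$. -/
theorem lintegral_ball_rpow_le {φ : Space N → ℝ} {z : Space N} {a l q q₀ : ℝ} (ha : 0 < a)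
    (hl : 0 < l) (hq : 0 ≤ q) (hqq : q ≤ q₀)
    (hint : IntegrableOn (fun y => |φ y| ^ q₀) (ball z a)) (hav : ⨍ y in ball z a, |φ y| ^ q₀ ≤ l ^ q₀) :
    ∫⁻ y in ball z a, ENNReal.ofReal (|φ y| ^ q) ≤
      ENNReal.ofReal (a ^ N * (2 * volume.real (ball (0 : Space N) 1) * l ^ q)) := by
  have hω := volume_real_unitBall_pos (N := N)
  set ω := volume.real (ball (0 : Space N) 1)
  have h1 := lintegral_ball_le_of_average_le ha (fun y => by positivity) hint hav
  calc ∫⁻ y in ball z a, ENNReal.ofReal (|φ y| ^ q)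
      ≤ ∫⁻ y in ball z a, (ENNReal.ofReal (l ^ q) +
          ENNReal.ofReal (l ^ (q - q₀)) * ENNReal.ofReal (|φ y| ^ q₀)) := by
        refine lintegral_mono fun y => ?_
        rw [← ENNReal.ofReal_mul (by positivity), ← ENNReal.ofReal_add (by positivity) (by positivity)]
        exact ENNReal.ofReal_le_ofReal (rpow_le_add_rpow hl hq hqq (abs_nonneg _))
    _ = ENNReal.ofReal (l ^ q) * volume (ball z a) +
          ENNReal.ofReal (l ^ (q - q₀)) * ∫⁻ y in ball z a, ENNReal.ofReal (|φ y| ^ q₀) := by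
        rw [lintegral_add_left measurable_const, setLIntegral_const,
          lintegral_const_mul' _ _ ENNReal.ofReal_ne_top]
    _ ≤ ENNReal.ofReal (l ^ q) * ENNReal.ofReal (a ^ N * ω) +
          ENNReal.ofReal (l ^ (q - q₀)) * ENNReal.ofReal (a ^ N * (ω * l ^ q₀)) := by
        have hv : volume (ball z a) = ENNReal.ofReal (a ^ N * ω) := by
          rw [← volume_real_ball ha z, Measure.real, ENNReal.ofReal_toReal measure_ball_lt_top.ne]
        rw [hv]
        gcongr
    _ = _ := by
        rw [← ENNReal.ofReal_mul (by positivity), ← ENNReal.ofReal_mul (by positivity),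
          ← ENNReal.ofReal_add (by positivity) (by positivity)]
        congr 1
        have : l ^ q = l ^ (q - q₀) * l ^ q₀ := by rw [← Real.rpow_add hl, sub_add_cancel]
        rw [this]; ring

theorem exists_solution_of_morrey (N : ℕ) (hN : 1 ≤ N) (d p : ℝ) (hd : 0 < d) (hp : 1 < p)
    (q₀ : ℝ) (hq₀ : 1 < q₀) :
    ∃ γ : ℝ, 0 < γ ∧ ∃ C : ℝ, 0 < C ∧
      ∀ φ : Space N → ℝ, LocallyIntegrable φ → ∀ T : ℝ≥0∞,
      (∀ (x : Space N) (σ : ℝ), 0 < σ → ENNReal.ofReal σ < T ^ (1 / d) →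
        IntegrableOn (fun y => |φ y| ^ q₀) (ball x σ) ∧
        σ ^ ((N : ℝ) / r0 N d p) * (⨍ y in ball x σ, |φ y| ^ q₀) ^ (1 / q₀) ≤ γ) →
      ∃ u : Space N → ℝ → ℝ, IsSolution N d p φ T u ∧
        ∀ (x : Space N) (t : ℝ), 0 < t → ENNReal.ofReal t < T →
          |u x t| ≤ C * t ^ (-((N : ℝ) / (d * r0 N d p))) := by
  obtain ⟨δ, hδ, A, hA, C, hC, hex⟩ := exists_solution_of_average N hd hp
  have hN' : (0 : ℝ) < N := by exact_mod_cast hN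
  have hp1 : 0 < p - 1 := by linarith
  have hω := volume_real_unitBall_pos (N := N)
  set ω := volume.real (ball (0 : Space N) 1)
  -- The bound $q\le p$ makes $v^{p-q}$ increasing, so it can be estimated at $\kappa$. The bound
  -- $q>1$ gives $e<1$, hence integrability of $m(s)\sim s^{-e}$.
  obtain ⟨q, hq1, hqq, hqp⟩ : ∃ q : ℝ, 1 < q ∧ q ≤ q₀ ∧ q ≤ p :=
    ⟨min q₀ p, lt_min hq₀ hp, min_le_left _ _, min_le_right _ _⟩
  have hq0 : 0 < q := by linarith
  have hq1' : 0 < q - 1 := by linarith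
  set e := (p - q) / (p - 1) with he
  have he1 : e < 1 := by rw [he, div_lt_one hp1]; linarith
  have he1' : 0 < 1 - e := by linarith
  have heq : (q - 1) / (p - 1) = 1 - e := by rw [he]; field_simp; ring
  -- This absorbs the unit-ball volume, the factor from lowering the exponent and the constant $C$
  -- of the potential estimate.
  set c := (2 * ω * C) ^ (1 / q) with hc
  have hc0 : 0 < c := by positivity
  have hcq : c ^ q = 2 * ω * C := by
    rw [hc, ← Real.rpow_mul (by positivity), one_div_mul_cancel hq0.ne', Real.rpow_one]
  -- Chosen so that $h(\kappa(t))\int_0^tm=G^{p-1}/(1-e)$ equals $\delta$; the powers $t^{-(1-e)}$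
  -- and $t^{1-e}$ cancel.
  set G := (δ * (1 - e)) ^ (1 / (p - 1)) with hG
  have hG0 : 0 < G := by positivity
  have hGp : G ^ (p - 1) = δ * (1 - e) := by
    rw [hG, ← Real.rpow_mul (by positivity), one_div_mul_cancel hp1.ne', Real.rpow_one]
  have hexp : (N : ℝ) / (d * r0 N d p) = 1 / (p - 1) := by unfold r0; field_simp
  have hexp' : (N : ℝ) / r0 N d p = d / (p - 1) := by unfold r0; field_simp
  rw [hexp, hexp']
  refine ⟨G / c, by positivity, A * G, by positivity, fun φ hφ T hyp => ?_⟩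
  have hsol := hex (fun s => s ^ (q - 1)) (fun y => y ^ (1 / q))
    (fun a ha b _ hab => Real.rpow_le_rpow ha hab hq1'.le) (fun s hs => by positivity)
    (fun a ha b _ hab => Real.rpow_le_rpow ha hab (by positivity))
    (fun y hy => by positivity) ?_ φ T 1 (fun t => G * t ^ (-(1 / (p - 1))))
    (fun s => G ^ (p - q) * s ^ (-e)) hφ.aestronglyMeasurable one_pos (fun t ht _ => by positivity)
    ?_ ?_ ?_ ?_
  · obtain ⟨u, hu, hub⟩ := hsol
    refine ⟨u, hu, fun x t ht htT => (hub x t ht htT).trans_eq ?_⟩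
    ring
  · intro y hy
    rcases hy.eq_or_lt with rfl | hy'
    · rw [Real.zero_rpow (by positivity), zero_mul]
    · have h0 : 0 < y ^ (1 / q) := by positivity
      rw [mul_comm, ← Real.rpow_add_one h0.ne', sub_add_cancel, ← Real.rpow_mul hy,
        one_div_mul_cancel hq0.ne', Real.rpow_one]
  · intro τ hτ
    refine ⟨G * τ ^ (-(1 / (p - 1))), fun t ht _ => ?_⟩
    exact mul_le_mul_of_nonneg_left
      (Real.rpow_le_rpow_of_nonpos hτ ht.le (by rw [neg_nonpos]; positivity)) hG0.le
  · intro t ht htT z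
    set a := t ^ (1 / d) with ha
    have ha0 : 0 < a := by positivity
    have haT : ENNReal.ofReal a < T ^ (1 / d) := by
      rw [ha, ← ENNReal.ofReal_rpow_of_pos ht]
      exact ENNReal.rpow_lt_rpow htT (by positivity)
    obtain ⟨hint, hle⟩ := hyp z a ha0 haT
    have had : a ^ (d / (p - 1)) = t ^ (1 / (p - 1)) := by
      rw [ha, ← Real.rpow_mul ht.le]; congr 1; field_simp
    rw [had] at hle
    set l := G / c * t ^ (-(1 / (p - 1))) with hl
    have hl0 : 0 < l := by positivity
    set X := ⨍ y in ball z a, |φ y| ^ q₀ with hX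
    have hX0 : 0 ≤ X := by
      rw [hX, setAverage_eq]
      exact smul_nonneg (by positivity) (integral_nonneg fun y => by positivity)
    have hXl : X ≤ l ^ q₀ := by
      have h1 : X ^ (1 / q₀) ≤ l := by
        rw [hl, Real.rpow_neg ht.le, ← div_eq_mul_inv, le_div_iff₀ (by positivity)]
        linarith
      have h2 := Real.rpow_le_rpow (by positivity) h1 (show 0 ≤ q₀ by linarith)
      rwa [← Real.rpow_mul hX0, one_div_mul_cancel (by linarith), Real.rpow_one] at h2
    have hb := lintegral_ball_rpow_le ha0 hl0 hq0.le hqq hint hXl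
    have hmul : ∀ v : ℝ, 0 ≤ v → v * v ^ (q - 1) = v ^ q := by
      intro v hv
      rcases hv.eq_or_lt with rfl | hv'
      · rw [Real.zero_rpow hq0.ne', zero_mul]
      · rw [mul_comm, ← Real.rpow_add_one hv'.ne', sub_add_cancel]
    simp only [one_mul]
    simp_rw [hmul _ (abs_nonneg _)]
    refine hb.trans (ENNReal.ofReal_le_ofReal (le_of_eq ?_))
    rw [hmul _ (by positivity), ha, rpow_one_div_pow ht]
    have hlq : (G * t ^ (-(1 / (p - 1)))) ^ q = c ^ q * l ^ q := by
      rw [← Real.mul_rpow hc0.le hl0.le, hl]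
      congr 1; field_simp
    rw [hlq, hcq]
    change _ * (2 * ω * _) = _
    field_simp
  · intro t ht _ v hv hvk
    have h1 : v ^ (p - 1) = v ^ (p - q) * v ^ (q - 1) := by
      rw [← Real.rpow_add hv]; congr 1; ring
    have h2 : v ^ (p - q) ≤ G ^ (p - q) * t ^ (-e) := by
      refine (Real.rpow_le_rpow hv.le hvk (by linarith)).trans_eq ?_
      rw [Real.mul_rpow hG0.le (by positivity), ← Real.rpow_mul ht.le]
      congr 2
      rw [he]; ring
    rw [h1]
    exact mul_le_mul_of_nonneg_right h2 (by positivity)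
  · intro t ht _
    refine (mul_le_mul_right (lintegral_rpow_neg_le (by positivity) he1 ht) _).trans ?_
    rw [← ENNReal.ofReal_mul (by positivity)]
    refine ENNReal.ofReal_le_ofReal (le_of_eq ?_)
    rw [Real.one_rpow, mul_one, Real.mul_rpow hG0.le (by positivity), ← Real.rpow_mul ht.le,
      show -(1 / (p - 1)) * (q - 1) = -(1 - e) by rw [← heq]; ring]
    have h1 : G ^ (q - 1) * G ^ (p - q) = δ * (1 - e) := by
      rw [← Real.rpow_add hG0, ← hGp]; congr 1; ring
    have h2 : t ^ (-(1 - e)) * t ^ (1 - e) = 1 := by rw [← Real.rpow_add ht]; simp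
    calc G ^ (q - 1) * t ^ (-(1 - e)) * (G ^ (p - q) * (t ^ (1 - e) / (1 - e)))
        = (G ^ (q - 1) * G ^ (p - q)) * (t ^ (-(1 - e)) * t ^ (1 - e)) / (1 - e) := by ring
      _ = δ := by rw [h1, h2]; field_simp

/-! ### The case $r_0=1$: logarithmic averages -/

theorem Phi_strictMonoOn {β : ℝ} (hβ : 0 < β) : StrictMonoOn (Phi β) (Ici 0) := by
  intro a ha b hb hab
  simp only [mem_Ici] at ha hb
  have h1 := one_le_log_exp_add ha
  have h2 : Real.log (Real.exp 1 + a) ^ β ≤ Real.log (Real.exp 1 + b) ^ β :=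
    Real.rpow_le_rpow (by linarith) (Real.log_le_log (by positivity) (by linarith)) hβ.le
  exact mul_lt_mul hab h2 (Real.rpow_pos_of_pos (by linarith) _) hb

theorem PhiInv_nonneg {β : ℝ} (hβ : 0 < β) {y : ℝ} (hy : 0 ≤ y) : 0 ≤ PhiInv β y :=
  (Phi_bijOn hβ).surjOn.mapsTo_invFunOn hy

theorem Phi_PhiInv {β : ℝ} (hβ : 0 < β) {y : ℝ} (hy : 0 ≤ y) : Phi β (PhiInv β y) = y :=
  (Phi_bijOn hβ).surjOn.rightInvOn_invFunOn hy

theorem PhiInv_monotoneOn {β : ℝ} (hβ : 0 < β) : MonotoneOn (PhiInv β) (Ici 0) := by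
  intro a ha b hb hab
  rw [← (Phi_strictMonoOn hβ).le_iff_le (PhiInv_nonneg hβ ha) (PhiInv_nonneg hβ hb),
    Phi_PhiInv hβ ha, Phi_PhiInv hβ hb]
  exact hab

/-- `v^η log(e+v)^{-β}` is increasing up to a constant factor. -/
theorem exists_rpow_mul_log_le {η β : ℝ} (hη : 0 < η) (hβ : 0 < β) :
    ∃ c : ℝ, 0 < c ∧ ∀ v U : ℝ, 0 < v → v ≤ U →
      v ^ η * Real.log (Real.exp 1 + U) ^ β ≤ c * U ^ η * Real.log (Real.exp 1 + v) ^ β := by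
  have ha : 0 < η / β := by positivity
  refine ⟨(1 + 1 / (η / β)) ^ β, by positivity, fun v U hv hvU => ?_⟩
  have hU : 0 < U := hv.trans_le hvU
  set l := U / v with hl
  have hl1 : 1 ≤ l := by rw [hl, one_le_div hv]; exact hvU
  have hLv := one_le_log_exp_add hv.le
  have hLU := one_le_log_exp_add hU.le
  have h1 : Real.log (Real.exp 1 + U) ≤ Real.log l + Real.log (Real.exp 1 + v) := by
    rw [← Real.log_mul (by positivity) (by positivity)]
    refine Real.log_le_log (by positivity) ?_
    have h2 : l * v = U := by rw [hl]; field_simp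
    have h3 : 0 < Real.exp 1 := Real.exp_pos 1
    nlinarith
  have h2 : Real.log l ≤ l ^ (η / β) / (η / β) := Real.log_le_rpow_div (by linarith) ha
  have h3 : 1 ≤ l ^ (η / β) := Real.one_le_rpow hl1 ha.le
  have hlog0 : 0 ≤ Real.log l := Real.log_nonneg hl1
  have h4 : Real.log (Real.exp 1 + U) ≤
      (1 + 1 / (η / β)) * l ^ (η / β) * Real.log (Real.exp 1 + v) := by
    calc Real.log (Real.exp 1 + U) ≤ Real.log l + Real.log (Real.exp 1 + v) := h1
      _ ≤ (1 + Real.log l) * Real.log (Real.exp 1 + v) := by nlinarith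
      _ ≤ (l ^ (η / β) + l ^ (η / β) / (η / β)) * Real.log (Real.exp 1 + v) := by gcongr
      _ = _ := by ring
  have h5 := Real.rpow_le_rpow (by linarith) h4 hβ.le
  rw [Real.mul_rpow (by positivity) (by linarith), Real.mul_rpow (by positivity) (by positivity),
    ← Real.rpow_mul (by positivity), div_mul_cancel₀ _ hβ.ne', hl, Real.div_rpow hU.le hv.le] at h5
  have hvη : 0 < v ^ η := by positivity
  calc v ^ η * Real.log (Real.exp 1 + U) ^ β
      ≤ v ^ η * ((1 + 1 / (η / β)) ^ β * (U ^ η / v ^ η) * Real.log (Real.exp 1 + v) ^ β) := by gcongr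
    _ = _ := by field_simp

theorem log_two_mul_gt {R : ℝ} (hR : 1 < R) : 1 / 2 < Real.log (2 * R) := by
  have h := Real.log_two_gt_d9
  have := Real.log_lt_log two_pos (show 2 < 2 * R by linarith)
  linarith

theorem log_two_mul_le_log_exp_add {d R : ℝ} (hd : 0 < d) (hR : 1 < R) :
    Real.log (2 * R) ≤ (1 + d) * Real.log (Real.exp 1 + R ^ (1 / d)) := by
  have hR0 : 0 < R := by linarith
  have h1 : 1 ≤ Real.log (Real.exp 1 + R ^ (1 / d)) := one_le_log_exp_add (by positivity)
  have h2 : 1 / d * Real.log R ≤ Real.log (Real.exp 1 + R ^ (1 / d)) := by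
    rw [← Real.log_rpow hR0]
    exact Real.log_le_log (by positivity) (by linarith [Real.exp_pos 1])
  rw [Real.log_mul two_ne_zero hR0.ne']
  have h3 := Real.log_two_lt_d9
  have h4 : Real.log R ≤ d * Real.log (Real.exp 1 + R ^ (1 / d)) := by
    calc Real.log R = d * (1 / d * Real.log R) := by field_simp
      _ ≤ _ := by gcongr
  linarith

/-- Both `log (e + U)` and `log (2 R)` are comparable for `U = (R / log (2 R))^b`. -/
theorem log_two_mul_le_log_exp_add_div {b R : ℝ} (hb : 0 < b) (hR : 1 < R) :
    Real.log (2 * R) ≤ (2 / b + 2) * Real.log (Real.exp 1 + (R / Real.log (2 * R)) ^ b) := by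
  have hR0 : 0 < R := by linarith
  have hL := log_two_mul_gt hR
  set L := Real.log (2 * R) with hLdef
  have hL0 : 0 < L := by linarith
  have h1 : 1 ≤ Real.log (Real.exp 1 + (R / L) ^ b) := one_le_log_exp_add (by positivity)
  have h2 : b * Real.log (R / L) ≤ Real.log (Real.exp 1 + (R / L) ^ b) := by
    rw [← Real.log_rpow (by positivity)]
    exact Real.log_le_log (by positivity) (by linarith [Real.exp_pos 1])
  -- The iterated logarithm is absorbed into half of $L$, at the price of doubling the constants.
  have h3 : Real.log L ≤ L / 2 := by
    have := Real.log_le_sub_one_of_pos (show 0 < L / 2 by positivity)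
    rw [Real.log_div hL0.ne' two_ne_zero] at this
    linarith [Real.log_two_lt_d9]
  have h4 : L = Real.log 2 + Real.log R := by rw [hLdef, Real.log_mul two_ne_zero hR0.ne']
  rw [Real.log_div hR0.ne' hL0.ne'] at h2
  have h5 : Real.log R - Real.log L ≤ 1 / b * Real.log (Real.exp 1 + (R / L) ^ b) := by
    calc Real.log R - Real.log L = 1 / b * (b * (Real.log R - Real.log L)) := by field_simp
      _ ≤ _ := by gcongr
  have h6 := Real.log_two_lt_d9
  have h7 : (2 / b + 2) * Real.log (Real.exp 1 + (R / L) ^ b) =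
      2 * (1 / b * Real.log (Real.exp 1 + (R / L) ^ b)) + 2 * Real.log (Real.exp 1 + (R / L) ^ b) := by ring
  linarith

theorem div_log_rpow_le {b R : ℝ} (hb : 0 < b) (hR : 1 < R) :
    (R / Real.log (2 * R)) ^ b ≤ (2 * R) ^ b := by
  have hL := log_two_mul_gt hR
  refine Real.rpow_le_rpow (by apply div_nonneg <;> linarith) ?_ hb.le
  rw [div_le_iff₀ (by linarith)]
  nlinarith

theorem log_exp_add_div_le {b R : ℝ} (hb : 0 < b) (hR : 1 < R) :
    Real.log (Real.exp 1 + (R / Real.log (2 * R)) ^ b) ≤ (6 + b) * Real.log (2 * R) := by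
  have hL := log_two_mul_gt hR
  have hU := div_log_rpow_le hb hR
  have hU0 : 0 ≤ (R / Real.log (2 * R)) ^ b :=
    Real.rpow_nonneg (by apply div_nonneg <;> linarith) _
  have h1 : 1 ≤ (2 * R) ^ b := Real.one_le_rpow (by linarith) hb.le
  have he := Real.exp_pos 1
  calc Real.log (Real.exp 1 + (R / Real.log (2 * R)) ^ b)
      ≤ Real.log ((Real.exp 1 + 1) * (2 * R) ^ b) := by
        refine Real.log_le_log (by positivity) ?_
        nlinarith
    _ = Real.log (Real.exp 1 + 1) + b * Real.log (2 * R) := by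
        rw [Real.log_mul (by positivity) (by positivity), Real.log_rpow (by linarith)]
    _ ≤ (6 + b) * Real.log (2 * R) := by
        have h2 := Real.log_le_sub_one_of_pos (show 0 < Real.exp 1 + 1 by positivity)
        have h3 := Real.exp_one_lt_d9
        nlinarith

/-- The integrand is the derivative of $\beta^{-1}[\log(2T/s)]^{-\beta}$, which tends to $0$ as
$s\to0^+$. The factor $2$ keeps the logarithm away from $0$ up to $s=T$. -/
theorem lintegral_inv_mul_log_le {β t T : ℝ} (hβ : 0 < β) (ht : 0 < t) (htT : t < T) :
    ∫⁻ s in Ioo 0 t, ENNReal.ofReal (s⁻¹ * Real.log (2 * (T / s)) ^ (-1 - β)) ≤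
      ENNReal.ofReal (Real.log (2 * (T / t)) ^ (-β) / β) := by
  have hT : 0 < T := ht.trans htT
  have hlog : ∀ s, 0 < s → s ≤ t → 0 < Real.log (2 * (T / s)) := fun s hs hst => by
    have := log_two_mul_gt (show 1 < T / s by rw [one_lt_div hs]; linarith)
    linarith
  set Q : ℝ → ℝ := fun s => Real.log (2 * (T / s)) ^ (-β) / β with hQ
  have hderiv : ∀ s, 0 < s → s ≤ t →
      HasDerivAt Q (s⁻¹ * Real.log (2 * (T / s)) ^ (-1 - β)) s := by
    intro s hs hst
    have hl := hlog s hs hst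
    have h1 : HasDerivAt (fun s => 2 * (T / s)) (2 * (T * -(s ^ 2)⁻¹)) s := by
      simpa [div_eq_mul_inv] using ((hasDerivAt_inv hs.ne').const_mul T).const_mul 2
    have h2 := ((h1.log (by positivity)).rpow_const (p := -β) (Or.inl hl.ne')).div_const β
    refine h2.congr_deriv ?_
    rw [show -β - 1 = -1 - β by ring]
    field_simp
  have hcont : ContinuousOn Q (Icc 0 t) := by
    intro s hs
    rcases hs.1.eq_or_lt with rfl | hs0
    · have h1 : Filter.Tendsto (fun s : ℝ => 2 * (T / s)) (nhdsWithin 0 (Ioi 0)) Filter.atTop := by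
        have := (tendsto_inv_nhdsGT_zero (𝕜 := ℝ)).const_mul_atTop (show 0 < 2 * T by positivity)
        refine this.congr fun s => by rw [div_eq_mul_inv]; ring
      have h2 := ((tendsto_rpow_neg_atTop hβ).comp (Real.tendsto_log_atTop.comp h1)).div_const β
      -- The conventions $T/0=0$, $\log 0=0$ and $0^{-\beta}=0$ give $Q$ at $0$ precisely its limit
      -- from the right.
      have h0 : Q 0 = 0 / β := by simp [hQ, Real.zero_rpow (neg_ne_zero.2 hβ.ne')]
      have h3 : ContinuousWithinAt Q (Ioi 0) 0 := by
        rw [ContinuousWithinAt, h0]; exact h2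
      have h4 : ContinuousWithinAt Q (Ici 0) 0 := by
        rw [← Ioi_insert]; exact continuousWithinAt_insert_self.2 h3
      exact h4.mono Icc_subset_Ici_self
    · exact (hderiv s hs0 hs.2).continuousAt.continuousWithinAt
  have hpos : ∀ s ∈ Ioo 0 t, 0 ≤ s⁻¹ * Real.log (2 * (T / s)) ^ (-1 - β) := fun s hs =>
    mul_nonneg (inv_nonneg.2 hs.1.le) (Real.rpow_nonneg (hlog s hs.1 hs.2.le).le _)
  have hd : ∀ s ∈ Ioo 0 t, HasDerivAt Q (s⁻¹ * Real.log (2 * (T / s)) ^ (-1 - β)) s :=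
    fun s hs => hderiv s hs.1 hs.2.le
  have hint : IntegrableOn (fun s => s⁻¹ * Real.log (2 * (T / s)) ^ (-1 - β)) (Ioc 0 t) :=
    intervalIntegral.integrableOn_deriv_of_nonneg hcont hd hpos
  rw [← ofReal_integral_eq_lintegral_ofReal (hint.mono_set Ioo_subset_Ioc_self)
    ((ae_restrict_iff' measurableSet_Ioo).2 (Filter.Eventually.of_forall hpos))]
  refine ENNReal.ofReal_le_ofReal (le_of_eq ?_)
  rw [← integral_Ioc_eq_integral_Ioo, ← intervalIntegral.integral_of_le ht.le,
    intervalIntegral.integral_eq_sub_of_hasDerivAt_of_le ht.le hcont hd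
      ((intervalIntegrable_iff_integrableOn_Ioc_of_le ht.le).2 hint)]
  simp [hQ, Real.zero_rpow (neg_ne_zero.2 hβ.ne')]

/-- With $R=T/t$ the left side is $R^{N/d}[\log(e+R^{1/d})]^{-N/d}$, and $\log(2R)$ is at most
$(1+d)\log(e+R^{1/d})$. -/
theorem rho_le {d t T : ℝ} (hd : 0 < d) (ht : 0 < t) (htT : t < T) :
    rho N d (t ^ (1 / d) * T ^ (-(1 / d))) ≤
      (1 + d) ^ ((N : ℝ) / d) * (T / t / Real.log (2 * (T / t))) ^ ((N : ℝ) / d) := by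
  have hT : 0 < T := ht.trans htT
  have hR : 1 < T / t := by rw [one_lt_div ht]; exact htT
  have hL := log_two_mul_gt hR
  set R := T / t with hRdef
  have hR0 : 0 < R := by linarith
  have hs : t ^ (1 / d) * T ^ (-(1 / d)) = (R ^ (1 / d))⁻¹ := by
    rw [hRdef, Real.div_rpow hT.le ht.le, Real.rpow_neg hT.le, inv_div]
    exact (div_eq_mul_inv _ _).symm
  unfold rho
  rw [hs, inv_inv, Real.inv_rpow (by positivity), Real.rpow_neg (by positivity), inv_inv,
    ← Real.rpow_mul hR0.le, show 1 / d * (N : ℝ) = N / d by ring, Real.div_rpow hR0.le (by linarith),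
    Real.rpow_neg (Real.log_nonneg (by
      have := Real.add_one_le_exp (1 : ℝ)
      have : 0 < R ^ (1 / d) := by positivity
      linarith))]
  have h1 := log_two_mul_le_log_exp_add hd hR
  have hb : 0 ≤ (N : ℝ) / d := by positivity
  have h2 := Real.rpow_le_rpow (by linarith) h1 hb
  have h3 : 1 ≤ Real.log (Real.exp 1 + R ^ (1 / d)) := one_le_log_exp_add (by positivity)
  rw [Real.mul_rpow (by positivity) (by linarith)] at h2
  have hX : 0 < Real.log (2 * R) ^ ((N : ℝ) / d) := Real.rpow_pos_of_pos (by linarith) _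
  have hY : 0 < Real.log (Real.exp 1 + R ^ (1 / d)) ^ ((N : ℝ) / d) := Real.rpow_pos_of_pos (by linarith) _
  rw [← mul_div_assoc, le_div_iff₀ hX, mul_assoc, inv_mul_eq_div, mul_comm]
  rw [div_mul_eq_mul_div, div_le_iff₀ hY]
  have hRb : 0 < R ^ ((N : ℝ) / d) := by positivity
  nlinarith

theorem exists_solution_of_orlicz (N : ℕ) (hN : 1 ≤ N) (d p : ℝ) (hd : 0 < d) (hp : 1 < p)
    (hr : r0 N d p = 1) (β : ℝ) (hβ : 0 < β) :
    ∃ γ : ℝ, 0 < γ ∧ ∃ C : ℝ, 0 < C ∧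
      ∀ φ : Space N → ℝ, LocallyIntegrable φ → ∀ T : ℝ, 0 < T →
      (∀ (x : Space N) (σ : ℝ), 0 < σ → σ < T ^ (1 / d) →
        IntegrableOn (fun y => Phi β (T ^ ((N : ℝ) / d) * |φ y|)) (ball x σ) ∧
        PhiInv β (⨍ y in ball x σ, Phi β (T ^ ((N : ℝ) / d) * |φ y|)) ≤
          γ * rho N d (σ * T ^ (-(1 / d)))) →
      ∃ u : Space N → ℝ → ℝ, IsSolution N d p φ (ENNReal.ofReal T) u ∧
        ∀ (x : Space N) (t : ℝ), 0 < t → t < T →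
          |u x t| ≤ C * t ^ (-((N : ℝ) / d)) * |Real.log (t / (2 * T))| ^ (-((N : ℝ) / d)) := by
  obtain ⟨δ, hδ, A, hA, C, hC, hex⟩ := exists_solution_of_average N hd hp
  have hN' : (0 : ℝ) < N := by exact_mod_cast hN
  have hp1 : 0 < p - 1 := by linarith
  have hω := volume_real_unitBall_pos (N := N)
  set ω := volume.real (ball (0 : Space N) 1) with hωdef
  set b := (N : ℝ) / d with hb
  have hb0 : 0 < b := by positivity
  have hbp : b * (p - 1) = 1 := (show b * (p - 1) = r0 N d p by rw [hb, r0]; ring).trans hr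
  -- The power $v^{p-1}$ is split into two equal factors: one yields the small constant $k^\eta$,
  -- the other compensates the logarithms through quasi-monotonicity.
  set η := (p - 1) / 2 with hη
  have hη0 : 0 < η := by positivity
  obtain ⟨c₄, hc₄, hquasi⟩ := exists_rpow_mul_log_le hη0 hβ
  set c₅ := 2 / b + 2 with hc₅
  have hc₅0 : 0 < c₅ := by positivity
  set c₆ := 6 + b with hc₆
  have hc₆0 : 0 < c₆ := by positivity
  set K := c₄ * c₅ ^ β with hK
  have hK0 : 0 < K := by positivity
  set K' := K * c₆ ^ β / β with hK'
  have hK'0 : 0 < K' := by positivity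
  obtain ⟨k, hk0, hk1, hkδ⟩ : ∃ k : ℝ, 0 < k ∧ k ≤ 1 ∧ k ^ η * K' ≤ δ := by
    refine ⟨min 1 ((δ / K') ^ (1 / η)), lt_min one_pos (by positivity), min_le_left _ _, ?_⟩
    have h1 : (min 1 ((δ / K') ^ (1 / η))) ^ η ≤ ((δ / K') ^ (1 / η)) ^ η :=
      Real.rpow_le_rpow (le_min zero_le_one (by positivity)) (min_le_right _ _) hη0.le
    rw [← Real.rpow_mul (by positivity), one_div_mul_cancel hη0.ne', Real.rpow_one,
      le_div_iff₀ hK'0] at h1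
    exact h1
  -- Dividing the level by $B$ pays for $C\omega$ in the mass condition, while $B\ge1$ keeps $w\le
  -- kU$ so that the logarithmic factor can only grow.
  set B := max 1 (C * ω) with hB
  have hB1 : 1 ≤ B := le_max_left _ _
  have hB0 : 0 < B := by linarith
  set c₁ := (1 + d) ^ b with hc₁
  have hc₁0 : 0 < c₁ := by positivity
  refine ⟨k / (B * c₁), by positivity, A * k, by positivity, fun φ hφ T hT hyp => ?_⟩
  have hlt : ∀ {t}, ENNReal.ofReal t < ENNReal.ofReal T → t < T := fun h =>
    (ENNReal.ofReal_lt_ofReal_iff hT).1 h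
  set U : ℝ → ℝ := fun t => (T / t / Real.log (2 * (T / t))) ^ b with hU
  have hR1 : ∀ {t}, 0 < t → t < T → 1 < T / t := fun ht htT => by rw [one_lt_div ht]; exact htT
  have hL0 : ∀ {t}, 0 < t → t < T → 0 < Real.log (2 * (T / t)) := fun ht htT => by
    linarith [log_two_mul_gt (hR1 ht htT)]
  have hU0 : ∀ {t}, 0 < t → t < T → 0 < U t := fun ht htT => by
    have := hL0 ht htT
    positivity
  have hmonoh : MonotoneOn (fun s => Real.log (Real.exp 1 + s) ^ β) (Ici 0) := fun x hx y _ hxy => by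
    have hx0 : (0 : ℝ) ≤ x := hx
    exact Real.rpow_le_rpow (by linarith [one_le_log_exp_add hx0])
      (Real.log_le_log (by positivity) (by linarith)) hβ.le
  have hposh : ∀ s : ℝ, 0 ≤ s → 0 < Real.log (Real.exp 1 + s) ^ β := fun s hs =>
    Real.rpow_pos_of_pos (by linarith [one_le_log_exp_add hs]) _
  -- The scale $\theta=T^{N/d}$ satisfies $\theta^{p-1}=T$, because $r_0=1$ means $\frac Nd(p-1)=1$.
  -- For the same reason $U^{p-1}=(T/t)/\log(2T/t)$, which with the extra $[\log(2T/t)]^{-\beta}$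
  -- gives the form of $m$.
  have hsol := hex (fun s => Real.log (Real.exp 1 + s) ^ β) (PhiInv β) hmonoh (fun s hs => hposh s hs.le)
    (PhiInv_monotoneOn hβ) (fun y hy => PhiInv_nonneg hβ hy) (fun y hy => Phi_PhiInv hβ hy)
    φ (ENNReal.ofReal T) (T ^ b) (fun t => k * U t)
    (fun s => k ^ η * K * T * (s⁻¹ * Real.log (2 * (T / s)) ^ (-1 - β)))
    hφ.aestronglyMeasurable (by positivity)
    (fun t ht htT => mul_pos hk0 (hU0 ht (hlt htT))) ?_ ?_ ?_ ?_
  · obtain ⟨u, hu, hub⟩ := hsol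
    refine ⟨u, hu, fun x t ht htT => ?_⟩
    refine (hub x t ht ((ENNReal.ofReal_lt_ofReal_iff hT).2 htT)).trans_eq ?_
    have hL := hL0 ht htT
    have h1 : |Real.log (t / (2 * T))| = Real.log (2 * (T / t)) := by
      rw [show t / (2 * T) = (2 * (T / t))⁻¹ by field_simp, Real.log_inv, abs_neg, abs_of_pos hL]
    rw [h1, hU]
    simp only
    rw [Real.div_rpow (by positivity) hL.le, Real.div_rpow hT.le ht.le, Real.rpow_neg ht.le,
      Real.rpow_neg hL.le]
    have hTb : T ^ b ≠ 0 := by positivity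
    field_simp
  · intro τ hτ
    refine ⟨(2 * (T / τ)) ^ b, fun t ht htT => ?_⟩
    have ht0 := hτ.trans ht
    have h1 := div_log_rpow_le hb0 (hR1 ht0 (hlt htT))
    calc k * U t ≤ 1 * U t := mul_le_mul_of_nonneg_right hk1 (hU0 ht0 (hlt htT)).le
      _ ≤ (2 * (T / t)) ^ b := by rw [one_mul]; exact h1
      _ ≤ _ := by gcongr
  · intro t ht htT z
    have htT' := hlt htT
    have hUt := hU0 ht htT'
    have ha0 : 0 < t ^ (1 / d) := by positivity
    obtain ⟨hint, hle⟩ := hyp z (t ^ (1 / d)) ha0 (Real.rpow_lt_rpow ht.le htT' (by positivity))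
    have hPhi0 : ∀ y, 0 ≤ Phi β (T ^ b * |φ y|) := fun y =>
      (Phi_bijOn hβ).mapsTo (show (0 : ℝ) ≤ T ^ b * |φ y| by positivity)
    set X := ⨍ y in ball z (t ^ (1 / d)), Phi β (T ^ b * |φ y|) with hX
    have hX0 : 0 ≤ X := by
      rw [hX, setAverage_eq]
      exact smul_nonneg (by positivity) (integral_nonneg hPhi0)
    set w := k / B * U t with hw
    have hw0 : 0 < w := by positivity
    have hXw : X ≤ Phi β w := by
      rw [← Phi_PhiInv hβ hX0]
      refine (Phi_strictMonoOn hβ).monotoneOn (PhiInv_nonneg hβ hX0) hw0.le (hle.trans ?_)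
      calc k / (B * c₁) * rho N d (t ^ (1 / d) * T ^ (-(1 / d))) ≤ k / (B * c₁) * (c₁ * U t) := by
            gcongr
            exact rho_le hd ht htT'
        _ = w := by rw [hw]; field_simp
    refine (lintegral_ball_le_of_average_le ha0 hPhi0 hint hXw).trans (ENNReal.ofReal_le_ofReal ?_)
    rw [rpow_one_div_pow ht, mul_div_assoc]
    refine mul_le_mul_of_nonneg_left ?_ (by positivity)
    rw [le_div_iff₀ hC]
    have hkw : k * U t = B * w := by rw [hw]; field_simp
    have hwle : w ≤ k * U t := by rw [hkw]; exact le_mul_of_one_le_left hw0.le hB1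
    have hh := hmonoh hw0.le (hw0.le.trans hwle) hwle
    have hhw := hposh w hw0.le
    have hCB : C * ω ≤ B := le_max_right _ _
    calc ω * Phi β w * C = (C * ω) * w * Real.log (Real.exp 1 + w) ^ β := by unfold Phi; ring
      _ ≤ B * w * Real.log (Real.exp 1 + k * U t) ^ β := by gcongr
      _ = _ := by rw [hkw]
  · intro t ht htT v hv hvk
    have htT' := hlt htT
    have hUt := hU0 ht htT'
    have hL := hL0 ht htT'
    have hvU : v ≤ U t := hvk.trans (mul_le_of_le_one_left hUt.le hk1)
    have hq := hquasi v (U t) hv hvU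
    have hLU : (Real.log (2 * (T / t))) ^ β ≤ c₅ ^ β * Real.log (Real.exp 1 + U t) ^ β := by
      rw [← Real.mul_rpow hc₅0.le (by linarith [one_le_log_exp_add hUt.le])]
      exact Real.rpow_le_rpow hL.le (log_two_mul_le_log_exp_add_div hb0 (hR1 ht htT')) hβ.le
    have hUp : U t ^ η * U t ^ η = T * t⁻¹ * (Real.log (2 * (T / t)))⁻¹ := by
      rw [← Real.rpow_add hUt, hU]
      simp only
      rw [← Real.rpow_mul (by positivity), show b * (η + η) = b * (p - 1) by rw [hη]; ring, hbp, Real.rpow_one]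
      rw [div_eq_mul_inv, div_eq_mul_inv]
    have hvp : v ^ (p - 1) = v ^ η * v ^ η := by rw [← Real.rpow_add hv]; congr 1; rw [hη]; ring
    have hvη : v ^ η ≤ k ^ η * U t ^ η := by
      rw [← Real.mul_rpow hk0.le hUt.le]
      exact Real.rpow_le_rpow hv.le hvk hη0.le
    set L := Real.log (2 * (T / t))
    have hLβ : 0 < L ^ β := by positivity
    have hhv := hposh v hv.le
    have h1 : v ^ η * L ^ β ≤ K * U t ^ η * Real.log (Real.exp 1 + v) ^ β := by
      calc v ^ η * L ^ β ≤ v ^ η * (c₅ ^ β * Real.log (Real.exp 1 + U t) ^ β) := by gcongr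
        _ = c₅ ^ β * (v ^ η * Real.log (Real.exp 1 + U t) ^ β) := by ring
        _ ≤ c₅ ^ β * (c₄ * U t ^ η * Real.log (Real.exp 1 + v) ^ β) := by gcongr
        _ = _ := by rw [hK]; ring
    have h2 : v ^ (p - 1) * L ^ β ≤ k ^ η * K * T * (t⁻¹ * L⁻¹) * Real.log (Real.exp 1 + v) ^ β := by
      calc v ^ (p - 1) * L ^ β = v ^ η * (v ^ η * L ^ β) := by rw [hvp]; ring
        _ ≤ (k ^ η * U t ^ η) * (K * U t ^ η * Real.log (Real.exp 1 + v) ^ β) := by gcongr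
        _ = k ^ η * K * (U t ^ η * U t ^ η) * Real.log (Real.exp 1 + v) ^ β := by ring
        _ = _ := by rw [hUp]; ring
    have h3 : L ^ (-1 - β) = L⁻¹ * (L ^ β)⁻¹ := by
      rw [Real.rpow_sub hL, Real.rpow_neg_one, div_eq_mul_inv]
    rw [h3]
    calc v ^ (p - 1) = v ^ (p - 1) * L ^ β * (L ^ β)⁻¹ := by field_simp
      _ ≤ k ^ η * K * T * (t⁻¹ * L⁻¹) * Real.log (Real.exp 1 + v) ^ β * (L ^ β)⁻¹ := by gcongr
      _ = _ := by ring
  · intro t ht htT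
    have htT' := hlt htT
    have hUt := hU0 ht htT'
    have hL := hL0 ht htT'
    have hθ : (T ^ b) ^ (p - 1) = T := by rw [← Real.rpow_mul hT.le, hbp, Real.rpow_one]
    have hsplit : ∫⁻ s in Ioo 0 t,
        ENNReal.ofReal (k ^ η * K * T * (s⁻¹ * Real.log (2 * (T / s)) ^ (-1 - β))) ≤
        ENNReal.ofReal (k ^ η * K * T * (Real.log (2 * (T / t)) ^ (-β) / β)) := by
      rw [ENNReal.ofReal_mul (by positivity : 0 ≤ k ^ η * K * T)]
      simp_rw [ENNReal.ofReal_mul (by positivity : 0 ≤ k ^ η * K * T)]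
      rw [lintegral_const_mul' _ _ ENNReal.ofReal_ne_top]
      gcongr
      exact lintegral_inv_mul_log_le hβ ht htT'
    refine (mul_le_mul_right hsplit _).trans ?_
    have hkU : k * U t ≤ U t := mul_le_of_le_one_left hUt.le hk1
    have hh : Real.log (Real.exp 1 + k * U t) ^ β ≤ c₆ ^ β * Real.log (2 * (T / t)) ^ β := by
      refine (hmonoh (mul_pos hk0 hUt).le hUt.le hkU).trans ?_
      simp only
      rw [← Real.mul_rpow hc₆0.le hL.le]
      exact Real.rpow_le_rpow (by linarith [one_le_log_exp_add hUt.le])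
        (log_exp_add_div_le hb0 (hR1 ht htT')) hβ.le
    rw [← ENNReal.ofReal_mul (hposh _ (mul_pos hk0 hUt).le).le, hθ]
    refine ENNReal.ofReal_le_ofReal ?_
    set L := Real.log (2 * (T / t))
    -- The growth $L^\beta$ of $h(\kappa(t))$ is exactly the decay $L^{-\beta}$ of $\int_0^tm$
    -- inverted, so only the small factor $k^\eta$ is left.
    have hLL : L ^ β * L ^ (-β) = 1 := by rw [← Real.rpow_add hL]; simp
    calc Real.log (Real.exp 1 + k * U t) ^ β * (k ^ η * K * T * (L ^ (-β) / β))
        ≤ c₆ ^ β * L ^ β * (k ^ η * K * T * (L ^ (-β) / β)) := by gcongr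
      _ = k ^ η * K' * T * (L ^ β * L ^ (-β)) := by rw [hK']; ring
      _ ≤ δ * T := by rw [hLL, mul_one]; gcongr

end FracHeat

end

theorem theorem7p1 (N : ℕ) (hN : 1 ≤ N) (d p : ℝ) (hd : 0 < d) (hp : 1 < p) :
    -- the case `r_0 < 1`
    (r0 N d p < 1 →
      ∃ γ : ℝ, 0 < γ ∧ ∃ C : ℝ, 0 < C ∧
        ∀ φ : Space N → ℝ, LocallyIntegrable φ → ∃ C' : ℝ, 0 < C' ∧
        ∀ T : ℝ, 0 < T →
        (∀ x : Space N,
          (⨍ y in ball x (T ^ (1 / d)), |φ y|) ≤ γ * T ^ (-((N : ℝ) / (d * r0 N d p)))) →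
        ∃ u : Space N → ℝ → ℝ, IsSolution N d p φ (ENNReal.ofReal T) u ∧
          ∀ (x : Space N) (t : ℝ), 0 < t → t < T →
            |u x t| ≤ C * T ^ (-((N : ℝ) / d * (1 / r0 N d p - 1))) * t ^ (-((N : ℝ) / d)) ∧
            |u x t| ≤ C' * t ^ (-((N : ℝ) / d))) ∧
    -- the case `r_0 > 1`; here `T = ∞` is allowed
    (1 < r0 N d p →
      ∀ q : ℝ, 1 < q →
      ∃ γ : ℝ, 0 < γ ∧ ∃ C : ℝ, 0 < C ∧
        ∀ φ : Space N → ℝ, LocallyIntegrable φ → ∀ T : ℝ≥0∞, 0 < T →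
        (∀ (x : Space N) (σ : ℝ), 0 < σ → ENNReal.ofReal σ < T ^ (1 / d) →
          IntegrableOn (fun y => |φ y| ^ q) (ball x σ) ∧
          σ ^ ((N : ℝ) / r0 N d p) * (⨍ y in ball x σ, |φ y| ^ q) ^ (1 / q) ≤ γ) →
        ∃ u : Space N → ℝ → ℝ, IsSolution N d p φ T u ∧
          ∀ (x : Space N) (t : ℝ), 0 < t → ENNReal.ofReal t < T →
            |u x t| ≤ C * t ^ (-((N : ℝ) / (d * r0 N d p)))) ∧
    -- the case `r_0 = 1`
    (r0 N d p = 1 →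
      ∀ β : ℝ, 0 < β →
      ∃ γ : ℝ, 0 < γ ∧ ∃ C : ℝ, 0 < C ∧
        ∀ φ : Space N → ℝ, LocallyIntegrable φ → ∀ T : ℝ, 0 < T →
        (∀ (x : Space N) (σ : ℝ), 0 < σ → σ < T ^ (1 / d) →
          IntegrableOn (fun y => Phi β (T ^ ((N : ℝ) / d) * |φ y|)) (ball x σ) ∧
          PhiInv β (⨍ y in ball x σ, Phi β (T ^ ((N : ℝ) / d) * |φ y|)) ≤
            γ * rho N d (σ * T ^ (-(1 / d)))) →
        ∃ u : Space N → ℝ → ℝ, IsSolution N d p φ (ENNReal.ofReal T) u ∧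
          ∀ (x : Space N) (t : ℝ), 0 < t → t < T →
            |u x t| ≤ C * t ^ (-((N : ℝ) / d)) * |Real.log (t / (2 * T))| ^ (-((N : ℝ) / d))) := by
  exact ⟨exists_solution_of_r0_lt_one N hN d p hd hp,
    fun _ q hq => by
      obtain ⟨γ, hγ, C, hC, h⟩ := exists_solution_of_morrey N hN d p hd hp q hq
      exact ⟨γ, hγ, C, hC, fun φ hφ T _ => h φ hφ T⟩,
    exists_solution_of_orlicz N hN d p hd hp⟩
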